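/- **Theorem 2 (dense case).** *Setting.* Fix $r\ge 1$. For every sample size $n$ let there be given integers $M=M_n\ge r$, $m=m_n\ge1$, a known noise level $\sigma=\sigma_n>0$ with $\sigma^2\le m$, and continuous functions $\phi_1,\dots,\phi_M$ on $[0,1]$, orthonormal in $L^2[0,1]$; put $\phi=(\phi_1,\dots,\phi_M)^T$. One observes $T_i=(T_{ij})_{j\le m}\in[0,1]^m$ and $$Y_{ij}=X_i(T_{ij})+\sigma\varepsilon_{ij},\qquad 1\le i\le n,\ 1\le j\le m,$$ where the $\varepsilon_{ij}$ are i.i.d. $N(0,1)$, the $X_i$ are i.i.d. jointly measurable Gaussian processes on $[0,1]$ with mean $0$ and covariance kernel $\overline\Sigma_0$, and the design $\mathbf T=(T_{ij})$, which may be random (with an arbitrary joint law) or non-random, the processes and the noise are independent. $\overline\Sigma_0$ is fixed or, more generally, may depend on $n$, and $\overline\Sigma_0(u,v)=\sum_{k\ge1}\overline\lambda_k\overline\psi_k(u)\overline\psi_k(v)$ on $[0,1]^2$ with $\overline\psi_k$ orthonormal in $L^2[0,1]$, $\overline\lambda_1\ge\overline\lambda_2\ge\cdots\ge0$ and $\sum_k\overline\lambda_k<\infty$.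 Let $\|\cdot\|$ be the operator norm and $\|\cdot\|_F$ the Frobenius norm of matrices, and also the Hilbert–Schmidt ($L^2([0,1]^2)$) norm of kernels. Let $\Omega$ be the set of pairs $(B,\Lambda)$ with $B\in\mathbb R^{M\times r}$, $B^TB=I_r$, and $\Lambda=\mathrm{diag}(\lambda_1,\dots,\lambda_r)$, all $\lambda_k>0$. Write $\Phi_i=[\phi(T_{i1}):\cdots:\phi(T_{im})]$, $R_i=\frac1m\Phi_i\Phi_i^T$, $\overline\Sigma_i=(\overline\Sigma_0(T_{ij},T_{ij'}))_{j,j'}+\sigma^2I_m$, $\Sigma_i=\Sigma_i(B,\Lambda)=\Phi_i^TB\Lambda B^T\Phi_i+\sigma^2I_m$, $\Gamma_i=\frac1m\Phi_i\Sigma_i\Phi_i^T$, $\widetilde Y_i=\Phi_iY_i$. The REML estimator minimizes over $\Omega$ $$\widetilde L_n(B,\Lambda)=\frac1{2n}\sum_{i=1}^n\mathrm{tr}\Big(\Gamma_i^{-1}\tfrac1m\widetilde Y_i\widetilde Y_i^T\Big)+\frac1{2n}\sum_{i=1}^n\log|\Gamma_i| .$$ The optimal parameter $(B_*,\Lambda_*)=(B_{*,n},\Lambda_{*,n})\in\Omega$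 has $\lambda_{*1}>\cdots>\lambda_{*r}>0$; put $\Sigma_{*i}=\Sigma_i(B_*,\Lambda_*)$ and $\Sigma_{*0}(u,v)=\phi(u)^TB_*\Lambda_*B_*^T\phi(v)$. *Assumptions.* As $n\to\infty$, $M\log n=o(n)$ and $\|\overline\Sigma_0-\Sigma_{*0}\|_F=O(\sqrt{M\log n/n})$, and, with $c_1,c_2,C_0$ not depending on $n$: - **A1**: $c_1\ge\overline\lambda_1>\cdots>\overline\lambda_r>\overline\lambda_{r+1}$ and $\max_{1\le j\le r}(\overline\lambda_j-\overline\lambda_{j+1})^{-1}\le c_2$. - **A2**: $\overline\psi_1,\dots,\overline\psi_r$ are four times continuously differentiable on $[0,1]$ and $\max_{k\le r}\|\overline\psi_k^{(4)}\|_\infty\le C_0$. - **B1'**: $m=O(n^\kappa)$ for some $\kappa>0$. - **C'**: for every $\eta>0$ there is $c_\eta>0$ such that, with probability at least $1-O(n^{-\eta})$, $\max_{i\le n}\frac1m\|\overline\Sigma_i-\Sigma_{*i}\|_F\le c_\eta\frac{\sigma^2}m\sqrt{\frac{M\log n}n}$. - **D**: for every $\eta>0$ there are $c_{1,\eta},c_{2,\eta}>0$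 such that, with probability at least $1-O(n^{-\eta})$, $\max_{i\le n}\|R_i-I_M\|\le c_{1,\eta}\sqrt{\frac{\sigma^2}{m\log n}}$ and $\max_{i\le n}\|B_*^TR_iB_*-I_r\|\le c_{2,\eta}\frac{\sigma^2}{m\log n}$. *Conclusion.* For every $\eta>0$ there are $c_{0,\eta}>0$ and $c'_\eta>0$ such that, with $\alpha_n=c_{0,\eta}\,\sigma\sqrt{\frac{M\log n}{nm}}$, with probability at least $1-O(n^{-\eta})$ there is a minimizer $(\widehat B,\widehat\Lambda)$ of $\widetilde L_n$ over $\Omega$ satisfying $$\|(I_M-B_*B_*^T)(\widehat B-B_*)\|_F\le\alpha_n,\qquad \|B_*^T(\widehat B-B_*)\|_F\le\sqrt{\tfrac m{\sigma^2}}\,\alpha_n,\qquad \|\widehat\Lambda-\Lambda_*\|_F\le\sqrt{\tfrac m{\sigma^2}}\,\alpha_n,$$ and the corresponding estimated kernel $\widehat\Sigma_0(u,v)=\phi(u)^T\widehat B\widehat\Lambda\widehat B^T\phi(v)$ satisfies $$\|\widehat\Sigma_0-\overline\Sigma_0\|_F\le c'_\eta\sqrt{\tfrac{M\log n}n}.$$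 -/

import Mathlib

open MeasureTheory ProbabilityTheory Filter Topology
open scoped ENNReal

noncomputable section

namespace REML

/-! ### Norms -/

/-- Frobenius norm of a real matrix. -/
def frob {p q : ℕ} (A : Matrix (Fin p) (Fin q) ℝ) : ℝ :=
  Real.sqrt (∑ i, ∑ j, A i j ^ 2)

/-- Operator (spectral) norm of a real square matrix, with respect to the Euclidean norm. -/
def opNorm {p : ℕ} (A : Matrix (Fin p) (Fin p) ℝ) : ℝ :=
  ‖Matrix.toEuclideanCLM (n := Fin p) (𝕜 := ℝ) A‖

/-- Hilbert–Schmidt distance of two kernels on `[0,1]`, i.e. the `L²([0,1]²)` norm of the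
difference. -/
def hsDist (K K' : unitInterval → unitInterval → ℝ) : ℝ≥0∞ :=
  eLpNorm (fun p : unitInterval × unitInterval => K p.1 p.2 - K' p.1 p.2) 2 (volume.prod volume)

/-! ### The stochastic process and its covariance kernel -/

/-- `X` is a (jointly measurable) Gaussian process on `[0,1]`, defined on the probability space
`(𝒳, ν)`, with mean zero and covariance kernel `K`. -/
structure IsCenteredGaussian {𝒳 : Type*} [MeasurableSpace 𝒳] (ν : Measure 𝒳)
    (X : unitInterval → 𝒳 → ℝ) (K : unitInterval → unitInterval → ℝ) : Prop where
  measurable : Measurable fun p : unitInterval × 𝒳 => X p.1 p.2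
  gaussian : IsGaussianProcess X ν
  mean_zero : ∀ t, ∫ x, X t x ∂ν = 0
  covariance : ∀ u v, ∫ x, X u x * X v x ∂ν = K u v

/-- The spectral decomposition `K(u,v) = ∑ₖ lamₖ psiₖ(u) psiₖ(v)` of a covariance kernel, with
orthonormal eigenfunctions `psiₖ` and summable, nonnegative, nonincreasing eigenvalues `lamₖ`.
Indices start at `0`: the `k`-th largest eigenvalue is `lam (k - 1)`. -/
structure IsSpectralDecomposition (K : unitInterval → unitInterval → ℝ) (lam : ℕ → ℝ)
    (psi : ℕ → ℝ → ℝ) : Prop where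
  nonneg : ∀ k, 0 ≤ lam k
  antitone : Antitone lam
  summable : Summable lam
  memLp : ∀ k, MemLp (fun t : unitInterval => psi k t) 2 volume
  orthonormal : ∀ k l, ∫ t : unitInterval, psi k t * psi l t = if k = l then 1 else 0
  hasSum : ∀ u v : unitInterval, HasSum (fun k => lam k * psi k u * psi k v) (K u v)

/-- Condition A1 with constants `c₁`, `c₂`: the `r` largest eigenvalues are bounded by `c₁`,
distinct, and separated from each other and from the `(r+1)`-st one by gaps of size at least
`1 / c₂`. -/
def CondA1 (r : ℕ) (c₁ c₂ : ℝ) (lam : ℕ → ℝ) : Prop :=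
  lam 0 ≤ c₁ ∧ ∀ j < r, lam (j + 1) < lam j ∧ (lam j - lam (j + 1))⁻¹ ≤ c₂

/-- Condition A2 with constant `C₀`: the first `r` eigenfunctions are four times continuously
differentiable on `[0,1]`, with fourth derivative bounded by `C₀`. -/
def CondA2 (r : ℕ) (C₀ : ℝ) (psi : ℕ → ℝ → ℝ) : Prop :=
  ∀ k < r, ContDiffOn ℝ 4 (psi k) (Set.Icc 0 1) ∧
    ∀ t ∈ Set.Icc (0 : ℝ) 1, |iteratedDerivWithin 4 (psi k) (Set.Icc 0 1) t| ≤ C₀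

/-! ### The model space -/

/-- `φ₁, …, φ_M` are continuous and orthonormal in `L²[0,1]`. -/
structure IsOrthonormalBasis {M : ℕ} (φ : Fin M → unitInterval → ℝ) : Prop where
  continuous : ∀ k, Continuous (φ k)
  orthonormal : ∀ k l, ∫ t, φ k t * φ l t = if k = l then 1 else 0

/-- The parameter space: an `M × r` matrix `B` with orthonormal columns and positive
`lam₁, …, lam_r`. -/
def paramSpace (M r : ℕ) : Set (Matrix (Fin M) (Fin r) ℝ × (Fin r → ℝ)) :=
  {θ | θ.1.transpose * θ.1 = 1 ∧ ∀ k, 0 < θ.2 k}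

/-- The finite rank kernel `∑ₖ lamₖ psiₖ(u) psiₖ(v)` with `(psi₁, …, psi_r) = φᵀ B`. -/
def modelKernel {M r : ℕ} (φ : Fin M → unitInterval → ℝ) (B : Matrix (Fin M) (Fin r) ℝ)
    (lam : Fin r → ℝ) (u v : unitInterval) : ℝ :=
  ∑ k, lam k * (∑ l, φ l u * B l k) * (∑ l, φ l v * B l k)

/-! ### Quantities attached to the design points `t = (t₁, …, t_m)` of one curve -/

/-- The `M × m` matrix `Φ` with columns `φ(t₁), …, φ(t_m)`. -/
def designMatrix {M m : ℕ} (φ : Fin M → unitInterval → ℝ) (t : Fin m → unitInterval) :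
    Matrix (Fin M) (Fin m) ℝ :=
  Matrix.of fun k j => φ k (t j)

/-- `R = (1/m) Φ Φᵀ`. -/
def designGram {M m : ℕ} (φ : Fin M → unitInterval → ℝ) (t : Fin m → unitInterval) :
    Matrix (Fin M) (Fin M) ℝ :=
  (1 / (m : ℝ)) • (designMatrix φ t * (designMatrix φ t).transpose)

/-- The true covariance `((K(t_j, t_j')))_{j,j'} + σ² I` of the observations of one curve. -/
def trueCov {m : ℕ} (σ : ℝ) (K : unitInterval → unitInterval → ℝ) (t : Fin m → unitInterval) :
    Matrix (Fin m) (Fin m) ℝ :=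
  Matrix.of (fun j j' => K (t j) (t j')) + σ ^ 2 • (1 : Matrix (Fin m) (Fin m) ℝ)

/-- The model covariance `Φᵀ B Λ Bᵀ Φ + σ² I` of the observations of one curve. -/
def modelCov {M m r : ℕ} (σ : ℝ) (φ : Fin M → unitInterval → ℝ) (t : Fin m → unitInterval)
    (B : Matrix (Fin M) (Fin r) ℝ) (lam : Fin r → ℝ) : Matrix (Fin m) (Fin m) ℝ :=
  (designMatrix φ t).transpose * B * Matrix.diagonal lam * B.transpose * designMatrix φ t
    + σ ^ 2 • (1 : Matrix (Fin m) (Fin m) ℝ)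

/-- `Γ = (1/m) Φ Σ Φᵀ`, where `Σ` is the model covariance. -/
def transCov {M m r : ℕ} (σ : ℝ) (φ : Fin M → unitInterval → ℝ) (t : Fin m → unitInterval)
    (B : Matrix (Fin M) (Fin r) ℝ) (lam : Fin r → ℝ) : Matrix (Fin M) (Fin M) ℝ :=
  (1 / (m : ℝ)) •
    (designMatrix φ t * modelCov σ φ t B lam * (designMatrix φ t).transpose)

/-! ### The transformed likelihood and the REML estimator -/

/-- The negative log-likelihood (up to scaling and an additive constant) of the transformed data
`Ỹᵢ = Φᵢ Yᵢ`:
`(1/2n) ∑ᵢ tr(Γᵢ⁻¹ (1/m) Ỹᵢ Ỹᵢᵀ) + (1/2n) ∑ᵢ log |Γᵢ|`. -/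
def transNegLogLik {n M m r : ℕ} (σ : ℝ) (φ : Fin M → unitInterval → ℝ)
    (T : Fin n → Fin m → unitInterval)
    (Y : Fin n → Fin m → ℝ) (θ : Matrix (Fin M) (Fin r) ℝ × (Fin r → ℝ)) : ℝ :=
  1 / (2 * (n : ℝ)) * ∑ i, Matrix.trace ((transCov σ φ (T i) θ.1 θ.2)⁻¹ *
      ((1 / (m : ℝ)) • Matrix.vecMulVec (Matrix.mulVec (designMatrix φ (T i)) (Y i))
        (Matrix.mulVec (designMatrix φ (T i)) (Y i))))
    + 1 / (2 * (n : ℝ)) * ∑ i, Real.log (transCov σ φ (T i) θ.1 θ.2).det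

/-- `(B, lam)` is a (global) minimizer over the parameter space of the negative log-likelihood of
the transformed data. -/
def IsREMLEstimate {n M m r : ℕ} (σ : ℝ) (φ : Fin M → unitInterval → ℝ)
    (T : Fin n → Fin m → unitInterval)
    (Y : Fin n → Fin m → ℝ) (B : Matrix (Fin M) (Fin r) ℝ) (lam : Fin r → ℝ) : Prop :=
  (B, lam) ∈ paramSpace M r ∧ IsMinOn (transNegLogLik σ φ T Y) (paramSpace M r) (B, lam)

/-! ### The sample -/

/-- The sample space for `n` curves with `m` measurements each: the design points `T`, the
underlying random elements `x₁, …, x_n` that drive the curves `X₁ = X(·, x₁), …, X_n = X(·, x_n)`,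
and the noise variables `ε`. -/
abbrev Sample (n m : ℕ) (𝒳 : Type*) : Type _ :=
  (Fin n → Fin m → unitInterval) × (Fin n → 𝒳) × (Fin n → Fin m → ℝ)

/-- The law of the sample: the design has an arbitrary law `τ` (a Dirac mass if it is non-random),
the curves are i.i.d., the noise variables are i.i.d. standard normal, and design, curves and noise
are independent. -/
def sampleLaw {n m : ℕ} {𝒳 : Type*} [MeasurableSpace 𝒳]
    (τ : Measure (Fin n → Fin m → unitInterval))
    (ν : Measure 𝒳) : Measure (Sample n m 𝒳) :=
  τ.prod ((Measure.pi fun _ : Fin n => ν).prod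
    (Measure.pi fun _ : Fin n => Measure.pi fun _ : Fin m => gaussianReal 0 1))

/-- The observations `Y_{ij} = Xᵢ(T_{ij}) + σ ε_{ij}`. -/
def obs {n m : ℕ} {𝒳 : Type*} (σ : ℝ) (X : unitInterval → 𝒳 → ℝ) (ω : Sample n m 𝒳) :
    Fin n → Fin m → ℝ :=
  fun i j => X (ω.1 i j) (ω.2.1 i) + σ * ω.2.2 i j

/-! ### Asymptotic conditions -/

/-- The events `E n` have probability at least `1 - O(n^{-η})` (as `n → ∞`). -/
def HighProb {Ω : ℕ → Type*} [∀ n, MeasurableSpace (Ω n)] (P : ∀ n, Measure (Ω n)) (η : ℝ)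
    (E : ∀ n, Set (Ω n)) : Prop :=
  ∃ C : ℝ, ∀ᶠ n : ℕ in atTop, P n (E n)ᶜ ≤ ENNReal.ofReal (C * (n : ℝ) ^ (-η))

/-- The rate `√(M log n / n)`. -/
def rate (M : ℕ → ℕ) (n : ℕ) : ℝ := Real.sqrt (M n * Real.log n / n)

/-- Condition B1': `m = O(n^κ)` for some `κ > 0`. -/
def CondB1' (m : ℕ → ℕ) : Prop :=
  ∃ κ : ℝ, 0 < κ ∧ (fun n => (m n : ℝ)) =O[atTop] fun n => (n : ℝ) ^ κ

/-- Condition C': for every `η > 0` there is `c > 0` such that, with probability at least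
`1 - O(n^{-η})`, the maximal approximation error `maxᵢ (1/m) ‖Σ̄ᵢ - Σ_{*i}‖_F` is at most
`c (σ²/m) √(M log n / n)`. -/
def CondC' {r : ℕ} {M m : ℕ → ℕ} (σ : ℕ → ℝ) (K : ∀ _ : ℕ, unitInterval → unitInterval → ℝ)
    (φ : ∀ n, Fin (M n) → unitInterval → ℝ) (Bs : ∀ n, Matrix (Fin (M n)) (Fin r) ℝ)
    (lams : ℕ → Fin r → ℝ) (τ : ∀ n, Measure (Fin n → Fin (m n) → unitInterval)) : Prop :=
  ∀ η : ℝ, 0 < η → ∃ c : ℝ, 0 < c ∧ HighProb τ η fun n =>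
    {T | ∀ i, 1 / (m n : ℝ) *
        frob (trueCov (σ n) (K n) (T i) - modelCov (σ n) (φ n) (T i) (Bs n) (lams n))
      ≤ c * (σ n ^ 2 / m n) * rate M n}

/-- Condition D: for every `η > 0` there are `c₁, c₂ > 0` such that, with probability at least
`1 - O(n^{-η})`, for all `i`, `‖Rᵢ - I‖ ≤ c₁ √(σ²/(m log n))` and
`‖B_*ᵀ Rᵢ B_* - I‖ ≤ c₂ σ²/(m log n)`. -/
def CondD {r : ℕ} {M m : ℕ → ℕ} (σ : ℕ → ℝ)
    (φ : ∀ n, Fin (M n) → unitInterval → ℝ) (Bs : ∀ n, Matrix (Fin (M n)) (Fin r) ℝ)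
    (τ : ∀ n, Measure (Fin n → Fin (m n) → unitInterval)) : Prop :=
  ∀ η : ℝ, 0 < η → ∃ c₁ c₂ : ℝ, 0 < c₁ ∧ 0 < c₂ ∧ HighProb τ η fun n =>
    {T | ∀ i, opNorm (designGram (φ n) (T i) - 1)
          ≤ c₁ * Real.sqrt (σ n ^ 2 / (m n * Real.log n)) ∧
        opNorm ((Bs n).transpose * designGram (φ n) (T i) * Bs n - 1)
          ≤ c₂ * (σ n ^ 2 / (m n * Real.log n))}

end REML

end

/-! Write `s = σ²/m`. Since `Γᵢ = m Rᵢ (B Λ Bᵀ + s Rᵢ⁻¹) Rᵢ`, the transformed likelihood is, up to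
terms free of the parameter, the Gaussian likelihood of the reduced data `zᵢ = (1/m) Rᵢ⁻¹ Φᵢ Yᵢ`
with covariance `Xᵢ = A + s Eᵢ`, where `A = B Λ Bᵀ + s I` and `Eᵢ = Rᵢ⁻¹ - I` is small by condition
D. Errors are measured relative to `A_* = B_* Λ_* B_*ᵀ + s I`, which is of order one on the range of
`B_*` but only `s` on its orthogonal complement. This anisotropy is the source of the two different
rates.

Deterministic core. Let `(B, Λ)` be at least as likely as the optimum. Diagonalize `A_*` and `A`
simultaneously, with relative eigenvalues `h_j`, and put `g_j = 1/h_j - 1`. An exact expansion of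
the inverse (`inv_expansion`) bounds the loss difference from below by a multiple of `∑ (h_j -
1)²/(h_j (h_j + 1))` minus noise terms weighted by the `g_j` (`loss_lower_bound`). The noise is
always taken at the optimum, through the forms `∑ᵢ ((x·X_{*i}⁻¹ zᵢ)² - x·X_{*i}⁻¹ x)`, so a bound
`ε` uniform over directions `x` suffices and no uniformity over parameters is needed. As `A - A_*`
has rank at most `2r`, at most `2r` of the `h_j` differ from `1`. The linear noise term is then at
most `2r ε max |g_j|`, against a divergence that is quadratic in small `g_j`, and `|h_j - 1| = O(ε)`
follows (`abs_form_sub_le_of_loss_le`).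

Relative closeness of the forms becomes closeness of eigenvalues and eigenvectors by Cauchy–Schwarz
and the eigenvalue gaps (`exists_colTransform_close`), up to order and signs of the columns; the
gaps are inherited from A1 (`eigenvalue_separation`). The likelihood does not see order and signs,
so a minimizer over a compact neighbourhood of the optimum is a global one
(`exists_isREMLEstimate_near`).

Probability. For a fixed good design and direction, the linear forms in the data are independent
centred Gaussian variables whose variances differ from the model ones by a small relative error, by
C'. A Bernstein inequality and a union over at most `(8M + 1)^M` grid directions give `ε` of order
`√(M log n / n)` (`measure_noise_large_le`). -/

namespace REML

set_option linter.unusedSectionVars false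

open Matrix

/-! ### Symmetric matrices: simultaneous diagonalization, Loewner order, Kullback–Leibler
divergence. -/

section LinearAlgebra

variable {ι : Type*} [Fintype ι] [DecidableEq ι]

/-- Spectral theorem for real symmetric matrices in terms of transposes. -/
theorem exists_orthogonal_diagonalization {A : Matrix ι ι ℝ} (hA : A.IsHermitian) :
    ∃ O : Matrix ι ι ℝ, O * Oᵀ = 1 ∧ Oᵀ * O = 1 ∧ A = O * diagonal hA.eigenvalues * Oᵀ := by
  have hst := hA.spectral_theorem
  rw [Unitary.conjStarAlgAut_apply, star_eq_conjTranspose,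
    conjTranspose_eq_transpose_of_trivial] at hst
  refine ⟨hA.eigenvectorUnitary, ?_, ?_, by simpa using hst⟩
  · have := Unitary.coe_mul_star_self hA.eigenvectorUnitary
    rwa [Unitary.coe_star, star_eq_conjTranspose, conjTranspose_eq_transpose_of_trivial] at this
  · have := Unitary.coe_star_mul_self hA.eigenvectorUnitary
    rwa [star_eq_conjTranspose, conjTranspose_eq_transpose_of_trivial] at this

/-- A positive definite matrix is the Gram matrix of an invertible matrix. -/
theorem exists_eq_transpose_mul_self {A : Matrix ι ι ℝ} (hA : A.PosDef) :
    ∃ W W' : Matrix ι ι ℝ, W * W' = 1 ∧ W' * W = 1 ∧ A = Wᵀ * W := by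
  obtain ⟨O, hO1, hO2, hst⟩ := exists_orthogonal_diagonalization hA.isHermitian
  set μ := hA.isHermitian.eigenvalues with hμ
  have hμpos : ∀ i, 0 < μ i := hA.eigenvalues_pos
  refine ⟨diagonal (fun i => √(μ i)) * Oᵀ, O * diagonal (fun i => (√(μ i))⁻¹), ?_, ?_, ?_⟩
  · rw [Matrix.mul_assoc, ← Matrix.mul_assoc Oᵀ, hO2, Matrix.one_mul, diagonal_mul_diagonal,
      ← diagonal_one]
    congr 1; ext i; exact mul_inv_cancel₀ (Real.sqrt_pos.2 (hμpos i)).ne'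
  · rw [Matrix.mul_assoc, ← Matrix.mul_assoc (diagonal _) (diagonal _), diagonal_mul_diagonal]
    rw [show (fun i => (√(μ i))⁻¹ * √(μ i)) = fun _ => (1 : ℝ) from by
      ext i; exact inv_mul_cancel₀ (Real.sqrt_pos.2 (hμpos i)).ne', diagonal_one,
      Matrix.one_mul, hO1]
  · rw [transpose_mul, transpose_transpose, diagonal_transpose, Matrix.mul_assoc,
      ← Matrix.mul_assoc (diagonal _) (diagonal _), diagonal_mul_diagonal, ← Matrix.mul_assoc]
    rw [show (fun i => √(μ i) * √(μ i)) = μ from by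
      ext i; exact Real.mul_self_sqrt (hμpos i).le]
    exact hst

/-- Simultaneous diagonalization of a positive definite and a symmetric matrix by a congruence. -/
theorem exists_simultaneous_diagonalization {A B : Matrix ι ι ℝ} (hA : A.PosDef)
    (hB : B.IsHermitian) :
    ∃ U V : Matrix ι ι ℝ, ∃ h : ι → ℝ, U * V = 1 ∧ V * U = 1 ∧ A = Uᵀ * U ∧
      B = Uᵀ * diagonal h * U := by
  obtain ⟨W, W', hWW', hW'W, hAW⟩ := exists_eq_transpose_mul_self hA
  have hWt : Wᵀ * W'ᵀ = 1 := by rw [← transpose_mul, hW'W, transpose_one]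
  have hC : (W'ᵀ * B * W').IsHermitian := by
    have := isHermitian_conjTranspose_mul_mul W' hB
    rwa [conjTranspose_eq_transpose_of_trivial] at this
  obtain ⟨O, hO1, hO2, hst⟩ := exists_orthogonal_diagonalization hC
  generalize hC.eigenvalues = μ at hst
  refine ⟨Oᵀ * W, W' * O, μ, ?_, ?_, ?_, ?_⟩
  · rw [Matrix.mul_assoc, ← Matrix.mul_assoc W, hWW', Matrix.one_mul, hO2]
  · rw [Matrix.mul_assoc, ← Matrix.mul_assoc O, hO1, Matrix.one_mul, hW'W]
  · rw [transpose_mul, transpose_transpose, Matrix.mul_assoc, ← Matrix.mul_assoc O, hO1,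
      Matrix.one_mul, hAW]
  · rw [transpose_mul, transpose_transpose]
    calc B = (Wᵀ * W'ᵀ) * B * (W' * W) := by rw [hWt, hW'W]; simp
      _ = Wᵀ * (W'ᵀ * B * W') * W := by simp only [Matrix.mul_assoc]
      _ = _ := by rw [hst]; simp only [Matrix.mul_assoc]

/-- Quadratic forms of symmetric matrices are symmetric bilinear. -/
theorem dotProduct_mulVec_symm {A : Matrix ι ι ℝ} (hA : Aᵀ = A) (x y : ι → ℝ) :
    x ⬝ᵥ A *ᵥ y = y ⬝ᵥ A *ᵥ x := by
  rw [dotProduct_mulVec, ← mulVec_transpose, hA, dotProduct_comm]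

theorem PosDef.transpose_eq {A : Matrix ι ι ℝ} (hA : A.PosDef) : Aᵀ = A := by
  have := hA.isHermitian.eq
  rwa [conjTranspose_eq_transpose_of_trivial] at this

theorem posSemidef_of_forall {A : Matrix ι ι ℝ} (hA : Aᵀ = A) (h : ∀ x, 0 ≤ x ⬝ᵥ A *ᵥ x) :
    A.PosSemidef :=
  PosSemidef.of_dotProduct_mulVec_nonneg
    (by rw [IsHermitian, conjTranspose_eq_transpose_of_trivial, hA])
    (fun x => by simpa using h x)

theorem posDef_of_forall {A : Matrix ι ι ℝ} (hA : Aᵀ = A) (h : ∀ x, x ≠ 0 → 0 < x ⬝ᵥ A *ᵥ x) :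
    A.PosDef :=
  PosDef.of_dotProduct_mulVec_pos
    (by rw [IsHermitian, conjTranspose_eq_transpose_of_trivial, hA])
    (fun x hx => by simpa using h x hx)

theorem PosSemidef.form_nonneg {A : Matrix ι ι ℝ} (hA : A.PosSemidef) (x : ι → ℝ) :
    0 ≤ x ⬝ᵥ A *ᵥ x := by
  simpa using hA.dotProduct_mulVec_nonneg x

theorem PosDef.mul_inv {A : Matrix ι ι ℝ} (hA : A.PosDef) : A * A⁻¹ = 1 :=
  mul_nonsing_inv _ ((isUnit_iff_isUnit_det A).1 hA.isUnit)

theorem PosDef.inv_mul {A : Matrix ι ι ℝ} (hA : A.PosDef) : A⁻¹ * A = 1 :=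
  nonsing_inv_mul _ ((isUnit_iff_isUnit_det A).1 hA.isUnit)

/-- Variational lower bound for the quadratic form of an inverse. -/
theorem PosDef.le_inv_form {A : Matrix ι ι ℝ} (hA : A.PosDef) (x z : ι → ℝ) :
    2 * (x ⬝ᵥ z) - z ⬝ᵥ A *ᵥ z ≤ x ⬝ᵥ A⁻¹ *ᵥ x := by
  have h := PosSemidef.form_nonneg hA.posSemidef (z - A⁻¹ *ᵥ x)
  have e : A *ᵥ (A⁻¹ *ᵥ x) = x := by rw [mulVec_mulVec, PosDef.mul_inv hA, one_mulVec]
  rw [mulVec_sub, e, sub_dotProduct, dotProduct_sub, dotProduct_sub,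
    dotProduct_comm (A⁻¹ *ᵥ x) x] at h
  have h2 : (A⁻¹ *ᵥ x) ⬝ᵥ A *ᵥ z = x ⬝ᵥ z := by
    rw [dotProduct_mulVec_symm (PosDef.transpose_eq hA), e, dotProduct_comm]
  rw [h2, dotProduct_comm z x] at h
  linarith

/-- Inversion is antitone for the Loewner order. -/
theorem PosDef.inv_form_antitone {A B : Matrix ι ι ℝ} (hA : A.PosDef) (hB : B.PosDef)
    (hAB : ∀ x, x ⬝ᵥ A *ᵥ x ≤ x ⬝ᵥ B *ᵥ x) (x : ι → ℝ) :
    x ⬝ᵥ B⁻¹ *ᵥ x ≤ x ⬝ᵥ A⁻¹ *ᵥ x := by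
  have h := PosDef.le_inv_form hA x (B⁻¹ *ᵥ x)
  have e : B *ᵥ (B⁻¹ *ᵥ x) = x := by rw [mulVec_mulVec, PosDef.mul_inv hB, one_mulVec]
  have h2 := hAB (B⁻¹ *ᵥ x)
  rw [e, dotProduct_comm (B⁻¹ *ᵥ x) x] at h2
  linarith

/-- Factoring `B = C Cᵀ` turns the trace into that of the congruence `Cᵀ A C`. Through
`trace_mul_le` this carries Loewner inequalities into traces of products of noncommuting matrices.
-/
theorem trace_mul_nonneg {A B : Matrix ι ι ℝ} (hA : A.PosSemidef) (hB : B.PosSemidef) :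
    0 ≤ (A * B).trace := by
  obtain ⟨C, rfl⟩ : ∃ C : Matrix ι ι ℝ, B = C * Cᵀ := by
    obtain ⟨O, -, -, hst⟩ := exists_orthogonal_diagonalization hB.isHermitian
    refine ⟨O * diagonal (fun i => √(hB.isHermitian.eigenvalues i)), ?_⟩
    rw [transpose_mul, diagonal_transpose, Matrix.mul_assoc,
      ← Matrix.mul_assoc (diagonal _) (diagonal _), diagonal_mul_diagonal, ← Matrix.mul_assoc]
    rw [show (fun i => √(hB.isHermitian.eigenvalues i) * √(hB.isHermitian.eigenvalues i)) =
      hB.isHermitian.eigenvalues from by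
        ext i; exact Real.mul_self_sqrt (hB.eigenvalues_nonneg i)]
    exact hst
  rw [← Matrix.mul_assoc, trace_mul_comm, ← Matrix.mul_assoc]
  have := hA.conjTranspose_mul_mul_same C
  rw [conjTranspose_eq_transpose_of_trivial] at this
  exact this.trace_nonneg

theorem trace_mul_le {A B C : Matrix ι ι ℝ} (hAB : ∀ x, x ⬝ᵥ A *ᵥ x ≤ x ⬝ᵥ B *ᵥ x)
    (hA : Aᵀ = A) (hB : Bᵀ = B) (hC : C.PosSemidef) : (A * C).trace ≤ (B * C).trace := by
  have := trace_mul_nonneg (A := B - A) (posSemidef_of_forall (by rw [transpose_sub, hA, hB])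
    (fun x => by rw [sub_mulVec, dotProduct_sub]; linarith [hAB x])) hC
  rw [Matrix.sub_mul, trace_sub] at this
  linarith

/-- A quantitative form of `log h⁻¹ ≤ h⁻¹ - 1`. -/
theorem log_add_inv_sub_one_ge {h : ℝ} (hh : 0 < h) :
    (h - 1) ^ 2 / (h * (h + 1)) / 2 ≤ Real.log h + h⁻¹ - 1 := by
  -- With `h = q⁻²`, the inequality `log q ≤ q - 1` leaves `(q - 1)²` as lower bound, and `(q + 1)²
  -- ≤ 2 (1 + q²)` compares it with the rational expression.
  obtain ⟨q, hq0, rfl⟩ : ∃ q : ℝ, 0 < q ∧ h = (q ^ 2)⁻¹ :=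
    ⟨√(h⁻¹), Real.sqrt_pos.2 (inv_pos.2 hh), by rw [Real.sq_sqrt (inv_pos.2 hh).le, inv_inv]⟩
  have h1 : (q - 1) ^ 2 ≤ Real.log (q ^ 2)⁻¹ + (q ^ 2)⁻¹⁻¹ - 1 := by
    rw [Real.log_inv, Real.log_pow, inv_inv]
    push_cast
    nlinarith [Real.log_le_sub_one_of_pos hq0]
  refine le_trans ?_ h1
  have : ((q ^ 2)⁻¹ - 1) ^ 2 / ((q ^ 2)⁻¹ * ((q ^ 2)⁻¹ + 1)) = (q ^ 2 - 1) ^ 2 / (1 + q ^ 2) := by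
    field_simp; ring
  rw [this, div_div, div_le_iff₀ (by positivity)]
  nlinarith [sq_nonneg ((q - 1) * (q - 1)), sq_nonneg (q - 1)]

theorem inv_eq_of_mul {A B : Matrix ι ι ℝ} (h : A * B = 1) : A⁻¹ = B :=
  Matrix.inv_eq_right_inv h

theorem diagonal_form (h x : ι → ℝ) : x ⬝ᵥ diagonal h *ᵥ x = ∑ i, h i * x i ^ 2 := by
  simp only [dotProduct, mulVec_diagonal]
  exact Finset.sum_congr rfl fun i _ => by ring

/-- Lower bound for the (doubled) Kullback–Leibler divergence of two centred normal laws with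
covariance matrices `Y` and `X`. -/
theorem kl_lower_bound {X Y : Matrix ι ι ℝ} (hX : X.PosDef) (hY : Y.PosDef) :
    ((X - Y) * X⁻¹ * (X - Y) * (X + Y)⁻¹).trace / 2
      ≤ Real.log X.det - Real.log Y.det + (X⁻¹ * Y).trace - Fintype.card ι := by
  -- A congruence taking `Y` to `1` and `X` to `diagonal h` makes both sides sums over the `h i`,
  -- compared termwise. The bound is stated as a trace because its inverses are antitone in `X` and
  -- in `X + Y`, so that it survives the perturbation `F` below.
  obtain ⟨U, V, h, hUV, hVU, hYU, hXU⟩ := exists_simultaneous_diagonalization hY hX.isHermitian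
  have hUVt : Vᵀ * Uᵀ = 1 := by rw [← transpose_mul, hUV, transpose_one]
  have hVUt : Uᵀ * Vᵀ = 1 := by rw [← transpose_mul, hVU, transpose_one]
  have hH : Vᵀ * X * V = diagonal h := by
    rw [hXU]
    calc Vᵀ * (Uᵀ * diagonal h * U) * V = (Vᵀ * Uᵀ) * diagonal h * (U * V) := by
          simp only [Matrix.mul_assoc]
      _ = _ := by rw [hUVt, hUV]; simp
  have hh : ∀ i, 0 < h i := by
    have hVinj : Function.Injective V.mulVec :=
      Matrix.mulVec_injective_of_isUnit ⟨⟨V, U, hVU, hUV⟩, rfl⟩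
    have := hX.conjTranspose_mul_mul_same hVinj
    rw [conjTranspose_eq_transpose_of_trivial, hH, posDef_diagonal_iff] at this
    exact this
  have cancel : ∀ Z : Matrix ι ι ℝ, U * (V * Z) = Z := fun Z => by
    rw [← Matrix.mul_assoc, hUV, Matrix.one_mul]
  have cancelt : ∀ Z : Matrix ι ι ℝ, Vᵀ * (Uᵀ * Z) = Z := fun Z => by
    rw [← Matrix.mul_assoc, hUVt, Matrix.one_mul]
  have hXi : X⁻¹ = V * diagonal (fun i => (h i)⁻¹) * Vᵀ := by
    apply inv_eq_of_mul
    rw [hXU]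
    simp only [Matrix.mul_assoc, cancel]
    rw [← Matrix.mul_assoc (diagonal h), diagonal_mul_diagonal]
    simp [mul_inv_cancel₀ (hh _).ne', hVUt]
  have hS : X + Y = Uᵀ * diagonal (fun i => h i + 1) * U := by
    rw [hXU, hYU, ← diagonal_add, diagonal_one, Matrix.mul_add, Matrix.add_mul, Matrix.mul_one]
  have hSi : (X + Y)⁻¹ = V * diagonal (fun i => (h i + 1)⁻¹) * Vᵀ := by
    apply inv_eq_of_mul
    rw [hS]
    simp only [Matrix.mul_assoc, cancel]
    rw [← Matrix.mul_assoc (diagonal _) (diagonal _), diagonal_mul_diagonal]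
    have h1 : ∀ i, (h i + 1) * (h i + 1)⁻¹ = 1 := fun i =>
      mul_inv_cancel₀ (by have := hh i; positivity)
    simp [h1, hVUt]
  have hD : X - Y = Uᵀ * diagonal (fun i => h i - 1) * U := by
    rw [hXU, hYU, ← diagonal_sub, diagonal_one, Matrix.mul_sub, Matrix.sub_mul, Matrix.mul_one]
  have htr : ((X - Y) * X⁻¹ * (X - Y) * (X + Y)⁻¹).trace
      = ∑ i, (h i - 1) ^ 2 / (h i * (h i + 1)) := by
    rw [hXi, hSi, hD]
    simp only [Matrix.mul_assoc, cancel, cancelt]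
    simp only [← Matrix.mul_assoc]
    rw [trace_mul_comm]
    simp only [← Matrix.mul_assoc]
    rw [hUVt, Matrix.one_mul]
    simp only [diagonal_mul_diagonal, trace_diagonal]
    refine Finset.sum_congr rfl fun i _ => ?_
    have := (hh i).ne'
    have : h i + 1 ≠ 0 := by have := hh i; positivity
    field_simp
  have htr2 : (X⁻¹ * Y).trace = ∑ i, (h i)⁻¹ := by
    rw [hXi, hYU]
    simp only [Matrix.mul_assoc, cancelt]
    rw [trace_mul_comm, Matrix.mul_assoc, hUV, Matrix.mul_one, trace_diagonal]
  have hdet : Real.log X.det = Real.log Y.det + ∑ i, Real.log (h i) := by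
    have hUdet : U.det ≠ 0 := fun h0 => by
      have := congrArg det hUV
      rw [det_mul, h0, det_one] at this; simp at this
    rw [hXU, hYU, det_mul, det_mul, det_mul, det_transpose, det_diagonal,
      ← Real.log_prod (fun i _ => (hh i).ne'), ← Real.log_mul (by positivity)
        (Finset.prod_ne_zero_iff.2 fun i _ => (hh i).ne')]
    congr 1; ring
  rw [htr, htr2, hdet, Finset.sum_div]
  have : (Fintype.card ι : ℝ) = ∑ _i : ι, (1 : ℝ) := by simp
  rw [this]
  have := Finset.sum_le_sum (s := Finset.univ) fun i _ => log_add_inv_sub_one_ge (hh i)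
  simp only [Finset.sum_sub_distrib, Finset.sum_add_distrib] at this
  linarith

end LinearAlgebra

/-! ### Perturbed covariances `H + F` and `1 + F`: expansion of the inverse. -/

section Perturbation

variable {ι : Type*} [Fintype ι] [DecidableEq ι]

/-- Exact second order expansion of the inverse of `X` around the inverse of `Y = X + 1 - H`. -/
theorem inv_expansion {H Hi X Xi Y K : Matrix ι ι ℝ} (hH : H * Hi = 1) (hH' : Hi * H = 1)
    (hX : X * Xi = 1) (hX' : Xi * X = 1) (hY : Y * K = 1) (hY' : K * Y = 1) (hXY : Y = X + 1 - H) :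
    Xi = K + K * (Hi - 1) * K - K * (Hi - 1) * (H - H * Xi * H) * (Hi - 1) * K := by
  have hKH : K * H = K * X + K - 1 := by
    rw [hXY] at hY'; rw [← hY']; noncomm_ring
  have hHK : H * K = X * K + K - 1 := by
    rw [hXY] at hY; rw [← hY]; noncomm_ring
  -- The factors `Hi - 1` cancel against the outer `H`, leaving `1 - H = Y - X`, whose products with
  -- `K` are `1 - K X` and `1 - X K`. Nothing is assumed to commute.
  have e1 : (Hi - 1) * (H - H * Xi * H) * (Hi - 1)
      = (1 - H) * Hi * (1 - H) - (1 - H) * Xi * (1 - H) := by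
    have a1 : (Hi - 1) * H = 1 - H := by rw [sub_mul, hH', one_mul]
    have a2 : H * (Hi - 1) = 1 - H := by rw [mul_sub, hH, mul_one]
    calc (Hi - 1) * (H - H * Xi * H) * (Hi - 1)
        = ((Hi - 1) * H) * (Hi - 1) - ((Hi - 1) * H) * Xi * (H * (Hi - 1)) := by noncomm_ring
      _ = (1 - H) * (Hi - 1) - (1 - H) * Xi * (1 - H) := by rw [a1, a2]
      _ = _ := by
        rw [Matrix.mul_assoc (1 - H) Hi, Matrix.mul_sub Hi, hH', Matrix.mul_one]
  have e2 : K * (1 - H) = 1 - K * X := by rw [mul_sub, hKH]; noncomm_ring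
  have e3 : (1 - H) * K = 1 - X * K := by rw [sub_mul, hHK]; noncomm_ring
  have e9 : K * (Hi - 1) * (H - H * Xi * H) * (Hi - 1) * K
      = K * Hi * (1 - H) * K - K * H * Hi * (1 - H) * K
        - (1 - K * X) * Xi * (1 - X * K) := by
    calc K * (Hi - 1) * (H - H * Xi * H) * (Hi - 1) * K
        = K * ((Hi - 1) * (H - H * Xi * H) * (Hi - 1)) * K := by noncomm_ring
      _ = K * Hi * (1 - H) * K - K * H * Hi * (1 - H) * K
            - (K * (1 - H)) * Xi * ((1 - H) * K) := by rw [e1]; noncomm_ring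
      _ = _ := by rw [e2, e3]
  have e5 : (1 - K * X) * Xi * (1 - X * K) = Xi - K - K + K * X * K := by
    calc (1 - K * X) * Xi * (1 - X * K)
        = Xi - K * (X * Xi) - (Xi * X) * K + K * (X * Xi) * X * K := by noncomm_ring
      _ = _ := by rw [hX, hX']; noncomm_ring
  have e6 : K * (1 - H) * K = K - K * X * K := by
    rw [e2]; noncomm_ring
  have e7 : K * Hi * (1 - H) * K = K * (Hi - 1) * K := by
    calc K * Hi * (1 - H) * K = K * (Hi - Hi * H) * K := by noncomm_ring
      _ = _ := by rw [hH']
  have e8 : K * H * Hi * (1 - H) * K = K * (1 - H) * K := by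
    rw [Matrix.mul_assoc K H Hi, hH, mul_one]
  rw [e9, e5, e8, e6, e7]; abel

variable {h : ι → ℝ} {Q F : Matrix ι ι ℝ} {δ : ℝ}

/-- Polarization: subtracting the bounds at `x + z` and `x - z` leaves the cross term of `F` and
cancels that of `Q`. -/
theorem abs_bilin_le {Q F : Matrix ι ι ℝ} {δ : ℝ} (hFs : Fᵀ = F)
    (hF : ∀ x, |x ⬝ᵥ F *ᵥ x| ≤ δ * (Q *ᵥ x ⬝ᵥ Q *ᵥ x)) (x z : ι → ℝ) :
    2 * (x ⬝ᵥ F *ᵥ z) ≤ δ * (Q *ᵥ x ⬝ᵥ Q *ᵥ x) + δ * (Q *ᵥ z ⬝ᵥ Q *ᵥ z) := by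
  have h1 := (abs_le.1 (hF (x + z))).2
  have h2 := (abs_le.1 (hF (x - z))).1
  simp only [mulVec_add, mulVec_sub, add_dotProduct, dotProduct_add, sub_dotProduct,
    dotProduct_sub] at h1 h2
  rw [dotProduct_mulVec_symm hFs z x, dotProduct_comm (Q *ᵥ z) (Q *ᵥ x)] at h1 h2
  nlinarith

variable (hh : ∀ i, 0 < h i) (hQ1 : ∀ x, Q *ᵥ x ⬝ᵥ Q *ᵥ x ≤ x ⬝ᵥ x)
  (hQh : ∀ x, Q *ᵥ x ⬝ᵥ Q *ᵥ x ≤ x ⬝ᵥ diagonal h *ᵥ x)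
  (hFs : Fᵀ = F) (hδ0 : 0 ≤ δ) (hδ : δ ≤ 1 / 224)
  (hF : ∀ x, |x ⬝ᵥ F *ᵥ x| ≤ δ * (Q *ᵥ x ⬝ᵥ Q *ᵥ x))

include hQ1 hFs hδ0 hδ hF in
-- Here `1` and `diagonal h` stand for `A_*` and `A` in simultaneously diagonalizing coordinates,
-- and `|Q x|²` for `s` times the squared Euclidean norm of the original vector. It is dominated by
-- both reference forms, so an `F` of size `δ |Q x|²` is small relative to either, however small `h`
-- may be.
theorem posDef_one_add : (1 + F).PosDef := by
  refine posDef_of_forall (by rw [transpose_add, transpose_one, hFs]) fun x hx => ?_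
  rw [add_mulVec, one_mulVec, dotProduct_add]
  have : 0 < x ⬝ᵥ x := by
    have := dotProduct_star_self_pos_iff (v := x); simpa using this.2 hx
  have h1 := (abs_le.1 (hF x)).1
  nlinarith [hQ1 x]

include hh hQh hFs hδ0 hδ hF in
theorem posDef_diagonal_add : (diagonal h + F).PosDef := by
  refine posDef_of_forall (by rw [transpose_add, diagonal_transpose, hFs]) fun x hx => ?_
  rw [add_mulVec, dotProduct_add]
  have : 0 < x ⬝ᵥ diagonal h *ᵥ x := by
    have := (PosDef.diagonal hh).dotProduct_mulVec_pos hx; simpa using this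
  have h1 := (abs_le.1 (hF x)).1
  nlinarith [hQh x]

include hh hQ1 hQh hFs hδ0 hδ hF in
/-- The quantities entering the expansion of `(H + F)⁻¹` around `(1 + F)⁻¹`, `H = diagonal h`. -/
theorem exists_inv_expansion : ∃ N : Matrix ι ι ℝ, Nᵀ = N ∧
    (∀ w, w ⬝ᵥ N *ᵥ w ≤ δ * (Q *ᵥ w ⬝ᵥ Q *ᵥ w)) ∧
    (∀ w, -(2 * δ) * (Q *ᵥ w ⬝ᵥ Q *ᵥ w) ≤ w ⬝ᵥ N *ᵥ w) ∧
    (diagonal h + F)⁻¹ = (1 + F)⁻¹ + (1 + F)⁻¹ * diagonal (fun i => (h i)⁻¹ - 1) * (1 + F)⁻¹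
      - (1 + F)⁻¹ * diagonal (fun i => (h i)⁻¹ - 1) * N * diagonal (fun i => (h i)⁻¹ - 1)
        * (1 + F)⁻¹ := by
  have hX := posDef_diagonal_add hh hQh hFs hδ0 hδ hF
  have hY := posDef_one_add hQ1 hFs hδ0 hδ hF
  set X := diagonal h + F with hXdef
  have hXi := hX.inv
  -- The two expressions play different roles: the left one shows that `N` is of the order of `F`,
  -- the right one is what `inv_expansion` produces.
  have hN : F - F * X⁻¹ * F = diagonal h - diagonal h * X⁻¹ * diagonal h := by
    have : F = X - diagonal h := by rw [hXdef]; abel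
    rw [this]
    calc X - diagonal h - (X - diagonal h) * X⁻¹ * (X - diagonal h)
        = X - diagonal h - ((X * X⁻¹) * X - (X * X⁻¹) * diagonal h - diagonal h * (X⁻¹ * X)
          + diagonal h * X⁻¹ * diagonal h) := by noncomm_ring
      _ = _ := by rw [PosDef.mul_inv hX, PosDef.inv_mul hX]; noncomm_ring
  have hform : ∀ w, w ⬝ᵥ (F - F * X⁻¹ * F) *ᵥ w
      = w ⬝ᵥ F *ᵥ w - (F *ᵥ w) ⬝ᵥ X⁻¹ *ᵥ (F *ᵥ w) := fun w => by
    rw [sub_mulVec, dotProduct_sub, ← mulVec_mulVec, ← mulVec_mulVec,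
      dotProduct_mulVec_symm hFs w (X⁻¹ *ᵥ (F *ᵥ w)), dotProduct_comm (X⁻¹ *ᵥ (F *ᵥ w))]
  refine ⟨F - F * X⁻¹ * F, ?_, fun w => ?_, fun w => ?_, ?_⟩
  · rw [transpose_sub, transpose_mul, transpose_mul, hFs, PosDef.transpose_eq hXi,
      Matrix.mul_assoc]
  · rw [hform]
    have := PosSemidef.form_nonneg hXi.posSemidef (F *ᵥ w)
    have := (abs_le.1 (hF w)).2
    linarith
  · rw [hform]
    -- The value `z·F w = z·X z` is at least `(1 - δ) |Q z|²`, which absorbs the `|Q z|²` arising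
    -- when the cross term is polarized.
    set z := X⁻¹ *ᵥ (F *ᵥ w) with hz
    have hXz : X *ᵥ z = F *ᵥ w := by rw [hz, mulVec_mulVec, PosDef.mul_inv hX, one_mulVec]
    have e1 : (F *ᵥ w) ⬝ᵥ z = z ⬝ᵥ F *ᵥ w := dotProduct_comm _ _
    have e2 : z ⬝ᵥ X *ᵥ z = z ⬝ᵥ F *ᵥ w := by rw [hXz]
    have e3 := abs_bilin_le hFs hF z w
    have e4 := (abs_le.1 (hF z)).1
    have e5 := hQh z
    have e6 := (abs_le.1 (hF w)).1
    rw [hXdef, add_mulVec, dotProduct_add] at e2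
    rw [e1]
    have : 0 ≤ Q *ᵥ z ⬝ᵥ Q *ᵥ z := by
      have := dotProduct_star_self_nonneg (Q *ᵥ z); simpa using this
    nlinarith
  · rw [hN]
    have hHi : diagonal h * diagonal (fun i => (h i)⁻¹) = 1 := by
      rw [diagonal_mul_diagonal, ← diagonal_one]; congr 1; ext i; exact mul_inv_cancel₀ (hh i).ne'
    have hHi' : diagonal (fun i => (h i)⁻¹) * diagonal h = 1 := by
      rw [diagonal_mul_diagonal, ← diagonal_one]; congr 1; ext i; exact inv_mul_cancel₀ (hh i).ne'
    have := inv_expansion hHi hHi' (PosDef.mul_inv hX) (PosDef.inv_mul hX) (PosDef.mul_inv hY)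
      (PosDef.inv_mul hY) (by rw [hXdef]; abel)
    rwa [← diagonal_one, diagonal_sub, diagonal_one] at this

end Perturbation

/-! ### Lower bound for the loss of one observation. -/

section Perturbation

variable {ι : Type*} [Fintype ι] [DecidableEq ι]

theorem inv_diagonal_of_pos {v : ι → ℝ} (hv : ∀ i, 0 < v i) :
    (diagonal v)⁻¹ = diagonal fun i => (v i)⁻¹ := by
  apply inv_eq_of_mul
  rw [diagonal_mul_diagonal, ← diagonal_one]
  congr 1; ext i; exact mul_inv_cancel₀ (hv i).ne'

theorem dotProduct_self_nonneg_real (x : ι → ℝ) : 0 ≤ x ⬝ᵥ x := by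
  simpa using dotProduct_star_self_nonneg x

theorem form_sandwich {D N : Matrix ι ι ℝ} (hD : Dᵀ = D) (x : ι → ℝ) :
    x ⬝ᵥ (D * N * D) *ᵥ x = (D *ᵥ x) ⬝ᵥ N *ᵥ (D *ᵥ x) := by
  rw [← mulVec_mulVec, ← mulVec_mulVec, dotProduct_mulVec_symm hD, dotProduct_comm]

/-- The weighted squared distance from `1` of the relative eigenvalues `h`. -/
noncomputable def relDist (h : ι → ℝ) : ℝ := ∑ i, (h i - 1) ^ 2 / (h i * (h i + 1))

theorem relDist_nonneg {h : ι → ℝ} (hh : ∀ i, 0 < h i) : 0 ≤ relDist h :=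
  Finset.sum_nonneg fun i _ => by have := hh i; positivity

variable {h : ι → ℝ} {Q F : Matrix ι ι ℝ} {δ : ℝ} (hh : ∀ i, 0 < h i)
  (hQ1 : ∀ x, Q *ᵥ x ⬝ᵥ Q *ᵥ x ≤ x ⬝ᵥ x)
  (hQh : ∀ x, Q *ᵥ x ⬝ᵥ Q *ᵥ x ≤ x ⬝ᵥ diagonal h *ᵥ x)

include hh hQ1 hQh in
/-- The compressed square norm of `G = H⁻¹ - 1` is dominated by `relDist`. -/
theorem sum_form_diagonal_le :
    ∑ a, ∑ j, Q a j ^ 2 * ((h j)⁻¹ - 1) ^ 2 ≤ 2 * relDist h := by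
  have hcol : ∀ j, Q *ᵥ (Pi.single j 1) ⬝ᵥ Q *ᵥ (Pi.single j 1) = ∑ a, Q a j ^ 2 := fun j => by
    simp [dotProduct, sq]
  rw [Finset.sum_comm, relDist, Finset.mul_sum]
  refine Finset.sum_le_sum fun j _ => ?_
  rw [← Finset.sum_mul, ← hcol]
  have h1 := hQ1 (Pi.single j 1)
  have h2 := hQh (Pi.single j 1)
  rw [diagonal_form] at h2
  have e1 : (Pi.single j 1 : ι → ℝ) ⬝ᵥ Pi.single j 1 = 1 := by simp
  have e2 : ∑ i, h i * (Pi.single j 1 : ι → ℝ) i ^ 2 = h j := by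
    rw [Finset.sum_eq_single j] <;> simp +contextual
  rw [e1] at h1; rw [e2] at h2
  set p := Q *ᵥ (Pi.single j 1) ⬝ᵥ Q *ᵥ (Pi.single j 1)
  have hj := hh j
  -- The weight `p` is at most `min 1 (h j)`, hence at most the harmonic mean `2 h j / (h j + 1)`;
  -- this supplies the factor `2` and the denominator of `relDist`.
  have h3 : p * (h j + 1) ≤ 2 * h j := by nlinarith
  have : ((h j)⁻¹ - 1) ^ 2 = (h j - 1) ^ 2 / h j ^ 2 := by field_simp; ring
  rw [this, ← mul_div_assoc, ← mul_div_assoc, div_le_div_iff₀ (by positivity) (by positivity)]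
  have := mul_le_mul_of_nonneg_left h3 (show 0 ≤ (h j - 1) ^ 2 * h j by positivity)
  nlinarith

variable (hFs : Fᵀ = F) (hδ0 : 0 ≤ δ) (hδ : δ ≤ 1 / 224)
  (hF : ∀ x, |x ⬝ᵥ F *ᵥ x| ≤ δ * (Q *ᵥ x ⬝ᵥ Q *ᵥ x))

include hh hQ1 hQh hFs hδ0 hδ hF in
-- The difference of the two covariances does not involve `F`. In the trace bound `X ≤ 2 H` and `X +
-- Y ≤ 2 (H + 1)`, so passing to the diagonal matrices costs a factor `4` in addition to the `2` of
-- `kl_lower_bound`.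
theorem kl_lower_bound_diagonal :
    relDist h / 8 ≤ Real.log (diagonal h + F).det - Real.log (1 + F).det
      + ((diagonal h + F)⁻¹ * (1 + F)).trace - Fintype.card ι := by
  have hX := posDef_diagonal_add hh hQh hFs hδ0 hδ hF
  have hY := posDef_one_add hQ1 hFs hδ0 hδ hF
  refine le_trans ?_ (kl_lower_bound hX hY)
  have hXY : (diagonal h + F) - (1 + F) = diagonal fun i => h i - 1 := by
    rw [← diagonal_sub, diagonal_one]; abel
  rw [hXY]
  set X := diagonal h + F with hXdef
  set Y := 1 + F with hYdef
  set D := diagonal fun i => h i - 1 with hD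
  have hDt : Dᵀ = D := diagonal_transpose _
  have hS := hX.add hY
  have hQ0 : ∀ x, 0 ≤ Q *ᵥ x ⬝ᵥ Q *ᵥ x := fun x => dotProduct_self_nonneg_real _
  have h2h : ∀ i, 0 < 2 * h i := fun i => by have := hh i; positivity
  have h2h1 : ∀ i, 0 < 2 * (h i + 1) := fun i => by have := hh i; positivity
  have b1 : ∀ x, x ⬝ᵥ (D * (diagonal fun i => 2 * h i)⁻¹ * D) *ᵥ x ≤ x ⬝ᵥ (D * X⁻¹ * D) *ᵥ x := by
    intro x
    rw [form_sandwich hDt, form_sandwich hDt]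
    refine PosDef.inv_form_antitone hX (PosDef.diagonal h2h) (fun z => ?_) _
    rw [hXdef, add_mulVec, dotProduct_add]
    have e : z ⬝ᵥ (diagonal fun i => 2 * h i) *ᵥ z = 2 * (z ⬝ᵥ diagonal h *ᵥ z) := by
      rw [diagonal_form, diagonal_form, Finset.mul_sum]
      exact Finset.sum_congr rfl fun i _ => by ring
    rw [e]
    nlinarith [hQh z, (abs_le.1 (hF z)).2, hQ0 z]
  have b2 : ∀ x, x ⬝ᵥ (diagonal fun i => 2 * (h i + 1))⁻¹ *ᵥ x ≤ x ⬝ᵥ (X + Y)⁻¹ *ᵥ x := by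
    refine PosDef.inv_form_antitone hS (PosDef.diagonal h2h1) (fun z => ?_)
    have e : z ⬝ᵥ (diagonal fun i => 2 * (h i + 1)) *ᵥ z
        = 2 * (z ⬝ᵥ diagonal h *ᵥ z) + 2 * (z ⬝ᵥ z) := by
      rw [diagonal_form, diagonal_form, Finset.mul_sum, dotProduct, Finset.mul_sum,
        ← Finset.sum_add_distrib]
      exact Finset.sum_congr rfl fun i _ => by ring
    rw [e, hXdef, hYdef]
    simp only [add_mulVec, dotProduct_add, one_mulVec]
    nlinarith [hQh z, (abs_le.1 (hF z)).2, hQ0 z, hQ1 z]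
  have hXit := PosDef.transpose_eq hX.inv
  have hAs : (D * (diagonal fun i => 2 * h i)⁻¹ * D)ᵀ = D * (diagonal fun i => 2 * h i)⁻¹ * D := by
    rw [transpose_mul, transpose_mul, hDt, PosDef.transpose_eq (PosDef.diagonal h2h).inv,
      Matrix.mul_assoc]
  have c1 := trace_mul_le b1 hAs
    (by rw [transpose_mul, transpose_mul, hDt, hXit, Matrix.mul_assoc]) hS.inv.posSemidef
  have c2 := trace_mul_le b2 (PosDef.transpose_eq (PosDef.diagonal h2h1).inv)
    (PosDef.transpose_eq hS.inv) (C := D * (diagonal fun i => 2 * h i)⁻¹ * D)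
    (posSemidef_of_forall hAs fun x => by
      rw [form_sandwich hDt]
      exact PosSemidef.form_nonneg (PosDef.diagonal h2h).inv.posSemidef _)
  rw [trace_mul_comm (X + Y)⁻¹] at c2
  have e : ((diagonal fun i => 2 * (h i + 1))⁻¹ * (D * (diagonal fun i => 2 * h i)⁻¹ * D)).trace
      = relDist h / 4 := by
    rw [inv_diagonal_of_pos h2h, inv_diagonal_of_pos h2h1, hD]
    simp only [diagonal_mul_diagonal, trace_diagonal, relDist, Finset.sum_div]
    refine Finset.sum_congr rfl fun i _ => ?_
    have := hh i
    field_simp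
    ring
  rw [e] at c2
  linarith

include hQ1 hFs hδ0 hδ hF in
-- Inversion reverses the order in `1 + F ≥ 1/2`.
theorem inv_one_add_form_le (x : ι → ℝ) : x ⬝ᵥ (1 + F)⁻¹ *ᵥ x ≤ 2 * (x ⬝ᵥ x) := by
  have hY := posDef_one_add hQ1 hFs hδ0 hδ hF
  have h2 : ∀ i : ι, (0 : ℝ) < (fun _ => 1 / 2) i := fun i => by norm_num
  have := PosDef.inv_form_antitone (PosDef.diagonal h2) hY (fun z => by
    rw [diagonal_form, ← Finset.mul_sum, add_mulVec, one_mulVec, dotProduct_add]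
    have e : ∑ i, z i ^ 2 = z ⬝ᵥ z := by simp [dotProduct, sq]
    rw [e]
    nlinarith [hQ1 z, (abs_le.1 (hF z)).1, dotProduct_self_nonneg_real (Q *ᵥ z)]) x
  rw [inv_diagonal_of_pos h2, diagonal_form, ← Finset.mul_sum] at this
  have e : ∑ i, x i ^ 2 = x ⬝ᵥ x := by simp [dotProduct, sq]
  rw [e] at this
  linarith

include hh hQ1 hQh hFs hδ0 hδ hF in
/-- Lower bound for the difference of the negative log-likelihoods of one observation `y`. -/
theorem loss_lower_bound (y : ι → ℝ) :
    relDist h / 8 - 8 * δ * relDist h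
      + ∑ j, ((h j)⁻¹ - 1) * (((1 + F)⁻¹ *ᵥ y) j ^ 2 - (1 + F)⁻¹ j j)
      - δ * ∑ a, (∑ j, Q a j * ((h j)⁻¹ - 1) * ((1 + F)⁻¹ *ᵥ y) j) ^ 2
    ≤ Real.log (diagonal h + F).det - Real.log (1 + F).det
      + y ⬝ᵥ (diagonal h + F)⁻¹ *ᵥ y - y ⬝ᵥ (1 + F)⁻¹ *ᵥ y := by
  have hkl := kl_lower_bound_diagonal hh hQ1 hQh hFs hδ0 hδ hF
  have hY := posDef_one_add hQ1 hFs hδ0 hδ hF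
  obtain ⟨N, hNt, hN1, hN2, hinv⟩ := exists_inv_expansion hh hQ1 hQh hFs hδ0 hδ hF
  set K := (1 + F)⁻¹ with hK
  have hKt : Kᵀ = K := PosDef.transpose_eq hY.inv
  set g : ι → ℝ := fun i => (h i)⁻¹ - 1 with hg
  set G := diagonal g with hG
  have hGt : Gᵀ = G := diagonal_transpose _
  set W := K *ᵥ y with hW
  -- the quadratic form
  have hform : y ⬝ᵥ (diagonal h + F)⁻¹ *ᵥ y
      = y ⬝ᵥ K *ᵥ y + ∑ j, g j * W j ^ 2 - (G *ᵥ W) ⬝ᵥ N *ᵥ (G *ᵥ W) := by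
    rw [hinv, sub_mulVec, add_mulVec, dotProduct_sub, dotProduct_add]
    have e1 : K * G * N * G * K = K * (G * N * G) * K := by simp only [Matrix.mul_assoc]
    rw [e1, form_sandwich hKt, form_sandwich hKt, form_sandwich hGt, diagonal_form]
  -- the trace
  have htr : ((diagonal h + F)⁻¹ * (1 + F)).trace
      = Fintype.card ι + ∑ j, g j * K j j - (G * N * G * K).trace := by
    have hKY : K * (1 + F) = 1 := PosDef.inv_mul hY
    rw [hinv, Matrix.sub_mul, Matrix.add_mul, hKY, Matrix.mul_assoc _ K, hKY,
      Matrix.mul_assoc _ K, hKY, trace_sub, trace_add, trace_one, Matrix.mul_one, Matrix.mul_one,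
      trace_mul_comm K G]
    congr 1
    · congr 1
      simp [trace, hG, diagonal_mul]
    · rw [trace_mul_comm (G * N * G) K]; simp only [Matrix.mul_assoc]
  have hQQt : (Qᵀ * Q)ᵀ = Qᵀ * Q := by rw [transpose_mul, transpose_transpose]
  have hQQ : ∀ x, x ⬝ᵥ (Qᵀ * Q) *ᵥ x = Q *ᵥ x ⬝ᵥ Q *ᵥ x := fun x => by
    rw [← mulVec_mulVec, dotProduct_mulVec, vecMul_transpose]
  have hGPGt : (G * (Qᵀ * Q) * G)ᵀ = G * (Qᵀ * Q) * G := by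
    rw [transpose_mul, transpose_mul, hGt, hQQt, ← Matrix.mul_assoc]
  have hGPG : (G * (Qᵀ * Q) * G).PosSemidef := posSemidef_of_forall hGPGt fun x => by
    rw [form_sandwich hGt, hQQ]; exact dotProduct_self_nonneg_real _
  -- The error in the trace is at most `8 δ relDist h`: a factor `2 δ` from the lower bound on `N`,
  -- then `2` from `K ≤ 2`, then `2` from `sum_form_diagonal_le`.
  have t1 : -(2 * δ) * (G * (Qᵀ * Q) * G * K).trace ≤ (G * N * G * K).trace := by
    have := trace_mul_le (A := (-(2 * δ)) • (G * (Qᵀ * Q) * G)) (B := G * N * G) (C := K)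
      (fun x => by
        rw [smul_mulVec, dotProduct_smul, form_sandwich hGt, form_sandwich hGt, hQQ]
        exact hN2 _)
      (by rw [transpose_smul, hGPGt])
      (by rw [transpose_mul, transpose_mul, hGt, hNt, Matrix.mul_assoc]) hY.inv.posSemidef
    rwa [smul_mul, trace_smul, smul_eq_mul] at this
  have t2 : (G * (Qᵀ * Q) * G * K).trace ≤ 2 * (G * (Qᵀ * Q) * G).trace := by
    have := trace_mul_le (A := K) (B := (2 : ℝ) • 1) (C := G * (Qᵀ * Q) * G)
      (fun x => by
        rw [smul_mulVec, dotProduct_smul, one_mulVec]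
        exact inv_one_add_form_le hQ1 hFs hδ0 hδ hF x) hKt (by simp) hGPG
    rwa [smul_mul, trace_smul, smul_eq_mul, Matrix.one_mul, trace_mul_comm] at this
  have t3 : (G * (Qᵀ * Q) * G).trace ≤ 2 * relDist h := by
    refine le_trans (le_of_eq ?_) (sum_form_diagonal_le hh hQ1 hQh)
    simp only [trace, diag_apply, hG, mul_diagonal, diagonal_mul]
    rw [Finset.sum_comm]
    refine Finset.sum_congr rfl fun j _ => ?_
    rw [Matrix.mul_apply, Finset.mul_sum, Finset.sum_mul]
    exact Finset.sum_congr rfl fun a _ => by rw [transpose_apply]; ring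
  have t4 : Q *ᵥ (G *ᵥ W) ⬝ᵥ Q *ᵥ (G *ᵥ W) = ∑ a, (∑ j, Q a j * g j * W j) ^ 2 := by
    simp only [dotProduct, hG]
    refine Finset.sum_congr rfl fun a _ => ?_
    rw [sq]
    have : (Q *ᵥ (diagonal g *ᵥ W)) a = ∑ j, Q a j * g j * W j := by
      change ∑ j, Q a j * (diagonal g *ᵥ W) j = _
      exact Finset.sum_congr rfl fun j _ => by rw [mulVec_diagonal]; ring
    rw [this]
  have hn := hN1 (G *ᵥ W)
  rw [t4] at hn
  rw [hform]
  rw [htr] at hkl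
  have s1 : ∑ j, g j * (W j ^ 2 - K j j) = ∑ j, g j * W j ^ 2 - ∑ j, g j * K j j := by
    rw [← Finset.sum_sub_distrib]; exact Finset.sum_congr rfl fun j _ => by ring
  rw [s1]
  nlinarith [relDist_nonneg hh]

end Perturbation

/-! ### From small loss to small relative eigenvalues. -/

section Key

variable {ι κ : Type*} [Fintype ι] [DecidableEq ι] [Fintype κ]

/-- The noise is needed only in two families of directions: the coordinate axes for the linear term,
and the rows of `Q` weighted by `h⁻¹ - 1` for the quadratic remainder. The remainders take away `8 δ
+ 6 δ = 14 δ ≤ 1/16` of the coefficient `1/8`, which explains the threshold `1/224` and leaves the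
factor `16`. -/
theorem relDist_le_of_loss_le_diagonal [Nonempty κ] {h : ι → ℝ} {Q : Matrix ι ι ℝ} {δ ε : ℝ}
    (hh : ∀ i, 0 < h i)
    (hQ1 : ∀ x, Q *ᵥ x ⬝ᵥ Q *ᵥ x ≤ x ⬝ᵥ x)
    (hQh : ∀ x, Q *ᵥ x ⬝ᵥ Q *ᵥ x ≤ x ⬝ᵥ diagonal h *ᵥ x)
    (F : κ → Matrix ι ι ℝ) (hFs : ∀ i, (F i)ᵀ = F i) (hδ0 : 0 ≤ δ) (hδ : δ ≤ 1 / 224)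
    (hF : ∀ i x, |x ⬝ᵥ F i *ᵥ x| ≤ δ * (Q *ᵥ x ⬝ᵥ Q *ᵥ x)) (y : κ → ι → ℝ) (hε1 : ε ≤ 1)
    (hnoise : ∀ x, |∑ i, ((x ⬝ᵥ (1 + F i)⁻¹ *ᵥ y i) ^ 2 - x ⬝ᵥ (1 + F i)⁻¹ *ᵥ x)|
      ≤ Fintype.card κ * ε * (x ⬝ᵥ x))
    (hloss : ∑ i, (Real.log (diagonal h + F i).det - Real.log (1 + F i).det
      + y i ⬝ᵥ (diagonal h + F i)⁻¹ *ᵥ y i - y i ⬝ᵥ (1 + F i)⁻¹ *ᵥ y i) ≤ 0) :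
    relDist h ≤ 16 * ε * ∑ j, |(h j)⁻¹ - 1| := by
  have hn : (0 : ℝ) < Fintype.card κ := by exact_mod_cast Fintype.card_pos
  set n : ℝ := (Fintype.card κ : ℝ)
  have h1 := Finset.sum_le_sum (s := Finset.univ) fun i _ =>
    loss_lower_bound hh hQ1 hQh (hFs i) hδ0 hδ (hF i) (y i)
  simp only [Finset.sum_sub_distrib, Finset.sum_add_distrib, Finset.sum_const, Finset.card_univ,
    nsmul_eq_mul, ← Finset.mul_sum] at h1 hloss
  set W : κ → ι → ℝ := fun i => (1 + F i)⁻¹ *ᵥ y i with hW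
  have h2 : -(n * ε * ∑ j, |(h j)⁻¹ - 1|)
      ≤ ∑ i, ∑ j, ((h j)⁻¹ - 1) * (W i j ^ 2 - (1 + F i)⁻¹ j j) := by
    rw [Finset.sum_comm, Finset.mul_sum, ← Finset.sum_neg_distrib]
    refine Finset.sum_le_sum fun j _ => ?_
    rw [← Finset.mul_sum]
    have := hnoise (Pi.single j 1)
    simp only [single_dotProduct, one_mul, mulVec_single_one, Matrix.col_apply,
      Pi.single_eq_same, mul_one] at this
    have h3 : |((h j)⁻¹ - 1) * ∑ i, (W i j ^ 2 - (1 + F i)⁻¹ j j)|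
        ≤ |(h j)⁻¹ - 1| * (n * ε) := by
      rw [abs_mul]; exact mul_le_mul_of_nonneg_left this (abs_nonneg _)
    linarith [(abs_le.1 h3).1]
  -- In each weighted row direction the average of the squares is at most `2 + ε ≤ 3` times the
  -- squared norm, the `2` coming from `inv_one_add_form_le`.
  have h3 : ∑ i, ∑ a, (∑ j, Q a j * ((h j)⁻¹ - 1) * W i j) ^ 2 ≤ n * (6 * relDist h) := by
    rw [Finset.sum_comm]
    have : ∀ a, ∑ i, (∑ j, Q a j * ((h j)⁻¹ - 1) * W i j) ^ 2
        ≤ n * 3 * ∑ j, Q a j ^ 2 * ((h j)⁻¹ - 1) ^ 2 := fun a => by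
      set x : ι → ℝ := fun j => Q a j * ((h j)⁻¹ - 1) with hx
      have e0 : ∑ j, Q a j ^ 2 * ((h j)⁻¹ - 1) ^ 2 = x ⬝ᵥ x :=
        Finset.sum_congr rfl fun j _ => by rw [hx]; ring
      rw [e0]
      have e1 := (abs_le.1 (hnoise x)).2
      rw [Finset.sum_sub_distrib] at e1
      have e2 : ∑ i, x ⬝ᵥ (1 + F i)⁻¹ *ᵥ x ≤ n * (2 * (x ⬝ᵥ x)) := by
        refine (Finset.sum_le_sum fun i _ =>
          inv_one_add_form_le hQ1 (hFs i) hδ0 hδ (hF i) x).trans ?_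
        simp [n]
      have e3 : n * ε * (x ⬝ᵥ x) ≤ n * 1 * (x ⬝ᵥ x) :=
        mul_le_mul_of_nonneg_right (mul_le_mul_of_nonneg_left hε1 hn.le)
          (dotProduct_self_nonneg_real x)
      have e4 : ∑ i, (∑ j, Q a j * ((h j)⁻¹ - 1) * W i j) ^ 2
        = ∑ i, (x ⬝ᵥ (1 + F i)⁻¹ *ᵥ y i) ^ 2 := rfl
      rw [e4]
      linarith
    refine (Finset.sum_le_sum fun a _ => this a).trans ?_
    rw [← Finset.mul_sum]
    have := sum_form_diagonal_le hh hQ1 hQh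
    nlinarith
  have h4 := mul_le_mul_of_nonneg_left h3 hδ0
  have h5 : n * (relDist h / 16) ≤ n * (ε * ∑ j, |(h j)⁻¹ - 1|) := by
    have h6 : n * relDist h * δ ≤ n * relDist h * (1 / 224) :=
      mul_le_mul_of_nonneg_left hδ (mul_nonneg hn.le (relDist_nonneg hh))
    nlinarith
  have := le_of_mul_le_mul_left h5 hn
  linarith

/-- If all relative eigenvalues but `k` equal `1` and `relDist h` is dominated by a small multiple
of the total deviation of the inverses, then all relative eigenvalues are close to `1`. -/
theorem abs_sub_one_le_of_relDist_le {h : ι → ℝ} (hh : ∀ i, 0 < h i) {k : ℕ} {ε : ℝ} (hε : 0 ≤ ε)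
    (hk : (Finset.univ.filter fun j => h j ≠ 1).card ≤ k) (hεk : ε * k ≤ 1 / 128)
    (hrel : relDist h ≤ 16 * ε * ∑ j, |(h j)⁻¹ - 1|) (j : ι) : |h j - 1| ≤ 64 * (k * ε) := by
  obtain ⟨j₀, -, hj₀⟩ := Finset.exists_max_image Finset.univ (fun j => |(h j)⁻¹ - 1|)
    ⟨j, Finset.mem_univ j⟩
  set g := |(h j₀)⁻¹ - 1| with hg
  have hg0 : 0 ≤ g := abs_nonneg _
  have h1 : ∑ j, |(h j)⁻¹ - 1| ≤ k * g := by
    rw [← Finset.sum_filter_add_sum_filter_not Finset.univ (fun j => h j ≠ 1)]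
    have : ∑ j ∈ Finset.univ.filter (fun j => ¬ h j ≠ 1), |(h j)⁻¹ - 1| = 0 := by
      refine Finset.sum_eq_zero fun i hi => ?_
      have : h i = 1 := by simpa using hi
      simp [this]
    rw [this, add_zero]
    refine (Finset.sum_le_card_nsmul _ _ g fun i _ => hj₀ i (Finset.mem_univ i)).trans ?_
    rw [nsmul_eq_mul]
    exact mul_le_mul_of_nonneg_right (by exact_mod_cast hk) hg0
  -- A single summand of `relDist` equals `g² / (1 + h⁻¹)`, and `h⁻¹ ≤ 1 + g`.
  have h2 : g ^ 2 / (2 + g) ≤ relDist h := by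
    refine le_trans ?_ (Finset.single_le_sum (f := fun i => (h i - 1) ^ 2 / (h i * (h i + 1)))
      (fun i _ => by have := hh i; positivity) (Finset.mem_univ j₀))
    have hp := hh j₀
    have e1 : (h j₀ - 1) ^ 2 / (h j₀ * (h j₀ + 1)) = g ^ 2 / (1 + (h j₀)⁻¹) := by
      rw [hg, sq_abs]; field_simp; ring
    rw [e1]
    refine div_le_div_of_nonneg_left (sq_nonneg _) (by positivity) ?_
    have := le_abs_self ((h j₀)⁻¹ - 1)
    linarith
  have h3 : g ^ 2 / (2 + g) ≤ 16 * ε * (k * g) :=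
    h2.trans (hrel.trans (mul_le_mul_of_nonneg_left h1 (by positivity)))
  rw [div_le_iff₀ (by positivity)] at h3
  set u := (k : ℝ) * ε with hu
  have hu0 : 0 ≤ u := by positivity
  have hu1 : u ≤ 1 / 128 := by rw [hu, mul_comm]; exact hεk
  -- From `g ≤ 16 u (2 + g)` with `16 u ≤ 1/8` follows `g ≤ (256/7) u < 37 u`. As then `h j ≤ 3/2`,
  -- going back from `h⁻¹` to `h` costs a factor `3/2`, and `37 · 3/2 < 64`.
  have h4 : g ≤ 37 * u := by
    rcases hg0.eq_or_lt with h0 | h0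
    · rw [← h0]; positivity
    · have : g ≤ 16 * u * (2 + g) := by
        have : g * g ≤ g * (16 * u * (2 + g)) := by rw [hu]; nlinarith
        exact le_of_mul_le_mul_left this h0
      nlinarith
  have h5 := (hj₀ j (Finset.mem_univ j)).trans h4
  have hp := hh j
  have e : h j - 1 = -((h j)⁻¹ - 1) * h j := by field_simp; ring
  have h6 : h j ≤ 3 / 2 := by
    have := (abs_le.1 h5).1
    have h7 : (0.7 : ℝ) ≤ (h j)⁻¹ := by linarith
    have := mul_le_mul_of_nonneg_right h7 hp.le
    rw [inv_mul_cancel₀ hp.ne'] at this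
    linarith
  rw [e, abs_mul, abs_neg, abs_of_pos hp]
  nlinarith [abs_nonneg ((h j)⁻¹ - 1)]

/-- **Main deterministic inequality.** If the noise is small in the natural metric, every
covariance `A` that differs from `As` by a matrix of small rank and is at least as likely as `As`
is close to `As` in the natural metric. -/
theorem abs_form_sub_le_of_loss_le [Nonempty κ] {A As : Matrix ι ι ℝ} (hAs : As.PosDef)
    (hA : A.PosDef) {s δ ε : ℝ} (hs : 0 < s) (hAss : ∀ x, s * (x ⬝ᵥ x) ≤ x ⬝ᵥ As *ᵥ x)
    (hAs' : ∀ x, s * (x ⬝ᵥ x) ≤ x ⬝ᵥ A *ᵥ x)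
    (E : κ → Matrix ι ι ℝ) (hEs : ∀ i, (E i)ᵀ = E i) (hδ0 : 0 ≤ δ) (hδ : δ ≤ 1 / 224)
    (hE : ∀ i x, |x ⬝ᵥ E i *ᵥ x| ≤ δ * (x ⬝ᵥ x)) (z : κ → ι → ℝ) (hε0 : 0 ≤ ε) (hε1 : ε ≤ 1)
    (hnoise : ∀ x, |∑ i, ((x ⬝ᵥ (As + s • E i)⁻¹ *ᵥ z i) ^ 2 - x ⬝ᵥ (As + s • E i)⁻¹ *ᵥ x)|
      ≤ Fintype.card κ * ε * (x ⬝ᵥ As⁻¹ *ᵥ x))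
    (hloss : ∑ i, (Real.log (A + s • E i).det - Real.log (As + s • E i).det
      + z i ⬝ᵥ (A + s • E i)⁻¹ *ᵥ z i - z i ⬝ᵥ (As + s • E i)⁻¹ *ᵥ z i) ≤ 0)
    {k : ℕ} (hk : (A - As).rank ≤ k) (hεk : ε * k ≤ 1 / 128) (x : ι → ℝ) :
    |x ⬝ᵥ (A - As) *ᵥ x| ≤ 64 * (k * ε) * (x ⬝ᵥ As *ᵥ x) := by
  obtain ⟨U, V, h, hUV, hVU, hAU, hBU⟩ := exists_simultaneous_diagonalization hAs hA.isHermitian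
  have hUVt : Vᵀ * Uᵀ = 1 := by rw [← transpose_mul, hUV, transpose_one]
  have hVUt : Uᵀ * Vᵀ = 1 := by rw [← transpose_mul, hVU, transpose_one]
  have hH : Vᵀ * A * V = diagonal h := by
    rw [hBU]
    calc Vᵀ * (Uᵀ * diagonal h * U) * V = (Vᵀ * Uᵀ) * diagonal h * (U * V) := by
          simp only [Matrix.mul_assoc]
      _ = _ := by rw [hUVt, hUV]; simp
  have hh : ∀ i, 0 < h i := by
    have hVinj : Function.Injective V.mulVec :=
      Matrix.mulVec_injective_of_isUnit ⟨⟨V, U, hVU, hUV⟩, rfl⟩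
    have := hA.conjTranspose_mul_mul_same hVinj
    rw [conjTranspose_eq_transpose_of_trivial, hH, posDef_diagonal_iff] at this
    exact this
  have formV : ∀ (Z : Matrix ι ι ℝ) (x y : ι → ℝ),
      x ⬝ᵥ (Vᵀ * Z * V) *ᵥ y = (V *ᵥ x) ⬝ᵥ Z *ᵥ (V *ᵥ y) := fun Z x y => by
    rw [← mulVec_mulVec, ← mulVec_mulVec, dotProduct_mulVec, vecMul_transpose]
  have formV' : ∀ (Z : Matrix ι ι ℝ) (x y : ι → ℝ),
      x ⬝ᵥ (V * Z * Vᵀ) *ᵥ y = (Vᵀ *ᵥ x) ⬝ᵥ Z *ᵥ (Vᵀ *ᵥ y) := fun Z x y => by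
    rw [← mulVec_mulVec, ← mulVec_mulVec, dotProduct_mulVec, ← mulVec_transpose]
  have hAs1 : Vᵀ * As * V = 1 := by
    rw [hAU, ← Matrix.mul_assoc, hUVt, Matrix.one_mul, hUV]
  -- This scaling turns the two lower bounds by `s` into `QᵀQ ≤ 1` and `QᵀQ ≤ diagonal h`.
  set Q := √s • V with hQ
  have hQf : ∀ x, Q *ᵥ x ⬝ᵥ Q *ᵥ x = s * (V *ᵥ x ⬝ᵥ V *ᵥ x) := fun x => by
    rw [hQ, smul_mulVec, smul_dotProduct, dotProduct_smul, smul_eq_mul, smul_eq_mul, ← mul_assoc,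
      Real.mul_self_sqrt hs.le]
  set F : κ → Matrix ι ι ℝ := fun i => Vᵀ * (s • E i) * V with hFdef
  have hXF : ∀ i, A + s • E i = Uᵀ * (diagonal h + F i) * U := fun i => by
    rw [hFdef, Matrix.mul_add, Matrix.add_mul, ← hBU]
    congr 1
    calc s • E i = (Uᵀ * Vᵀ) * (s • E i) * (V * U) := by rw [hVUt, hVU]; simp
      _ = _ := by simp only [Matrix.mul_assoc]
  have hYF : ∀ i, As + s • E i = Uᵀ * (1 + F i) * U := fun i => by
    rw [hFdef, Matrix.mul_add, Matrix.add_mul, Matrix.mul_one, ← hAU]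
    congr 1
    calc s • E i = (Uᵀ * Vᵀ) * (s • E i) * (V * U) := by rw [hVUt, hVU]; simp
      _ = _ := by simp only [Matrix.mul_assoc]
  have hQ1 : ∀ x, Q *ᵥ x ⬝ᵥ Q *ᵥ x ≤ x ⬝ᵥ x := fun x => by
    rw [hQf]
    have := hAss (V *ᵥ x)
    rwa [← formV, hAs1, one_mulVec] at this
  have hQh : ∀ x, Q *ᵥ x ⬝ᵥ Q *ᵥ x ≤ x ⬝ᵥ diagonal h *ᵥ x := fun x => by
    rw [hQf]
    have := hAs' (V *ᵥ x)
    rwa [← formV, hH] at this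
  have hFs : ∀ i, (F i)ᵀ = F i := fun i => by
    rw [hFdef]
    simp only [transpose_mul, transpose_smul, transpose_transpose, hEs i, Matrix.mul_assoc]
  have hF : ∀ i x, |x ⬝ᵥ F i *ᵥ x| ≤ δ * (Q *ᵥ x ⬝ᵥ Q *ᵥ x) := fun i x => by
    rw [hFdef, formV, smul_mulVec, dotProduct_smul, smul_eq_mul, abs_mul, abs_of_pos hs, hQf]
    have := hE i (V *ᵥ x)
    nlinarith
  have hY := fun i => posDef_one_add hQ1 (hFs i) hδ0 hδ (hF i)
  have hX := fun i => posDef_diagonal_add hh hQh (hFs i) hδ0 hδ (hF i)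
  have invform : ∀ Z : Matrix ι ι ℝ, Z.PosDef → (Uᵀ * Z * U)⁻¹ = V * Z⁻¹ * Vᵀ := fun Z hZ => by
    apply inv_eq_of_mul
    calc Uᵀ * Z * U * (V * Z⁻¹ * Vᵀ) = Uᵀ * Z * (U * V) * Z⁻¹ * Vᵀ := by
          simp only [Matrix.mul_assoc]
      _ = Uᵀ * (Z * Z⁻¹) * Vᵀ := by rw [hUV, Matrix.mul_one]; simp only [Matrix.mul_assoc]
      _ = 1 := by rw [PosDef.mul_inv hZ, Matrix.mul_one, hVUt]
  have hUdet : U.det ≠ 0 := fun h0 => by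
    have := congrArg det hUV
    rw [det_mul, h0, det_one] at this; simp at this
  have hlogdet : ∀ Z : Matrix ι ι ℝ, Z.PosDef →
      Real.log (Uᵀ * Z * U).det = 2 * Real.log U.det + Real.log Z.det := fun Z hZ => by
    rw [det_mul, det_mul, det_transpose, Real.log_mul (mul_ne_zero hUdet hZ.det_pos.ne') hUdet,
      Real.log_mul hUdet hZ.det_pos.ne']
    ring
  have hAsi : As⁻¹ = V * 1⁻¹ * Vᵀ := by
    rw [← invform 1 PosDef.one, Matrix.mul_one, ← hAU]
  have hrel : relDist h ≤ 16 * ε * ∑ j, |(h j)⁻¹ - 1| := by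
    refine relDist_le_of_loss_le_diagonal (κ := κ) hh hQ1 hQh F hFs hδ0 hδ hF
      (fun i => Vᵀ *ᵥ z i) hε1 (fun x => ?_) ?_
    · have := hnoise (Uᵀ *ᵥ x)
      have e : Vᵀ *ᵥ (Uᵀ *ᵥ x) = x := by rw [mulVec_mulVec, hUVt, one_mulVec]
      simp only [hYF, invform _ (hY _), formV', e, hAsi, inv_one, one_mulVec] at this
      exact this
    · refine le_of_eq_of_le (Finset.sum_congr rfl fun i _ => ?_) hloss
      rw [hXF, hYF, invform _ (hX i), invform _ (hY i), formV', formV', hlogdet _ (hX i),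
        hlogdet _ (hY i)]
      ring
  have hDd : A - As = Uᵀ * diagonal (fun i => h i - 1) * U := by
    rw [hBU, hAU, ← diagonal_sub, diagonal_one, Matrix.mul_sub, Matrix.sub_mul, Matrix.mul_one]
  -- Congruence does not increase the rank, and the rank of `diagonal (h - 1)` counts the `h j ≠ 1`.
  have hcard : (Finset.univ.filter fun j => h j ≠ 1).card ≤ k := by
    have e : Vᵀ * (A - As) * V = diagonal (fun i => h i - 1) := by
      rw [Matrix.mul_sub, Matrix.sub_mul, hH, hAs1, ← diagonal_one, diagonal_sub]
    have h1 : (diagonal (fun i => h i - 1)).rank ≤ k := by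
      rw [← e]
      exact (rank_mul_le_left _ _).trans ((rank_mul_le_right _ _).trans hk)
    rw [rank_diagonal, Fintype.card_subtype] at h1
    simpa [sub_eq_zero] using h1
  have hfin := abs_sub_one_le_of_relDist_le hh hε0 hcard hεk hrel
  have formU : ∀ (Z : Matrix ι ι ℝ) (x : ι → ℝ),
      x ⬝ᵥ (Uᵀ * Z * U) *ᵥ x = (U *ᵥ x) ⬝ᵥ Z *ᵥ (U *ᵥ x) := fun Z x => by
    rw [← mulVec_mulVec, ← mulVec_mulVec, dotProduct_mulVec, vecMul_transpose]
  have e2 : x ⬝ᵥ As *ᵥ x = ∑ j, (U *ᵥ x) j ^ 2 := by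
    rw [hAU, ← Matrix.mul_one Uᵀ, formU, one_mulVec]
    simp [dotProduct, sq]
  rw [hDd, formU, diagonal_form, e2, Finset.mul_sum]
  refine (Finset.abs_sum_le_sum_abs _ _).trans (Finset.sum_le_sum fun j _ => ?_)
  rw [abs_mul, abs_of_nonneg (sq_nonneg ((U *ᵥ x) j))]
  exact mul_le_mul_of_nonneg_right (hfin j) (sq_nonneg _)

end Key

/-! ### Eigenvalues and eigenvectors under a relative perturbation bound. -/

section Spectral

/-- Cauchy–Schwarz inequality for a symmetric form dominated by a nonnegative one. -/
theorem sq_bilin_le {ι : Type*} [Fintype ι] [DecidableEq ι] {D A : Matrix ι ι ℝ} {κ : ℝ}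
    (hD : Dᵀ = D) (hA : Aᵀ = A)
    (h : ∀ x, |x ⬝ᵥ D *ᵥ x| ≤ κ * (x ⬝ᵥ A *ᵥ x)) (x y : ι → ℝ) :
    (x ⬝ᵥ D *ᵥ y) ^ 2 ≤ κ ^ 2 * ((x ⬝ᵥ A *ᵥ x) * (y ⬝ᵥ A *ᵥ y)) := by
  -- Combining the bounds at `t x + y` and `t x - y` gives a quadratic polynomial in `t` without
  -- sign change; its discriminant is the claim.
  have key : ∀ t : ℝ, 0 ≤ (κ * (x ⬝ᵥ A *ᵥ x)) * (t * t) + (2 * (x ⬝ᵥ D *ᵥ y)) * t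
      + κ * (y ⬝ᵥ A *ᵥ y) := fun t => by
    have h1 := (abs_le.1 (h (t • x + y))).1
    have h2 := (abs_le.1 (h (t • x - y))).2
    simp only [mulVec_add, mulVec_sub, mulVec_smul, add_dotProduct, dotProduct_add, sub_dotProduct,
      dotProduct_sub, smul_dotProduct, dotProduct_smul, smul_eq_mul] at h1 h2
    rw [dotProduct_mulVec_symm hD y x, dotProduct_mulVec_symm hA y x] at h1 h2
    nlinarith
  have := discrim_le_zero key
  rw [discrim] at this
  nlinarith

/-- Quadratic form of a matrix `B Λ Bᵀ`. -/
theorem lowRank_form {M r : ℕ} (B : Matrix (Fin M) (Fin r) ℝ) (L : Fin r → ℝ) (x y : Fin M → ℝ) :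
    x ⬝ᵥ (B * diagonal L * Bᵀ) *ᵥ y = ∑ k, L k * (x ⬝ᵥ Bᵀ k) * (y ⬝ᵥ Bᵀ k) := by
  rw [← mulVec_mulVec, ← mulVec_mulVec, dotProduct_mulVec, ← mulVec_transpose]
  simp only [dotProduct, mulVec_diagonal]
  refine Finset.sum_congr rfl fun k _ => ?_
  change (∑ i, Bᵀ k i * x i) * (L k * ∑ i, Bᵀ k i * y i) = _
  rw [Finset.sum_congr rfl fun i _ => mul_comm (Bᵀ k i) (x i),
    Finset.sum_congr rfl fun i _ => mul_comm (Bᵀ k i) (y i)]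
  ring

theorem dotProduct_transpose_of_orthonormal {M r : ℕ} {B : Matrix (Fin M) (Fin r) ℝ}
    (hB : Bᵀ * B = 1) (j k : Fin r) : Bᵀ j ⬝ᵥ Bᵀ k = if j = k then 1 else 0 := by
  have := congrFun (congrFun hB j) k
  rwa [Matrix.mul_apply, one_apply] at this

theorem transpose_lowRank {M r : ℕ} (B : Matrix (Fin M) (Fin r) ℝ) (L : Fin r → ℝ) :
    (B * diagonal L * Bᵀ)ᵀ = B * diagonal L * Bᵀ := by
  rw [transpose_mul, transpose_mul, transpose_transpose, diagonal_transpose, Matrix.mul_assoc]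

theorem frob_le_of_sum_le {p q : ℕ} {A : Matrix (Fin p) (Fin q) ℝ} {a : ℝ} (ha : 0 ≤ a)
    (h : ∑ i, ∑ j, A i j ^ 2 ≤ a ^ 2) : frob A ≤ a :=
  (Real.sqrt_le_left ha).2 h

/-- The matrix obtained from `B` by permuting the columns and multiplying them by `e`. -/
def colTransform {M r : ℕ} (B : Matrix (Fin M) (Fin r) ℝ) (p : Equiv.Perm (Fin r)) (e : Fin r → ℝ) :
    Matrix (Fin M) (Fin r) ℝ :=
  Matrix.of fun i k => e k * B i (p k)

set_option maxHeartbeats 1600000 in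
/-- If the form of `B Λ Bᵀ - B₀ Λ₀ B₀ᵀ` is small relative to that of `B₀ Λ₀ B₀ᵀ + s`, and the
entries of `Λ₀` are separated, then, up to signs and the order of the columns, `B` and `Λ` are
close to `B₀` and `Λ₀`. -/
theorem exists_colTransform_close (r : ℕ) {c C g : ℝ} (hc : 0 < c) (hC : 0 < C) (hg : 0 < g) :
    ∃ κ₀ : ℝ, 0 < κ₀ ∧ ∃ C₁ : ℝ, 0 < C₁ ∧ ∀ (M : ℕ) (B B₀ : Matrix (Fin M) (Fin r) ℝ)
      (L L₀ : Fin r → ℝ) (s κ : ℝ), Bᵀ * B = 1 → B₀ᵀ * B₀ = 1 → (∀ k, 0 < L k) →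
      (∀ k, c ≤ L₀ k) → (∀ k, L₀ k ≤ C) → (∀ j k, j ≠ k → g ≤ |L₀ j - L₀ k|) →
      0 < s → s ≤ 1 → 0 ≤ κ → κ ≤ κ₀ →
      (∀ x, |x ⬝ᵥ (B * diagonal L * Bᵀ - B₀ * diagonal L₀ * B₀ᵀ) *ᵥ x|
        ≤ κ * (x ⬝ᵥ (B₀ * diagonal L₀ * B₀ᵀ + s • 1) *ᵥ x)) →
      ∃ (p : Equiv.Perm (Fin r)) (e : Fin r → ℝ), (∀ k, e k = 1 ∨ e k = -1) ∧
        frob ((1 - B₀ * B₀ᵀ) * (colTransform B p e - B₀)) ≤ C₁ * √s * κ ∧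
        frob (B₀ᵀ * (colTransform B p e - B₀)) ≤ C₁ * κ ∧
        ∀ k, |L (p k) - L₀ k| ≤ C₁ * κ := by
  set D := C + 1 with hD
  have hD1 : 1 ≤ D := by linarith
  have hD0 : 0 < D := by linarith
  have hr0 : (0 : ℝ) ≤ r := Nat.cast_nonneg r
  set τ := c / (2 * (r + 1) * D) with hτ
  have hτ0 : 0 < τ := by positivity
  set a₁ := 2 * D / g with ha₁
  set a₂ := 2 * (r + 1) * D / c with ha₂
  have ha₁0 : 0 < a₁ := by positivity
  have ha₂0 : 0 < a₂ := by positivity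
  set a₃ := r * a₁ ^ 2 + a₂ ^ 2 with ha₃
  have ha₃0 : 0 < a₃ := by positivity
  -- The three thresholds give `κ D ≤ c/2`, `κ D ≤ 1` and `κ D / τ ≤ g/4`: respectively for finding
  -- a matching column, for bounding `L` and `κ`, and for the matching to be injective.
  refine ⟨min (min (c / (2 * D)) (1 / D)) (g * τ / (4 * D)), by positivity,
    D / τ + (r + 1) * (a₁ + a₂ + a₃), by positivity, ?_⟩
  intro M B B₀ L L₀ s κ hB hB₀ hL hL₀c hL₀C hgap hs hs1 hκ hκ₀ hform
  have hκ1 : κ * D ≤ c / 2 := by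
    have := hκ₀.trans ((min_le_left _ _).trans (min_le_left _ _))
    rw [le_div_iff₀ (by positivity)] at this; linarith
  have hκ2 : κ * D ≤ 1 := by
    have := hκ₀.trans ((min_le_left _ _).trans (min_le_right _ _))
    rwa [le_div_iff₀ (by positivity)] at this
  have hκ3 : κ * D / τ ≤ g / 4 := by
    have := hκ₀.trans (min_le_right _ _)
    rw [le_div_iff₀ (by positivity)] at this
    rw [div_le_iff₀ hτ0]; linarith
  have hκ4 : κ ≤ 1 := by nlinarith
  have hoB := dotProduct_transpose_of_orthonormal hB
  have hoB₀ := dotProduct_transpose_of_orthonormal hB₀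
  set S := B * diagonal L * Bᵀ with hS
  set S₀ := B₀ * diagonal L₀ * B₀ᵀ with hS₀
  set t : Fin r → Fin r → ℝ := fun k j => Bᵀ k ⬝ᵥ B₀ᵀ j with ht
  set q : Fin r → Fin M → ℝ := fun k => Bᵀ k - ∑ j, t k j • B₀ᵀ j with hq
  have hqo : ∀ k j, q k ⬝ᵥ B₀ᵀ j = 0 := fun k j => by
    rw [hq]
    simp only [sub_dotProduct, sum_dotProduct, smul_dotProduct, hoB₀, smul_eq_mul, mul_ite,
      mul_one, mul_zero, Finset.sum_ite_eq', Finset.mem_univ, if_true]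
    exact sub_self _
  have hqB : ∀ k, q k ⬝ᵥ q k = q k ⬝ᵥ Bᵀ k := fun k => by
    conv_lhs => rw [show q k ⬝ᵥ q k = q k ⬝ᵥ (Bᵀ k - ∑ j, t k j • B₀ᵀ j) from rfl]
    simp [dotProduct_sub, dotProduct_sum, hqo]
  have hpyth : ∀ k, q k ⬝ᵥ q k = 1 - ∑ j, t k j ^ 2 := fun k => by
    rw [hqB, hq]
    simp only [sub_dotProduct, sum_dotProduct, smul_dotProduct, hoB, if_true, smul_eq_mul]
    congr 1
    exact Finset.sum_congr rfl fun j _ => by rw [dotProduct_comm, sq]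
  have hq0 : ∀ k, 0 ≤ q k ⬝ᵥ q k := fun k => dotProduct_self_nonneg_real _
  have ht1 : ∀ k, ∑ j, t k j ^ 2 ≤ 1 := fun k => by linarith [hpyth k, hq0 k]
  have htle : ∀ k j, |t k j| ≤ 1 := fun k j => by
    have := (Finset.single_le_sum (f := fun j => t k j ^ 2) (fun _ _ => sq_nonneg _)
      (Finset.mem_univ j)).trans (ht1 k)
    exact (sq_le_one_iff_abs_le_one _).1 this
  -- values of the forms
  have hSform : ∀ x k, x ⬝ᵥ S *ᵥ Bᵀ k = L k * (x ⬝ᵥ Bᵀ k) := fun x k => by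
    rw [hS, lowRank_form]; simp [hoB]
  have hS₀form : ∀ x k, x ⬝ᵥ S₀ *ᵥ Bᵀ k = ∑ j, L₀ j * (x ⬝ᵥ B₀ᵀ j) * t k j := fun x k => by
    rw [hS₀, lowRank_form]
  have hA₀ : ∀ x, x ⬝ᵥ (S₀ + s • 1) *ᵥ x = x ⬝ᵥ S₀ *ᵥ x + s * (x ⬝ᵥ x) := fun x => by
    rw [add_mulVec, dotProduct_add, smul_mulVec, one_mulVec, dotProduct_smul, smul_eq_mul]
  have hA₀t : (S₀ + s • 1)ᵀ = S₀ + s • 1 := by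
    rw [transpose_add, hS₀, transpose_lowRank, transpose_smul, transpose_one]
  have hDt : (S - S₀)ᵀ = S - S₀ := by rw [transpose_sub, hS, hS₀, transpose_lowRank,
    transpose_lowRank]
  have hAB : ∀ k, Bᵀ k ⬝ᵥ (S₀ + s • 1) *ᵥ Bᵀ k ≤ D := fun k => by
    rw [hA₀, hoB, if_pos rfl, hS₀form]
    have : ∑ j, L₀ j * (Bᵀ k ⬝ᵥ B₀ᵀ j) * t k j ≤ ∑ j, C * t k j ^ 2 :=
      Finset.sum_le_sum fun j _ => by
        have := mul_le_mul_of_nonneg_right (hL₀C j) (sq_nonneg (t k j))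
        rw [sq, ← mul_assoc] at this; simpa [mul_assoc, sq] using this
    rw [← Finset.mul_sum] at this
    have h2 := mul_le_mul_of_nonneg_left (ht1 k) hC.le
    rw [hD]; linarith
  have hAB0 : ∀ x, 0 ≤ x ⬝ᵥ (S₀ + s • 1) *ᵥ x := fun x => by
    rw [hA₀, hS₀, lowRank_form]
    have : 0 ≤ ∑ k, L₀ k * (x ⬝ᵥ B₀ᵀ k) * (x ⬝ᵥ B₀ᵀ k) := Finset.sum_nonneg fun k _ => by
      rw [mul_assoc]; exact mul_nonneg (hc.le.trans (hL₀c k)) (mul_self_nonneg _)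
    have := mul_nonneg hs.le (dotProduct_self_nonneg_real x)
    linarith
  have hAB₀ : ∀ j, B₀ᵀ j ⬝ᵥ (S₀ + s • 1) *ᵥ B₀ᵀ j ≤ D := fun j => by
    rw [hA₀, hoB₀, if_pos rfl, hS₀, lowRank_form]
    simp only [hoB₀, mul_ite, mul_one, mul_zero, Finset.sum_ite_eq, Finset.mem_univ, if_true]
    linarith [hL₀C j]
  -- Each `q k` is the part of a column of `B` orthogonal to the range of `B₀`, where the reference
  -- form is only `s`. This is the origin of the factor `√s` in the first bound.
  have hAq : ∀ k, q k ⬝ᵥ (S₀ + s • 1) *ᵥ q k = s * (q k ⬝ᵥ q k) := fun k => by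
    rw [hA₀, hS₀, lowRank_form]; simp [hqo]
  have hDD : κ ^ 2 * (D * D) = (κ * D) ^ 2 := by ring
  -- Tested on the pair `B₀ᵀ j`, `Bᵀ k`, the difference `S - S₀` gives `(L k - L₀ j) t k j`: either
  -- the eigenvalues are close or the vectors are nearly orthogonal.
  have ha : ∀ k j, |L k - L₀ j| * |t k j| ≤ κ * D := fun k j => by
    have h1 := sq_bilin_le hDt hA₀t hform (B₀ᵀ j) (Bᵀ k)
    have e : B₀ᵀ j ⬝ᵥ (S - S₀) *ᵥ Bᵀ k = (L k - L₀ j) * t k j := by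
      rw [sub_mulVec, dotProduct_sub, hSform, hS₀form, dotProduct_comm]
      simp [hoB₀, ht]
      ring
    rw [e] at h1
    have h2 : (B₀ᵀ j ⬝ᵥ (S₀ + s • 1) *ᵥ B₀ᵀ j) * (Bᵀ k ⬝ᵥ (S₀ + s • 1) *ᵥ Bᵀ k) ≤ D * D :=
      mul_le_mul (hAB₀ j) (hAB k) (hAB0 _) hD0.le
    have h3 := h1.trans (mul_le_mul_of_nonneg_left h2 (sq_nonneg κ))
    rw [← abs_mul]
    rw [hDD] at h3
    exact abs_le_of_sq_le_sq h3 (by positivity)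
  -- Tested on `q k`, `Bᵀ k`, the form of `S₀` vanishes and that of `S` gives `L k |q k|²`; one
  -- factor `|q k|` cancels.
  have hb : ∀ k, L k * √(q k ⬝ᵥ q k) ≤ κ * D * √s := fun k => by
    have h1 := sq_bilin_le hDt hA₀t hform (q k) (Bᵀ k)
    have e : q k ⬝ᵥ (S - S₀) *ᵥ Bᵀ k = L k * (q k ⬝ᵥ q k) := by
      rw [sub_mulVec, dotProduct_sub, hSform, hS₀form, hqB]
      simp [hqo]
    rw [e, hAq] at h1
    set v := √(q k ⬝ᵥ q k) with hv
    have hv2 : q k ⬝ᵥ q k = v ^ 2 := (Real.sq_sqrt (hq0 k)).symm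
    have hv0 : 0 ≤ v := Real.sqrt_nonneg _
    have hs2 : s = √s ^ 2 := (Real.sq_sqrt hs.le).symm
    rw [hv2] at h1
    rcases hv0.eq_or_lt with h0 | h0
    · rw [← h0]; simp; positivity
    have h2 : (L k * v) ^ 2 * v ^ 2 ≤ (κ * D * √s) ^ 2 * v ^ 2 := by
      have h3 : (Bᵀ k ⬝ᵥ (S₀ + s • 1) *ᵥ Bᵀ k) ≤ D * D := (hAB k).trans (by nlinarith)
      have h4 : κ ^ 2 * (s * v ^ 2 * (Bᵀ k ⬝ᵥ (S₀ + s • 1) *ᵥ Bᵀ k))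
          ≤ κ ^ 2 * (s * v ^ 2 * (D * D)) := by gcongr
      have h5 : (κ * D * √s) ^ 2 = κ ^ 2 * D ^ 2 * s := by rw [mul_pow, ← hs2]; ring
      rw [h5]; nlinarith
    have h3 := le_of_mul_le_mul_right h2 (by positivity)
    exact abs_le_of_sq_le_sq' h3 (by positivity) |>.2
  have hLD : ∀ k, L k ≤ D := fun k => by
    have h1 := (abs_le.1 (hform (Bᵀ k))).2
    have h2 := mul_le_mul_of_nonneg_left (hAB k) hκ
    have h3 := hAB k
    rw [sub_mulVec, dotProduct_sub, hSform, hoB, if_pos rfl, mul_one] at h1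
    rw [hA₀, hoB, if_pos rfl] at h3
    have h4 : Bᵀ k ⬝ᵥ S₀ *ᵥ Bᵀ k ≤ C := by
      rw [hS₀form]
      have : ∑ j, L₀ j * (Bᵀ k ⬝ᵥ B₀ᵀ j) * t k j ≤ ∑ j, C * t k j ^ 2 :=
        Finset.sum_le_sum fun j _ => by
          have := mul_le_mul_of_nonneg_right (hL₀C j) (sq_nonneg (t k j))
          rw [sq, ← mul_assoc] at this; simpa [mul_assoc, sq] using this
      rw [← Finset.mul_sum] at this
      have h2 := mul_le_mul_of_nonneg_left (ht1 k) hC.le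
      linarith
    linarith
  -- No lower bound on `L` is given. If no column of `B` carried a fixed share of direction `B₀ᵀ j`,
  -- the form of `S` there would be below `c/2`, although that of `S₀` is at least `c` and the error
  -- at most `c/2`. The choice of columns is then injective by the gap `g`, hence a permutation,
  -- which also bounds all of `L` from below.
  have hcov : ∀ j, ∃ k, c / (2 * (r + 1)) ≤ L k * t k j ^ 2 := fun j => by
    by_contra hcon
    push Not at hcon
    have h1 := (abs_le.1 (hform (B₀ᵀ j))).1
    have h2 := mul_le_mul_of_nonneg_left (hAB₀ j) hκ
    have e1 : B₀ᵀ j ⬝ᵥ S₀ *ᵥ B₀ᵀ j = L₀ j := by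
      rw [hS₀, lowRank_form]; simp [hoB₀]
    have e2 : B₀ᵀ j ⬝ᵥ S *ᵥ B₀ᵀ j = ∑ k, L k * t k j ^ 2 := by
      rw [hS, lowRank_form]
      exact Finset.sum_congr rfl fun k _ => by rw [dotProduct_comm]; simp only [ht]; ring
    rw [sub_mulVec, dotProduct_sub, e1, e2] at h1
    have h3 : ∑ k, L k * t k j ^ 2 ≤ ∑ _k : Fin r, c / (2 * (r + 1)) :=
      Finset.sum_le_sum fun k _ => (hcon k).le
    rw [Finset.sum_const, Finset.card_univ, Fintype.card_fin, nsmul_eq_mul] at h3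
    have h4 : r * (c / (2 * (r + 1))) < c / 2 := by
      rw [← mul_div_assoc, div_lt_div_iff₀ (by positivity) (by positivity)]; nlinarith
    linarith [hL₀c j]
  choose f hf using hcov
  have htf : ∀ j, τ ≤ |t (f j) j| := fun j => by
    have h1 : t (f j) j ^ 2 ≤ |t (f j) j| := by
      rw [← sq_abs, sq]; nlinarith [htle (f j) j, abs_nonneg (t (f j) j)]
    have h2 := mul_le_mul_of_nonneg_right (hLD (f j)) (sq_nonneg (t (f j) j))
    have h3 := (hf j).trans h2
    rw [hτ, div_le_iff₀ (by positivity)]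
    rw [div_le_iff₀ (by positivity)] at h3
    have h4 := mul_le_mul_of_nonneg_left h1 (show 0 ≤ 2 * (r + 1) * D by positivity)
    linarith
  have hLf : ∀ j, |L (f j) - L₀ j| ≤ κ * D / τ := fun j => by
    rw [le_div_iff₀ hτ0]
    exact (mul_le_mul_of_nonneg_left (htf j) (abs_nonneg _)).trans (ha _ _)
  have hfinj : Function.Injective f := fun i j hij => by
    by_contra hne
    have h1 := hLf i
    have h2 := hLf j
    rw [← hij] at h2
    have h3 := hgap i j hne
    have h4 : |L₀ i - L₀ j| ≤ |L (f i) - L₀ i| + |L (f i) - L₀ j| := by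
      rw [abs_sub_comm (L (f i)) (L₀ i)]; exact abs_sub_le _ _ _
    linarith
  have hfbij : Function.Bijective f := Finite.injective_iff_bijective.1 hfinj
  have hLlow : ∀ j, c / (2 * (r + 1)) ≤ L (f j) := fun j => by
    have := hf j
    have h1 : t (f j) j ^ 2 ≤ 1 := (sq_le_one_iff_abs_le_one _).2 (htle _ _)
    nlinarith [hL (f j)]
  have hqbd : ∀ j, √(q (f j) ⬝ᵥ q (f j)) ≤ a₂ * √s * κ := fun j => by
    have h1 := (mul_le_mul_of_nonneg_right (hLlow j) (Real.sqrt_nonneg _)).trans (hb (f j))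
    rw [div_mul_eq_mul_div, div_le_iff₀ (by positivity)] at h1
    have e : a₂ * √s * κ = (κ * D * √s * (2 * (r + 1))) / c := by rw [ha₂]; ring
    rw [e, le_div_iff₀ hc]; linarith
  have hqbd2 : ∀ j, q (f j) ⬝ᵥ q (f j) ≤ (a₂ * √s * κ) ^ 2 := fun j => by
    rw [← Real.sqrt_le_left (by positivity)]; exact hqbd j
  have htoff : ∀ j i, i ≠ j → |t (f j) i| ≤ a₁ * κ := fun j i hij => by
    have h1 := hgap i j hij
    have h2 := hLf j
    have h4 : |L₀ i - L₀ j| ≤ |L (f j) - L₀ i| + |L (f j) - L₀ j| := by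
      rw [abs_sub_comm (L (f j)) (L₀ i)]; exact abs_sub_le _ _ _
    have h5 : g / 2 ≤ |L (f j) - L₀ i| := by linarith
    have h6 := (mul_le_mul_of_nonneg_right h5 (abs_nonneg _)).trans (ha (f j) i)
    have e : a₁ * κ = (2 * (κ * D)) / g := by rw [ha₁]; ring
    rw [e, le_div_iff₀ hg]; linarith
  -- By Pythagoras `1 - t²` is the sum of the squares of the off-diagonal coefficients and of
  -- `|q|²`, which is of order `κ²`; moreover `1 - |t| ≤ 1 - t²`.
  have htdiag : ∀ j, 1 - |t (f j) j| ≤ a₃ * κ := fun j => by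
    have h1 := hpyth (f j)
    rw [← Finset.add_sum_erase _ _ (Finset.mem_univ j)] at h1
    have h2 : ∑ i ∈ Finset.univ.erase j, t (f j) i ^ 2 ≤ r * (a₁ * κ) ^ 2 := by
      refine (Finset.sum_le_card_nsmul _ _ ((a₁ * κ) ^ 2) fun i hi => ?_).trans ?_
      · rw [← sq_abs]
        exact pow_le_pow_left₀ (abs_nonneg _) (htoff j i (Finset.ne_of_mem_erase hi)) 2
      · rw [nsmul_eq_mul]
        refine mul_le_mul_of_nonneg_right ?_ (sq_nonneg _)
        have := Finset.card_erase_le (s := (Finset.univ : Finset (Fin r))) (a := j)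
        rw [Finset.card_univ, Fintype.card_fin] at this
        exact_mod_cast this
    have h3 := hqbd2 j
    have h4 : (a₂ * √s * κ) ^ 2 ≤ (a₂ * κ) ^ 2 := by
      have : (a₂ * √s * κ) ^ 2 = s * (a₂ * κ) ^ 2 := by
        rw [mul_pow, mul_pow, Real.sq_sqrt hs.le]; ring
      rw [this]; nlinarith [sq_nonneg (a₂ * κ)]
    have h5 : t (f j) j ^ 2 ≤ |t (f j) j| := by
      rw [← sq_abs, sq]; nlinarith [htle (f j) j, abs_nonneg (t (f j) j)]
    have h6 : a₃ * κ ^ 2 ≤ a₃ * κ := by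
      refine mul_le_mul_of_nonneg_left ?_ ha₃0.le; nlinarith
    have h7 : r * (a₁ * κ) ^ 2 + (a₂ * κ) ^ 2 = a₃ * κ ^ 2 := by rw [ha₃]; ring
    linarith
  set e : Fin r → ℝ := fun j => if 0 ≤ t (f j) j then 1 else -1 with he
  have he1 : ∀ j, e j = 1 ∨ e j = -1 := fun j => by
    simp only [he]; split_ifs <;> simp
  have het : ∀ j, e j * t (f j) j = |t (f j) j| := fun j => by
    simp only [he]; split_ifs with h
    · rw [one_mul, abs_of_nonneg h]
    · rw [abs_of_neg (not_le.1 h)]; ring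
  have heabs : ∀ j, e j ^ 2 = 1 := fun j => by rcases he1 j with h | h <;> rw [h] <;> norm_num
  refine ⟨Equiv.ofBijective f hfbij, e, he1, ?_, ?_, fun k => ?_⟩
  · have hent : ∀ i j, ((1 - B₀ * B₀ᵀ) * (colTransform B (Equiv.ofBijective f hfbij) e - B₀) :
        Matrix (Fin M) (Fin r) ℝ) i j
        = e j * q (f j) i := fun i j => by
      have e1 : (1 - B₀ * B₀ᵀ) * B₀ = 0 := by
        rw [Matrix.sub_mul, Matrix.one_mul, Matrix.mul_assoc, hB₀, Matrix.mul_one, sub_self]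
      rw [Matrix.mul_sub, e1, sub_zero, Matrix.sub_mul, Matrix.one_mul, Matrix.mul_assoc,
        Matrix.sub_apply, hq, mul_apply]
      have e2 : ∀ l, (B₀ᵀ * colTransform B (Equiv.ofBijective f hfbij) e) l j = e j * t (f j) l :=
        fun l => by
          rw [mul_apply, ht]
          simp only [dotProduct, Finset.mul_sum]
          exact Finset.sum_congr rfl fun i _ => by
            simp only [colTransform, of_apply, transpose_apply, Equiv.ofBijective_apply]; ring
      simp only [e2, Pi.sub_apply, Finset.sum_apply, Pi.smul_apply, smul_eq_mul, transpose_apply,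
        mul_sub, Finset.mul_sum]
      congr 1
      exact Finset.sum_congr rfl fun l _ => by ring
    refine frob_le_of_sum_le (by positivity) ?_
    rw [Finset.sum_comm]
    have h1 : ∀ j, ∑ i, ((1 - B₀ * B₀ᵀ) *
        (colTransform B (Equiv.ofBijective f hfbij) e - B₀) : Matrix (Fin M) (Fin r) ℝ) i j ^ 2
          ≤ (a₂ * √s * κ) ^ 2 := fun j => by
      refine le_of_eq_of_le ?_ (hqbd2 j)
      rw [dotProduct]
      refine Finset.sum_congr rfl fun i _ => ?_
      rw [hent, mul_pow, heabs]; ring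
    refine (Finset.sum_le_sum fun j _ => h1 j).trans ?_
    rw [Finset.sum_const, Finset.card_univ, Fintype.card_fin, nsmul_eq_mul]
    have h2 : (r : ℝ) * (a₂ * √s * κ) ^ 2 ≤ ((r + 1) * (a₂ * √s * κ)) ^ 2 := by
      rw [mul_pow ((r : ℝ) + 1)]
      exact mul_le_mul_of_nonneg_right (by nlinarith) (sq_nonneg _)
    refine h2.trans (pow_le_pow_left₀ (by positivity) ?_ 2)
    have h3 : (r + 1) * a₂ ≤ D / τ + (r + 1) * (a₁ + a₂ + a₃) := by
      have : 0 < D / τ := by positivity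
      nlinarith
    have h4 := mul_le_mul_of_nonneg_right h3 (show 0 ≤ √s * κ by positivity)
    linarith
  · have hent : ∀ i j, |(B₀ᵀ * (colTransform B (Equiv.ofBijective f hfbij) e - B₀)) i j|
        ≤ (a₁ + a₃) * κ := fun i j => by
      have e2 : (B₀ᵀ * colTransform B (Equiv.ofBijective f hfbij) e) i j = e j * t (f j) i := by
        rw [mul_apply, ht]
        simp only [dotProduct, Finset.mul_sum]
        exact Finset.sum_congr rfl fun i _ => by
          simp only [colTransform, of_apply, transpose_apply, Equiv.ofBijective_apply]; ring
      rw [Matrix.mul_sub, Matrix.sub_apply, e2, hB₀, one_apply]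
      split_ifs with hij
      · rw [hij, het, abs_sub_comm, abs_of_nonneg (by linarith [htle (f j) j])]
        have := htdiag j
        have : 0 ≤ a₁ * κ := by positivity
        linarith
      · rw [sub_zero, abs_mul, ← Real.sqrt_sq_eq_abs (e j), heabs, Real.sqrt_one, one_mul]
        have := htoff j i hij
        have : 0 ≤ a₃ * κ := by positivity
        linarith
    refine frob_le_of_sum_le (by positivity) ?_
    have h1 : ∑ i, ∑ j, (B₀ᵀ * (colTransform B (Equiv.ofBijective f hfbij) e - B₀)) i j ^ 2
        ≤ ∑ _i : Fin r, ∑ _j : Fin r, ((a₁ + a₃) * κ) ^ 2 :=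
      Finset.sum_le_sum fun i _ => Finset.sum_le_sum fun j _ => by
        rw [← sq_abs]; exact pow_le_pow_left₀ (abs_nonneg _) (hent i j) 2
    refine h1.trans ?_
    simp only [Finset.sum_const, Finset.card_univ, Fintype.card_fin, nsmul_eq_mul]
    rw [← mul_assoc, ← sq, ← mul_pow]
    refine pow_le_pow_left₀ (by positivity) ?_ 2
    rw [← mul_assoc]
    refine mul_le_mul_of_nonneg_right ?_ hκ
    have : 0 < D / τ := by positivity
    nlinarith [mul_nonneg hr0 ha₂0.le]
  · refine (hLf k).trans ?_
    rw [add_mul]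
    have : κ * D / τ = D / τ * κ := by ring
    rw [this]
    have : 0 ≤ (r + 1) * (a₁ + a₂ + a₃) * κ := by positivity
    linarith

end Spectral

/-! ### Hilbert–Schmidt norms of kernels and Frobenius norms of matrices. -/

section Kernels

theorem eLpNorm_two_eq {α : Type*} [MeasurableSpace α] {μ : Measure α} {f : α → ℝ}
    (hf : MemLp f 2 μ) : eLpNorm f 2 μ = ENNReal.ofReal (√(∫ x, f x ^ 2 ∂μ)) := by
  rw [hf.eLpNorm_eq_integral_rpow_norm (by norm_num) (by norm_num), Real.sqrt_eq_rpow]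
  simp

theorem continuous_integrable {α : Type*} [TopologicalSpace α] [CompactSpace α]
    [MeasurableSpace α] [OpensMeasurableSpace α] {μ : Measure α} [IsFiniteMeasure μ]
    {f : α → ℝ} (hf : Continuous f) : Integrable f μ :=
  hf.integrable_of_hasCompactSupport (HasCompactSupport.of_compactSpace f)

theorem integral_mul_sum_sq {M : ℕ} {φ : Fin M → unitInterval → ℝ} (hφ : IsOrthonormalBasis φ)
    (d : Fin M → ℝ) : ∫ v, (∑ b, d b * φ b v) ^ 2 = ∑ b, d b ^ 2 := by
  have e : ∀ v, (∑ b, d b * φ b v) ^ 2 = ∑ b, ∑ b', d b * d b' * (φ b v * φ b' v) := fun v => by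
    rw [sq, Finset.sum_mul_sum]
    exact Finset.sum_congr rfl fun b _ => Finset.sum_congr rfl fun b' _ => by ring
  have hi : ∀ b b', Integrable (fun v => d b * d b' * (φ b v * φ b' v)) volume := fun b b' =>
    continuous_integrable (continuous_const.mul ((hφ.continuous b).mul (hφ.continuous b')))
  simp_rw [e]
  rw [integral_finsetSum _ fun b _ => integrable_finsetSum _ fun b' _ => hi b b']
  refine Finset.sum_congr rfl fun b _ => ?_
  rw [integral_finsetSum _ fun b' _ => hi b b']
  simp_rw [integral_const_mul, hφ.orthonormal]
  simp [sq]

/-- The kernel with coefficient matrix `C` in the basis `φ`. -/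
def coeffKernel {M : ℕ} (φ : Fin M → unitInterval → ℝ) (C : Matrix (Fin M) (Fin M) ℝ)
    (u v : unitInterval) : ℝ :=
  ∑ b, (∑ a, C a b * φ a u) * φ b v

theorem continuous_coeffKernel {M : ℕ} {φ : Fin M → unitInterval → ℝ} (hφ : IsOrthonormalBasis φ)
    (C : Matrix (Fin M) (Fin M) ℝ) :
    Continuous fun p : unitInterval × unitInterval => coeffKernel φ C p.1 p.2 := by
  refine continuous_finsetSum _ fun b _ => Continuous.mul (continuous_finsetSum _ fun a _ =>
    continuous_const.mul ((hφ.continuous a).comp continuous_fst))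
    ((hφ.continuous b).comp continuous_snd)

theorem modelKernel_eq_coeffKernel {M r : ℕ} (φ : Fin M → unitInterval → ℝ)
    (B : Matrix (Fin M) (Fin r) ℝ) (L : Fin r → ℝ) (u v : unitInterval) :
    modelKernel φ B L u v = coeffKernel φ (B * diagonal L * Bᵀ) u v := by
  have e : coeffKernel φ (B * diagonal L * Bᵀ) u v
      = (fun a => φ a u) ⬝ᵥ (B * diagonal L * Bᵀ) *ᵥ (fun b => φ b v) := by
    simp only [coeffKernel, dotProduct, mulVec, Finset.mul_sum, Finset.sum_mul]
    rw [Finset.sum_comm]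
    exact Finset.sum_congr rfl fun a _ => Finset.sum_congr rfl fun b _ => by ring
  rw [e, lowRank_form]
  rfl

/-- Parseval's identity twice, in the second variable for a fixed first one and then in the first.
-/
theorem eLpNorm_coeffKernel {M : ℕ} {φ : Fin M → unitInterval → ℝ} (hφ : IsOrthonormalBasis φ)
    (C : Matrix (Fin M) (Fin M) ℝ) :
    eLpNorm (fun p : unitInterval × unitInterval => coeffKernel φ C p.1 p.2) 2
      (volume.prod volume) = ENNReal.ofReal (frob C) := by
  have hc := continuous_coeffKernel hφ C
  have hm : MemLp (fun p : unitInterval × unitInterval => coeffKernel φ C p.1 p.2) 2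
      (volume.prod volume) :=
    (memLp_two_iff_integrable_sq hc.aestronglyMeasurable).2 (continuous_integrable (hc.pow 2))
  rw [eLpNorm_two_eq hm, frob, integral_prod _ hm.integrable_sq]
  simp only [coeffKernel]
  simp_rw [integral_mul_sum_sq hφ]
  have hi : ∀ b, Integrable (fun u => (∑ a, C a b * φ a u) ^ 2) volume := fun b =>
    continuous_integrable
      ((continuous_finsetSum _ fun a _ => continuous_const.mul (hφ.continuous a)).pow 2)
  rw [integral_finsetSum _ fun b _ => hi b]
  simp_rw [integral_mul_sum_sq hφ]
  rw [Finset.sum_comm]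

theorem hsDist_modelKernel {M r : ℕ} {φ : Fin M → unitInterval → ℝ} (hφ : IsOrthonormalBasis φ)
    (B B₀ : Matrix (Fin M) (Fin r) ℝ) (L L₀ : Fin r → ℝ) :
    hsDist (modelKernel φ B L) (modelKernel φ B₀ L₀)
      = ENNReal.ofReal (frob (B * diagonal L * Bᵀ - B₀ * diagonal L₀ * B₀ᵀ)) := by
  rw [← eLpNorm_coeffKernel hφ, hsDist]
  congr 1
  ext p
  rw [modelKernel_eq_coeffKernel, modelKernel_eq_coeffKernel]
  simp only [coeffKernel, ← Finset.sum_sub_distrib, ← sub_mul, Matrix.sub_apply]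

open scoped Matrix.Norms.Frobenius in
theorem frob_eq_norm {p q : ℕ} (A : Matrix (Fin p) (Fin q) ℝ) : frob A = ‖A‖ := by
  rw [frobenius_norm_def, frob, Real.sqrt_eq_rpow]
  simp

open scoped Matrix.Norms.Frobenius in
theorem frob_add_le {p q : ℕ} (A B : Matrix (Fin p) (Fin q) ℝ) :
    frob (A + B) ≤ frob A + frob B := by
  simp only [frob_eq_norm]; exact norm_add_le A B

open scoped Matrix.Norms.Frobenius in
theorem frob_mul_le {p q l : ℕ} (A : Matrix (Fin p) (Fin q) ℝ) (B : Matrix (Fin q) (Fin l) ℝ) :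
    frob (A * B) ≤ frob A * frob B := by
  simp only [frob_eq_norm]; exact frobenius_norm_mul A B

open scoped Matrix.Norms.Frobenius in
theorem frob_transpose {p q : ℕ} (A : Matrix (Fin p) (Fin q) ℝ) : frob Aᵀ = frob A := by
  simp only [frob_eq_norm]; exact frobenius_norm_transpose A

theorem frob_nonneg {p q : ℕ} (A : Matrix (Fin p) (Fin q) ℝ) : 0 ≤ frob A := Real.sqrt_nonneg _

theorem frob_sq {p q : ℕ} (A : Matrix (Fin p) (Fin q) ℝ) : frob A ^ 2 = ∑ i, ∑ j, A i j ^ 2 :=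
  Real.sq_sqrt (Finset.sum_nonneg fun _ _ => Finset.sum_nonneg fun _ _ => sq_nonneg _)

theorem frob_of_orthonormal {M r : ℕ} {B : Matrix (Fin M) (Fin r) ℝ} (hB : Bᵀ * B = 1) :
    frob B = √r := by
  rw [frob, Finset.sum_comm]
  congr 1
  have : ∀ j, ∑ i, B i j ^ 2 = 1 := fun j => by
    have := dotProduct_transpose_of_orthonormal hB j j
    rw [if_pos rfl, dotProduct] at this
    rw [← this]
    exact Finset.sum_congr rfl fun i _ => by rw [transpose_apply, sq]
  simp [this]

theorem frob_diagonal_le {r : ℕ} {v : Fin r → ℝ} {a : ℝ} (ha : 0 ≤ a) (hv : ∀ k, |v k| ≤ a) :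
    frob (diagonal v) ≤ r * a := by
  refine frob_le_of_sum_le (by positivity) ?_
  have h1 : ∀ i, ∑ j, diagonal v i j ^ 2 = v i ^ 2 := fun i => by
    rw [Finset.sum_eq_single i] <;> simp +contextual [eq_comm]
  simp only [h1]
  refine (Finset.sum_le_sum fun i _ => (sq_le_sq' (neg_le_of_abs_le (hv i))
    (le_of_abs_le (hv i)))).trans ?_
  rw [Finset.sum_const, Finset.card_univ, Fintype.card_fin, nsmul_eq_mul, mul_pow]
  refine mul_le_mul_of_nonneg_right ?_ (sq_nonneg a)
  have : (r : ℝ) ≤ (r : ℝ) * r := by exact_mod_cast Nat.le_mul_self r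
  rw [sq]; exact this

/-- Closeness of the parameters implies closeness of the covariance matrices. -/
theorem frob_lowRank_sub_le {M r : ℕ} {B B₀ : Matrix (Fin M) (Fin r) ℝ} {L L₀ : Fin r → ℝ}
    {a C : ℝ} (hB : Bᵀ * B = 1) (hB₀ : B₀ᵀ * B₀ = 1) (ha : 0 ≤ a) (ha1 : a ≤ 1)
    (hC : 0 ≤ C) (hL₀ : ∀ k, |L₀ k| ≤ C)
    (h1 : frob ((1 - B₀ * B₀ᵀ) * (B - B₀)) ≤ a) (h2 : frob (B₀ᵀ * (B - B₀)) ≤ a)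
    (h3 : ∀ k, |L k - L₀ k| ≤ a) :
    frob (B * diagonal L * Bᵀ - B₀ * diagonal L₀ * B₀ᵀ)
      ≤ (4 * (r + 1) ^ 3 * (C + 1)) * a := by
  have hr : (0 : ℝ) ≤ r := Nat.cast_nonneg r
  have hsr : √(r : ℝ) ≤ r + 1 := by
    rw [Real.sqrt_le_left (by positivity)]; nlinarith
  have hsr0 := Real.sqrt_nonneg (r : ℝ)
  have hL : ∀ k, |L k| ≤ C + 1 := fun k => by
    have : |L k| ≤ |L k - L₀ k| + |L₀ k| := by
      have := abs_add_le (L k - L₀ k) (L₀ k); rwa [sub_add_cancel] at this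
    linarith [h3 k, hL₀ k]
  have hd : frob (B - B₀) ≤ (r + 2) * a := by
    have e : B - B₀ = (1 - B₀ * B₀ᵀ) * (B - B₀) + B₀ * (B₀ᵀ * (B - B₀)) := by
      rw [Matrix.sub_mul, Matrix.one_mul, Matrix.mul_assoc]; abel
    have h4 := frob_mul_le B₀ (B₀ᵀ * (B - B₀))
    rw [frob_of_orthonormal hB₀] at h4
    have h5 : √(r : ℝ) * frob (B₀ᵀ * (B - B₀)) ≤ (r + 1) * a :=
      mul_le_mul hsr h2 (frob_nonneg _) (by positivity)
    calc frob (B - B₀) = frob ((1 - B₀ * B₀ᵀ) * (B - B₀) + B₀ * (B₀ᵀ * (B - B₀))) := by rw [← e]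
      _ ≤ _ := frob_add_le _ _
      _ ≤ (r + 2) * a := by linarith
  -- The three factors are exchanged one at a time.
  have e : B * diagonal L * Bᵀ - B₀ * diagonal L₀ * B₀ᵀ
      = (B - B₀) * diagonal L * Bᵀ + B₀ * diagonal (fun k => L k - L₀ k) * Bᵀ
        + B₀ * diagonal L₀ * (B - B₀)ᵀ := by
    rw [← diagonal_sub, transpose_sub]
    simp only [Matrix.sub_mul, Matrix.mul_sub]
    abel
  have t1 : frob ((B - B₀) * diagonal L * Bᵀ) ≤ ((r + 2) * a) * (r * (C + 1)) * (r + 1) := by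
    refine (frob_mul_le _ _).trans ?_
    rw [frob_transpose, frob_of_orthonormal hB]
    refine mul_le_mul ((frob_mul_le _ _).trans ?_) hsr hsr0 (by positivity)
    exact mul_le_mul hd (frob_diagonal_le (by positivity) hL) (frob_nonneg _) (by positivity)
  have t2 : frob (B₀ * diagonal (fun k => L k - L₀ k) * Bᵀ) ≤ (r + 1) * (r * a) * (r + 1) := by
    refine (frob_mul_le _ _).trans ?_
    rw [frob_transpose, frob_of_orthonormal hB]
    refine mul_le_mul ((frob_mul_le _ _).trans ?_) hsr hsr0 (by positivity)
    rw [frob_of_orthonormal hB₀]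
    exact mul_le_mul hsr (frob_diagonal_le ha h3) (frob_nonneg _) (by positivity)
  have t3 : frob (B₀ * diagonal L₀ * (B - B₀)ᵀ) ≤ (r + 1) * (r * C) * ((r + 2) * a) := by
    refine (frob_mul_le _ _).trans ?_
    rw [frob_transpose]
    refine mul_le_mul ((frob_mul_le _ _).trans ?_) hd (frob_nonneg _) (by positivity)
    rw [frob_of_orthonormal hB₀]
    exact mul_le_mul hsr (frob_diagonal_le hC hL₀) (frob_nonneg _) (by positivity)
  rw [e]
  refine (frob_add_le _ _).trans ((add_le_add_left (frob_add_le _ _) _).trans ?_)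
  refine (add_le_add (add_le_add t1 t2) t3).trans ?_
  have : ((r + 2) * a) * (r * (C + 1)) * (r + 1) + (r + 1) * (r * a) * (r + 1)
      + (r + 1) * (r * C) * ((r + 2) * a)
      = ((r + 1) * r * ((r + 2) * (C + 1) + (r + 1) + (r + 2) * C)) * a := by ring
  rw [this]
  refine mul_le_mul_of_nonneg_right ?_ ha
  have : (r : ℝ) * ((r + 2) * (C + 1) + (r + 1) + (r + 2) * C) ≤ 4 * (r + 1) ^ 2 * (C + 1) := by
    nlinarith [mul_nonneg hr hC, mul_nonneg (mul_nonneg hr hr) hC]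
  nlinarith

end Kernels

/-! ### Bounds and gaps for the eigenvalues of the optimal parameter. -/

section Eigenvalues

theorem integral_sum_mul_sum {M : ℕ} {φ : Fin M → unitInterval → ℝ} (hφ : IsOrthonormalBasis φ)
    (d d' : Fin M → ℝ) :
    ∫ v, (∑ b, φ b v * d b) * (∑ b, φ b v * d' b) = ∑ b, d b * d' b := by
  have e : ∀ v, (∑ b, φ b v * d b) * (∑ b, φ b v * d' b)
      = ∑ b, ∑ b', d b * d' b' * (φ b v * φ b' v) := fun v => by
    rw [Finset.sum_mul_sum]
    exact Finset.sum_congr rfl fun b _ => Finset.sum_congr rfl fun b' _ => by ring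
  have hi : ∀ b b', Integrable (fun v => d b * d' b' * (φ b v * φ b' v)) volume := fun b b' =>
    continuous_integrable (continuous_const.mul ((hφ.continuous b).mul (hφ.continuous b')))
  simp_rw [e]
  rw [integral_finsetSum _ fun b _ => integrable_finsetSum _ fun b' _ => hi b b']
  refine Finset.sum_congr rfl fun b _ => ?_
  rw [integral_finsetSum _ fun b' _ => hi b b']
  simp_rw [integral_const_mul, hφ.orthonormal]
  simp

/-- Cauchy–Schwarz inequality for the integral of a function against one of norm at most one. -/
theorem abs_integral_mul_le {α : Type*} [MeasurableSpace α] {μ : Measure α} {D h : α → ℝ} {ρ : ℝ}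
    (hD : AEStronglyMeasurable D μ) (hρ : 0 ≤ ρ) (hDρ : eLpNorm D 2 μ ≤ ENNReal.ofReal ρ)
    (hh : MemLp h 2 μ) (hh1 : ∫ x, h x ^ 2 ∂μ ≤ 1) : |∫ x, D x * h x ∂μ| ≤ ρ := by
  have hDm : MemLp D 2 μ := ⟨hD, hDρ.trans_lt ENNReal.ofReal_lt_top⟩
  rw [eLpNorm_two_eq hDm, ENNReal.ofReal_le_ofReal_iff hρ] at hDρ
  have hD2 : ∫ x, D x ^ 2 ∂μ ≤ ρ ^ 2 := (Real.sqrt_le_left hρ).1 hDρ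
  have hDh : Integrable (fun x => D x * h x) μ := hDm.integrable_mul hh
  set I := ∫ x, D x * h x ∂μ with hI
  -- Subtracting the multiple `I h` and using `∫ h² ≤ 1` leaves `I² ≤ ∫ D²`.
  have h0 : 0 ≤ ∫ x, (D x - I * h x) ^ 2 ∂μ := integral_nonneg fun x => sq_nonneg _
  have e : ∫ x, (D x - I * h x) ^ 2 ∂μ
      = ∫ x, D x ^ 2 ∂μ - 2 * I * I + I ^ 2 * ∫ x, h x ^ 2 ∂μ := by
    have : ∀ x, (D x - I * h x) ^ 2 = D x ^ 2 - 2 * I * (D x * h x) + I ^ 2 * h x ^ 2 :=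
      fun x => by ring
    simp_rw [this]
    have i1 : Integrable (fun x => 2 * I * (D x * h x)) μ := hDh.const_mul _
    have i2 : Integrable (fun x => I ^ 2 * h x ^ 2) μ := hh.integrable_sq.const_mul _
    have i3 : Integrable (fun x => D x ^ 2 - 2 * I * (D x * h x)) μ := hDm.integrable_sq.sub i1
    rw [integral_add i3 i2, integral_sub hDm.integrable_sq i1,
      integral_const_mul, integral_const_mul]
  have h2 : I ^ 2 * ∫ x, h x ^ 2 ∂μ ≤ I ^ 2 * 1 := mul_le_mul_of_nonneg_left hh1 (sq_nonneg _)
  refine abs_le_of_sq_le_sq ?_ hρ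
  nlinarith

variable {K : unitInterval → unitInterval → ℝ} {lam : ℕ → ℝ} {psi : ℕ → ℝ → ℝ}

/-- The kernel is the pointwise limit of the measurable partial sums of its spectral series. -/
theorem IsSpectralDecomposition.aestronglyMeasurable (hK : IsSpectralDecomposition K lam psi) :
    AEStronglyMeasurable (fun p : unitInterval × unitInterval => K p.1 p.2)
      (volume.prod volume) := by
  refine aestronglyMeasurable_of_tendsto_ae atTop
    (f := fun n (p : unitInterval × unitInterval) =>
      ∑ k ∈ Finset.range n, lam k * psi k p.1 * psi k p.2) (fun n => ?_)
    (ae_of_all _ fun p => (hK.hasSum p.1 p.2).tendsto_sum_nat)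
  refine Finset.aestronglyMeasurable_fun_sum _ fun k _ => ?_
  exact ((hK.memLp k).aestronglyMeasurable.comp_fst.const_mul (lam k)).mul
    ((hK.memLp k).aestronglyMeasurable.comp_snd (μ := volume))

/-- Termwise integration of the spectral series. It is legitimate because the integrals of `|psi l ·
psi k|` and `|psi l · f|` are bounded uniformly in `l` while the eigenvalues are summable;
orthonormality then leaves only the term `l = k`. -/
theorem IsSpectralDecomposition.integral_mul (hK : IsSpectralDecomposition K lam psi) (k : ℕ)
    {f : unitInterval → ℝ} (hf : MemLp f 2 volume) :
    Integrable (fun p : unitInterval × unitInterval => K p.1 p.2 * (psi k p.1 * f p.2))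
      (volume.prod volume) ∧
    ∫ p : unitInterval × unitInterval, K p.1 p.2 * (psi k p.1 * f p.2) ∂(volume.prod volume)
      = lam k * ∫ v : unitInterval, psi k v * f v := by
  set F : ℕ → unitInterval × unitInterval → ℝ := fun l p =>
    lam l * ((psi l p.1 * psi k p.1) * (psi l p.2 * f p.2)) with hF
  have i1 : ∀ l, Integrable (fun u : unitInterval => psi l u * psi k u) volume := fun l =>
    (hK.memLp l).integrable_mul (hK.memLp k)
  have i2 : ∀ l, Integrable (fun u : unitInterval => psi l u * f u) volume := fun l =>
    (hK.memLp l).integrable_mul hf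
  have hFi : ∀ l, Integrable (F l) (volume.prod volume) := fun l =>
    ((i1 l).mul_prod (i2 l)).const_mul (lam l)
  have hsq : ∀ l, ∫ u : unitInterval, psi l u ^ 2 = 1 := fun l => by
    have := hK.orthonormal l l
    simpa [sq] using this
  set a := ∫ u, f u ^ 2 with ha
  have b1 : ∀ l, ∫ u : unitInterval, ‖psi l u * psi k u‖ ≤ 1 := fun l => by
    have : ∀ u : unitInterval, ‖psi l u * psi k u‖ ≤ (psi l u ^ 2 + psi k u ^ 2) / 2 := fun u => by
      rw [Real.norm_eq_abs, abs_mul, ← sq_abs (psi l u), ← sq_abs (psi k u)]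
      nlinarith [sq_nonneg (|psi l u| - |psi k u|)]
    refine (integral_mono (i1 l).norm
      (((hK.memLp l).integrable_sq.add (hK.memLp k).integrable_sq).div_const 2) this).trans ?_
    rw [integral_div]
    simp only [Pi.add_apply]
    rw [integral_add (hK.memLp l).integrable_sq (hK.memLp k).integrable_sq, hsq, hsq]
    norm_num
  have b2 : ∀ l, ∫ u : unitInterval, ‖psi l u * f u‖ ≤ (1 + a) / 2 := fun l => by
    have : ∀ u : unitInterval, ‖psi l u * f u‖ ≤ (psi l u ^ 2 + f u ^ 2) / 2 := fun u => by
      rw [Real.norm_eq_abs, abs_mul, ← sq_abs (psi l u), ← sq_abs (f u)]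
      nlinarith [sq_nonneg (|psi l u| - |f u|)]
    refine (integral_mono (i2 l).norm
      (((hK.memLp l).integrable_sq.add hf.integrable_sq).div_const 2) this).trans ?_
    rw [integral_div]
    simp only [Pi.add_apply]
    rw [integral_add (hK.memLp l).integrable_sq hf.integrable_sq, hsq]
  have hnorm : ∀ l, ∫ p, ‖F l p‖ ∂(volume.prod volume)
      = lam l * ((∫ u : unitInterval, ‖psi l u * psi k u‖) * ∫ u : unitInterval, ‖psi l u * f u‖) :=
    fun l => by
      have : ∀ p, ‖F l p‖ = lam l * (‖psi l p.1 * psi k p.1‖ * ‖psi l p.2 * f p.2‖) := fun p => by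
        rw [hF]; simp only [norm_mul]; rw [Real.norm_of_nonneg (hK.nonneg l)]
      simp_rw [this]
      rw [integral_const_mul, integral_prod_mul (fun u : unitInterval => ‖psi l u * psi k u‖)
        (fun u : unitInterval => ‖psi l u * f u‖)]
  have hsum : Summable fun l => ∫ p, ‖F l p‖ ∂(volume.prod volume) := by
    refine Summable.of_nonneg_of_le (fun l => integral_nonneg fun _ => norm_nonneg _) (fun l => ?_)
      (hK.summable.mul_right ((1 + a) / 2))
    rw [hnorm]
    refine mul_le_mul_of_nonneg_left ?_ (hK.nonneg l)
    have := mul_le_mul (b1 l) (b2 l) (integral_nonneg fun _ => norm_nonneg _) zero_le_one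
    linarith
  have h1 := hasSum_integral_of_summable_integral_norm hFi hsum
  have hts : ∀ p, HasSum (fun l => F l p) (K p.1 p.2 * (psi k p.1 * f p.2)) := fun p => by
    have := (hK.hasSum p.1 p.2).mul_right (psi k p.1 * f p.2)
    have e : (fun l => F l p) = fun l => lam l * psi l p.1 * psi l p.2 * (psi k p.1 * f p.2) :=
      funext fun l => by simp only [hF]; ring
    rw [e]; exact this
  have htsum : (fun p => ∑' l, F l p) = fun p : unitInterval × unitInterval =>
      K p.1 p.2 * (psi k p.1 * f p.2) := funext fun p => (hts p).tsum_eq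
  constructor
  · have hm : AEStronglyMeasurable (fun p : unitInterval × unitInterval =>
        K p.1 p.2 * (psi k p.1 * f p.2)) (volume.prod volume) :=
      hK.aestronglyMeasurable.mul ((hK.memLp k).aestronglyMeasurable.comp_fst.mul
        hf.aestronglyMeasurable.comp_snd)
    refine ⟨hm, ?_⟩
    have hle : ∀ p : unitInterval × unitInterval, ‖K p.1 p.2 * (psi k p.1 * f p.2)‖ₑ
        ≤ ∑' l, ‖F l p‖ₑ := fun p => by
      rw [← (hts p).tsum_eq]; exact enorm_tsum_le_tsum_enorm
    rw [HasFiniteIntegral]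
    refine (lintegral_mono hle).trans_lt ?_
    rw [lintegral_tsum fun l => (hFi l).aestronglyMeasurable.enorm]
    have : ∀ l, ∫⁻ p, ‖F l p‖ₑ ∂(volume.prod volume)
        = ENNReal.ofReal (∫ p, ‖F l p‖ ∂(volume.prod volume)) := fun l => by
      rw [ofReal_integral_norm_eq_lintegral_enorm (hFi l)]
    simp_rw [this]
    rw [← ENNReal.ofReal_tsum_of_nonneg (fun l => integral_nonneg fun _ => norm_nonneg _) hsum]
    exact ENNReal.ofReal_lt_top
  · rw [htsum] at h1
    have h2 : HasSum (fun l => ∫ p, F l p ∂(volume.prod volume))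
        (lam k * ∫ v : unitInterval, psi k v * f v) := by
      have e : ∀ l, ∫ p, F l p ∂(volume.prod volume)
          = if l = k then lam k * ∫ v : unitInterval, psi k v * f v else 0 := fun l => by
        rw [hF]
        simp only
        rw [integral_const_mul, integral_prod_mul (fun u : unitInterval => psi l u * psi k u)
          (fun u : unitInterval => psi l u * f u), hK.orthonormal]
        split_ifs with h
        · rw [h, one_mul]
        · simp
      simp_rw [e]
      exact hasSum_ite_eq k _
    exact h1.unique h2

/-- If the kernel `K` satisfies A1 and is close to a kernel of rank `r`, then the eigenvalues of
the latter are bounded and separated. -/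
theorem eigenvalue_separation {r M : ℕ} {c₁ c₂ ρ : ℝ} (hr : 1 ≤ r) (hA1 : CondA1 r c₁ c₂ lam)
    (hK : IsSpectralDecomposition K lam psi)
    {φ : Fin M → unitInterval → ℝ} (hφ : IsOrthonormalBasis φ) {B : Matrix (Fin M) (Fin r) ℝ}
    {L : Fin r → ℝ} (hB : Bᵀ * B = 1) (hL : ∀ k, 0 < L k) (hρ : 0 ≤ ρ)
    (hρ1 : ρ ≤ 1 / (16 * (r + 1) * c₂)) (hρ2 : ρ ≤ 1 / (2 * (r + 1)))
    (hd : hsDist K (modelKernel φ B L) ≤ ENNReal.ofReal ρ) :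
    0 < c₂ ∧ (∀ k, 1 / (2 * c₂) ≤ L k) ∧ (∀ k, L k ≤ c₁ + 1) ∧
      ∀ j k, j ≠ k → 1 / (2 * c₂) ≤ |L j - L k| := by
  have hgap : ∀ j < r, 1 / c₂ ≤ lam j - lam (j + 1) ∧ 0 < c₂ := fun j hj => by
    obtain ⟨h1, h2⟩ := hA1.2 j hj
    have h3 : 0 < lam j - lam (j + 1) := sub_pos.2 h1
    have hc : 0 < c₂ := (inv_pos.2 h3).trans_le h2
    refine ⟨?_, hc⟩
    rw [one_div]
    exact inv_le_of_inv_le₀ h3 h2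
  have hc₂ : 0 < c₂ := (hgap 0 hr).2
  refine ⟨hc₂, ?_⟩
  have hlam : ∀ k : Fin r, 1 / c₂ ≤ lam k := fun k => by
    have := (hgap k k.2).1
    linarith [hK.nonneg (k + 1)]
  have hsep : ∀ k k' : Fin r, k ≠ k' → 1 / c₂ ≤ |lam k - lam k'| := by
    have key : ∀ k k' : Fin r, k < k' → 1 / c₂ ≤ lam k - lam k' := fun k k' hkk => by
      have h1 := (hgap k k.2).1
      have h2 := hK.antitone (show (k : ℕ) + 1 ≤ k' from hkk)
      linarith
    intro k k' hne
    rcases lt_or_gt_of_ne hne with h | h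
    · exact (key k k' h).trans (le_abs_self _)
    · rw [abs_sub_comm]; exact (key k' k h).trans (le_abs_self _)
  set g : Fin r → unitInterval → ℝ := fun j v => ∑ l, φ l v * B l j with hg
  have hgc : ∀ j, Continuous (g j) := fun j =>
    continuous_finsetSum _ fun l _ => (hφ.continuous l).mul continuous_const
  have hgm : ∀ j, MemLp (g j) 2 volume := fun j =>
    (memLp_two_iff_integrable_sq (hgc j).aestronglyMeasurable).2
      (continuous_integrable ((hgc j).pow 2))
  have hgo : ∀ j k, ∫ v, g j v * g k v = if j = k then 1 else 0 := fun j k => by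
    rw [integral_sum_mul_sum hφ (fun l => B l j) (fun l => B l k)]
    exact dotProduct_transpose_of_orthonormal hB j k
  set t : Fin r → Fin r → ℝ := fun k j => ∫ v : unitInterval, psi k v * g j v with ht
  have hpsisq : ∀ k, ∫ u : unitInterval, psi k u ^ 2 = 1 := fun l => by
    have := hK.orthonormal l l
    simpa [sq] using this
  have hgsq : ∀ k, ∫ u : unitInterval, g k u ^ 2 = 1 := fun l => by
    have := hgo l l
    simpa [sq] using this
  have ht1 : ∀ k j, |t k j| ≤ 1 := fun k j => by
    refine abs_integral_mul_le (hK.memLp k).aestronglyMeasurable zero_le_one ?_ (hgm j)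
      (hgsq j).le
    rw [eLpNorm_two_eq (hK.memLp k), hpsisq, Real.sqrt_one]
  -- testing the difference of the kernels
  have hmodel : ∀ (k : Fin r) {f : unitInterval → ℝ}, MemLp f 2 volume →
      Integrable (fun p : unitInterval × unitInterval =>
        modelKernel φ B L p.1 p.2 * (psi k p.1 * f p.2)) (volume.prod volume) ∧
      ∫ p : unitInterval × unitInterval, modelKernel φ B L p.1 p.2 * (psi k p.1 * f p.2)
        ∂(volume.prod volume) = ∑ j, L j * t k j * ∫ v, g j v * f v := fun k f hf => by
    have e : ∀ p : unitInterval × unitInterval, modelKernel φ B L p.1 p.2 * (psi k p.1 * f p.2)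
        = ∑ j, L j * ((psi k p.1 * g j p.1) * (g j p.2 * f p.2)) := fun p => by
      rw [modelKernel, Finset.sum_mul]
      exact Finset.sum_congr rfl fun j _ => by rw [hg]; ring
    simp_rw [e]
    have i : ∀ j, Integrable (fun p : unitInterval × unitInterval =>
        L j * ((psi k p.1 * g j p.1) * (g j p.2 * f p.2))) (volume.prod volume) := fun j => by
      have i1 : Integrable (fun u : unitInterval => psi k u * g j u) volume :=
        (hK.memLp k).integrable_mul (hgm j)
      have i2 : Integrable (fun u : unitInterval => g j u * f u) volume :=
        (hgm j).integrable_mul hf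
      exact (i1.mul_prod i2).const_mul (L j)
    refine ⟨integrable_finsetSum _ fun j _ => i j, ?_⟩
    rw [integral_finsetSum _ fun j _ => i j]
    refine Finset.sum_congr rfl fun j _ => ?_
    rw [integral_const_mul, integral_prod_mul (fun u : unitInterval => psi k u * g j u)
      (fun u : unitInterval => g j u * f u), mul_assoc]
  have hDm : AEStronglyMeasurable (fun p : unitInterval × unitInterval =>
      K p.1 p.2 - modelKernel φ B L p.1 p.2) (volume.prod volume) := by
    refine hK.aestronglyMeasurable.sub (Continuous.aestronglyMeasurable ?_)
    simp_rw [modelKernel_eq_coeffKernel]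
    exact continuous_coeffKernel hφ _
  have htest : ∀ (k : Fin r) {f : unitInterval → ℝ}, MemLp f 2 volume → ∫ v, f v ^ 2 ≤ 1 →
      |lam k * (∫ v : unitInterval, psi k v * f v) - ∑ j, L j * t k j * ∫ v, g j v * f v| ≤ ρ :=
    fun k f hf hf1 => by
      have hm : MemLp (fun p : unitInterval × unitInterval => psi k p.1 * f p.2) 2
          (volume.prod volume) := by
        refine (memLp_two_iff_integrable_sq ((hK.memLp k).aestronglyMeasurable.comp_fst.mul
          hf.aestronglyMeasurable.comp_snd)).2 ?_
        have := (hK.memLp k).integrable_sq.mul_prod hf.integrable_sq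
        refine this.congr (ae_of_all _ fun p => ?_)
        simp only [Pi.mul_apply, mul_pow]
      have h1 : ∫ p : unitInterval × unitInterval, (psi k p.1 * f p.2) ^ 2
          ∂(volume.prod volume) ≤ 1 := by
        simp_rw [mul_pow]
        rw [integral_prod_mul (fun u : unitInterval => psi k u ^ 2) (fun u => f u ^ 2), hpsisq,
          one_mul]
        exact hf1
      have h2 := abs_integral_mul_le hDm hρ hd hm h1
      simp_rw [sub_mul] at h2
      have e := integral_sub (hK.integral_mul k hf).1 (hmodel k hf).1
      rw [(hK.integral_mul k hf).2, (hmodel k hf).2] at e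
      rw [← e]
      exact h2
  -- Testing against `psi k ⊗ g j`: eigenvalues are close or eigenfunctions nearly orthogonal.
  have hta : ∀ k j : Fin r, |lam k - L j| * |t k j| ≤ ρ := fun k j => by
    have := htest k (hgm j) (hgsq j).le
    simp only [hgo, mul_ite, mul_one, mul_zero, Finset.sum_ite_eq', Finset.mem_univ, if_true]
      at this
    rw [← abs_mul, sub_mul]
    exact this
  have htb : ∀ k : Fin r, |lam k - ∑ j, L j * t k j ^ 2| ≤ ρ := fun k => by
    have := htest k (hK.memLp k) (hpsisq k).le
    have e : ∀ j, ∫ v : unitInterval, g j v * psi k v = t k j := fun j => by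
      rw [ht]; simp_rw [mul_comm (g j _)]
    simp only [e, ← sq, hpsisq, mul_one, mul_assoc] at this
    exact this
  have hr1 : (0 : ℝ) < r + 1 := by positivity
  -- If `psi k` were nearly orthogonal to every `g j`, then `L j t² ≤ L j |t| ≤ lam k |t| + ρ` would
  -- make the sum in `htb` at most about `lam k / 2`, which contradicts `lam k ≥ 1 / c₂`. No a
  -- priori upper bound on `L` is needed.
  have hex : ∀ k : Fin r, ∃ j, 1 / (2 * (r + 1)) ≤ |t k j| := fun k => by
    by_contra hcon
    push Not at hcon
    have h1 : ∑ j, L j * t k j ^ 2 ≤ ∑ _j : Fin r, (lam k * (1 / (2 * (r + 1))) + ρ) := by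
      refine Finset.sum_le_sum fun j _ => ?_
      have h2 := hta k j
      have h3 : L j * |t k j| ≤ lam k * |t k j| + ρ := by
        have h4 : (L j - lam k) * |t k j| ≤ |lam k - L j| * |t k j| :=
          mul_le_mul_of_nonneg_right (by rw [abs_sub_comm]; exact le_abs_self _) (abs_nonneg _)
        linarith
      have h5 : lam k * |t k j| ≤ lam k * (1 / (2 * (r + 1))) :=
        mul_le_mul_of_nonneg_left (hcon j).le (hK.nonneg k)
      have h6 : L j * t k j ^ 2 ≤ L j * |t k j| := by
        refine mul_le_mul_of_nonneg_left ?_ (hL j).le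
        rw [← sq_abs, sq]; nlinarith [ht1 k j, abs_nonneg (t k j)]
      linarith
    rw [Finset.sum_const, Finset.card_univ, Fintype.card_fin, nsmul_eq_mul] at h1
    have h2 := (abs_le.1 (htb k)).2
    have h3 : (r + 1) * ρ ≤ 1 / (16 * c₂) := by
      have := mul_le_mul_of_nonneg_left hρ1 hr1.le
      have e : (r + 1) * (1 / (16 * (r + 1) * c₂)) = 1 / (16 * c₂) := by field_simp
      rwa [e] at this
    have h4 : (r : ℝ) * (lam k * (1 / (2 * (r + 1)))) ≤ lam k / 2 := by
      have : (r : ℝ) * (lam k * (1 / (2 * (r + 1)))) = lam k / 2 * (r / (r + 1)) := by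
        field_simp
      rw [this]
      refine mul_le_of_le_one_right (by linarith [hK.nonneg k]) ?_
      rw [div_le_one hr1]; linarith
    have h5 := hlam k
    have h6 : 1 / (16 * c₂) = 1 / c₂ / 16 := by field_simp
    have h7 : 0 < 1 / c₂ := by positivity
    linarith
  choose f hf using hex
  set e := 2 * (r + 1) * ρ with he
  have hLf : ∀ k : Fin r, |lam k - L (f k)| ≤ e := fun k => by
    have h1 := (mul_le_mul_of_nonneg_left (hf k) (abs_nonneg _)).trans (hta k (f k))
    rw [mul_one_div, div_le_iff₀ (by positivity)] at h1
    rw [he]; linarith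
  have he1 : e ≤ 1 / c₂ / 8 := by
    rw [he]
    have := mul_le_mul_of_nonneg_left hρ1 (show 0 ≤ 2 * ((r : ℝ) + 1) by positivity)
    have e : 2 * (r + 1) * (1 / (16 * (r + 1) * c₂)) = 1 / c₂ / 8 := by field_simp; norm_num
    rwa [e] at this
  have he2 : e ≤ 1 := by
    rw [he]
    rw [le_div_iff₀ (by positivity)] at hρ2
    linarith
  have h7 : 0 < 1 / c₂ := by positivity
  have h8 : 1 / (2 * c₂) = 1 / c₂ / 2 := by field_simp
  have hfinj : Function.Injective f := fun k k' hkk => by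
    by_contra hne
    have h1 := hLf k
    have h2 := hLf k'
    rw [← hkk] at h2
    have h3 := hsep k k' hne
    have h4 := abs_sub_le (lam k) (L (f k)) (lam k')
    rw [abs_sub_comm (L (f k))] at h4
    linarith
  have hsurj : Function.Surjective f := Finite.injective_iff_surjective.1 hfinj
  refine ⟨fun j => ?_, fun j => ?_, fun i j hij => ?_⟩
  · obtain ⟨k, rfl⟩ := hsurj j
    have := (abs_le.1 (hLf k)).2
    linarith [hlam k]
  · obtain ⟨k, rfl⟩ := hsurj j
    have h1 := (abs_le.1 (hLf k)).1
    have h2 := hK.antitone (Nat.zero_le k)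
    linarith [hA1.1]
  · obtain ⟨k, rfl⟩ := hsurj i
    obtain ⟨k', rfl⟩ := hsurj j
    have h3 := hsep k k' (fun h => hij (by rw [h]))
    have h1 := hLf k
    have h2 := hLf k'
    have h4 := abs_sub_le (lam k) (L (f k)) (lam k')
    have h5 := abs_sub_le (L (f k)) (L (f k')) (lam k')
    rw [abs_sub_comm (L (f k')) (lam k')] at h5
    linarith

end Eigenvalues

/-! ### A Bernstein inequality for squares of Gaussian variables. -/

section ChiSquare

theorem integrable_exp_sq_gaussianReal {u : ℝ} (hu : u ≤ 1 / 4) :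
    Integrable (fun z => Real.exp (u * (z ^ 2 - 1))) (gaussianReal 0 1) := by
  rw [gaussianReal_of_var_ne_zero _ one_ne_zero,
    integrable_withDensity_iff_integrable_smul' (measurable_gaussianPDF _ _)
      (ae_of_all _ fun _ => gaussianPDF_lt_top)]
  have h1 : Integrable (fun z : ℝ => Real.exp (-(1 / 2 - u) * z ^ 2)) :=
    integrable_exp_neg_mul_sq (by linarith)
  refine (h1.const_mul ((Real.sqrt (2 * Real.pi))⁻¹ * Real.exp (-u))).congr (ae_of_all _ fun z => ?_)
  simp only [gaussianPDF, gaussianPDFReal, smul_eq_mul]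
  rw [ENNReal.toReal_ofReal (by positivity)]
  simp only [NNReal.coe_one, mul_one, sub_zero]
  rw [mul_assoc, mul_assoc, ← Real.exp_add, ← Real.exp_add]
  congr 2
  ring

theorem integral_exp_sq_gaussianReal_le {u : ℝ} (hu : |u| ≤ 1 / 4) :
    ∫ z, Real.exp (u * (z ^ 2 - 1)) ∂gaussianReal 0 1 ≤ Real.exp (4 * u ^ 2) := by
  obtain ⟨hu1, hu2⟩ := abs_le.1 hu
  have hpos : 0 < 1 - 2 * u := by linarith
  have e : ∀ z : ℝ, gaussianPDFReal 0 1 z • Real.exp (u * (z ^ 2 - 1))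
      = (Real.sqrt (2 * Real.pi))⁻¹ * Real.exp (-u) * Real.exp (-(1 / 2 - u) * z ^ 2) := fun z => by
    simp only [gaussianPDFReal, smul_eq_mul, NNReal.coe_one, mul_one, sub_zero]
    rw [mul_assoc, mul_assoc, ← Real.exp_add, ← Real.exp_add]
    congr 2
    ring
  rw [integral_gaussianReal_eq_integral_smul one_ne_zero]
  simp_rw [e]
  rw [integral_const_mul, integral_gaussian]
  have h1 : Real.sqrt (Real.pi / (1 / 2 - u)) = Real.sqrt (2 * Real.pi) * Real.sqrt (1 - 2 * u)⁻¹ := by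
    rw [← Real.sqrt_mul (by positivity)]
    congr 1
    have : (1 / 2 - u) ≠ 0 := by linarith
    field_simp
  have h2 : (0 : ℝ) < Real.sqrt (2 * Real.pi) := Real.sqrt_pos.2 (by positivity)
  rw [h1]
  have h3 : (Real.sqrt (2 * Real.pi))⁻¹ * Real.exp (-u)
      * (Real.sqrt (2 * Real.pi) * Real.sqrt (1 - 2 * u)⁻¹)
      = Real.exp (-u) * Real.sqrt (1 - 2 * u)⁻¹ := by field_simp
  rw [h3]
  -- The remainder of the logarithm is `|2u|² / (1 - |2u|)`, at most `8 u²` because `|2u| ≤ 1/2`.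
  have h4 : -(2 * u) - 8 * u ^ 2 ≤ Real.log (1 - 2 * u) := by
    have h5 := Real.abs_log_sub_add_sum_range_le (x := 2 * u)
      (by rw [abs_mul, abs_two]; linarith) 1
    simp only [Finset.range_one, Finset.sum_singleton, zero_add, pow_one, Nat.cast_zero, div_one]
      at h5
    have h6 : |2 * u| ^ (1 + 1) / (1 - |2 * u|) ≤ 8 * u ^ 2 := by
      have e : (2 * |u|) ^ (1 + 1) = 4 * u ^ 2 := by rw [← sq_abs u]; ring
      rw [abs_mul, abs_two, e, div_le_iff₀ (by linarith)]
      nlinarith [mul_nonneg (sq_nonneg u) (sub_nonneg.2 hu)]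
    have := (abs_le.1 h5).1
    linarith
  have h5 : Real.sqrt (1 - 2 * u)⁻¹ ≤ Real.exp (u + 4 * u ^ 2) := by
    rw [Real.sqrt_le_left (Real.exp_pos _).le, ← Real.exp_nat_mul]
    calc (1 - 2 * u)⁻¹ = Real.exp (-Real.log (1 - 2 * u)) := by
          rw [Real.exp_neg, Real.exp_log hpos]
      _ ≤ _ := by
          refine Real.exp_le_exp.2 ?_
          push_cast
          linarith
  calc Real.exp (-u) * Real.sqrt (1 - 2 * u)⁻¹ ≤ Real.exp (-u) * Real.exp (u + 4 * u ^ 2) :=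
        mul_le_mul_of_nonneg_left h5 (Real.exp_pos _).le
    _ = _ := by rw [← Real.exp_add]; congr 1; ring

variable {Ω : Type*} [MeasurableSpace Ω] {P : Measure Ω} {q : Ω → ℝ} {v : NNReal}

theorem gaussianReal_eq_map_std (v : NNReal) :
    gaussianReal 0 v = (gaussianReal 0 1).map (fun z => Real.sqrt v * z) := by
  rw [gaussianReal_map_const_mul, mul_zero]
  congr 1
  ext
  simp

/-- The moment generating function of the centred square of a centred Gaussian variable. -/
theorem mgf_sq_sub_var_le (hq : Measurable q) (hlaw : P.map q = gaussianReal 0 v) {θ : ℝ}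
    (hθ : |θ| * v ≤ 1 / 4) :
    Integrable (fun ω => Real.exp (θ * (q ω ^ 2 - v))) P ∧
      mgf (fun ω => q ω ^ 2 - v) P θ ≤ Real.exp (4 * θ ^ 2 * v ^ 2) := by
  have hu : |θ * v| ≤ 1 / 4 := by rwa [abs_mul, NNReal.abs_eq]
  have hm : Measurable fun y : ℝ => Real.exp (θ * (y ^ 2 - v)) := by fun_prop
  have e : ∀ z : ℝ, Real.exp (θ * ((Real.sqrt v * z) ^ 2 - v)) = Real.exp (θ * v * (z ^ 2 - 1)) :=
    fun z => by
      congr 1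
      rw [mul_pow, Real.sq_sqrt v.coe_nonneg]
      ring
  have hms : Measurable fun z : ℝ => Real.sqrt v * z := by fun_prop
  constructor
  · have h1 : Integrable (fun y : ℝ => Real.exp (θ * (y ^ 2 - v))) (P.map q) := by
      rw [hlaw, gaussianReal_eq_map_std, integrable_map_measure hm.aestronglyMeasurable
        hms.aemeasurable]
      simp only [Function.comp_def, e]
      exact integrable_exp_sq_gaussianReal (le_of_abs_le hu)
    exact h1.comp_measurable hq
  · have h1 : mgf (fun ω => q ω ^ 2 - v) P θ = ∫ y, Real.exp (θ * (y ^ 2 - v)) ∂(P.map q) := by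
      rw [integral_map hq.aemeasurable hm.aestronglyMeasurable]
      rfl
    rw [h1, hlaw, gaussianReal_eq_map_std, integral_map hms.aemeasurable hm.aestronglyMeasurable]
    simp_rw [e]
    refine (integral_exp_sq_gaussianReal_le hu).trans (le_of_eq ?_)
    congr 1
    ring

/-- A Bernstein type inequality for sums of squares of independent centred Gaussian variables. -/
theorem measure_sum_sq_sub_var_le {n : ℕ} [IsProbabilityMeasure P] {q : Fin n → Ω → ℝ}
    {v : Fin n → NNReal} (hq : ∀ i, Measurable (q i)) (hlaw : ∀ i, P.map (q i) = gaussianReal 0 (v i))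
    (hind : iIndepFun q P) {V x : ℝ} (hV : 0 < V) (hv : ∀ i, v i ≤ V) (hx : 0 ≤ x)
    (hxV : x ≤ 2 * V) :
    P.real {ω | n * x ≤ |∑ i, (q i ω ^ 2 - v i)|} ≤ 2 * Real.exp (-(n * x ^ 2 / (16 * V ^ 2))) := by
  set Z : Fin n → Ω → ℝ := fun i ω => q i ω ^ 2 - v i with hZ
  have hZm : ∀ i, Measurable (Z i) := fun i => ((hq i).pow_const 2).sub_const _
  have hZi : iIndepFun Z P :=
    hind.comp (fun i y => y ^ 2 - (v i : ℝ)) fun i => (measurable_id.pow_const 2).sub_const _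
  -- The value `x / (8 V²)` minimizes `-θ x + 4 θ² V²`; the assumption `x ≤ 2 V` is what keeps `|θ|
  -- v i ≤ 1/4`. Both signs of `θ` are needed for the two tails.
  have key : ∀ θ : ℝ, |θ| = x / (8 * V ^ 2) →
      Integrable (fun ω => Real.exp (θ * (∑ i, Z i) ω)) P ∧
      mgf (∑ i, Z i) P θ ≤ Real.exp (n * x ^ 2 / (16 * V ^ 2)) := fun θ hθ => by
    have h1 : ∀ i, |θ| * v i ≤ 1 / 4 := fun i => by
      rw [hθ]
      calc x / (8 * V ^ 2) * v i ≤ 2 * V / (8 * V ^ 2) * V := by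
            gcongr
            exact hv i
        _ = 1 / 4 := by field_simp; norm_num
    have h2 : ∀ i, mgf (Z i) P θ ≤ Real.exp (x ^ 2 / (16 * V ^ 2)) := fun i => by
      refine (mgf_sq_sub_var_le (hq i) (hlaw i) (h1 i)).2.trans (Real.exp_le_exp.2 ?_)
      rw [← sq_abs θ, hθ]
      have : (v i : ℝ) ^ 2 ≤ V ^ 2 := pow_le_pow_left₀ (v i).2 (hv i) 2
      calc 4 * (x / (8 * V ^ 2)) ^ 2 * (v i : ℝ) ^ 2 ≤ 4 * (x / (8 * V ^ 2)) ^ 2 * V ^ 2 := by gcongr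
        _ = x ^ 2 / (16 * V ^ 2) := by field_simp; ring
    refine ⟨hZi.integrable_exp_mul_sum hZm fun i _ =>
      (mgf_sq_sub_var_le (hq i) (hlaw i) (h1 i)).1, ?_⟩
    rw [hZi.mgf_sum hZm]
    calc ∏ i, mgf (Z i) P θ ≤ ∏ _i : Fin n, Real.exp (x ^ 2 / (16 * V ^ 2)) :=
          Finset.prod_le_prod (fun i _ => mgf_nonneg) fun i _ => h2 i
      _ = _ := by
          rw [Finset.prod_const, Finset.card_univ, Fintype.card_fin, ← Real.exp_nat_mul]
          congr 1; ring
  set θ := x / (8 * V ^ 2) with hθ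
  have hθ0 : 0 ≤ θ := by positivity
  have eθ : θ * (n * x) = 2 * (n * x ^ 2 / (16 * V ^ 2)) := by rw [hθ]; field_simp; ring
  obtain ⟨i1, m1⟩ := key θ (abs_of_nonneg hθ0)
  obtain ⟨i2, m2⟩ := key (-θ) (by rw [abs_neg]; exact abs_of_nonneg hθ0)
  have c1 := measure_ge_le_exp_mul_mgf (n * x) hθ0 i1
  have c2 := measure_le_le_exp_mul_mgf (-(n * x)) (neg_nonpos.2 hθ0) i2
  have b1 : Real.exp (-θ * (n * x)) * Real.exp (n * x ^ 2 / (16 * V ^ 2))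
      = Real.exp (-(n * x ^ 2 / (16 * V ^ 2))) := by
    rw [← Real.exp_add]; congr 1; linarith
  have hsub : {ω | n * x ≤ |∑ i, (q i ω ^ 2 - v i)|}
      ⊆ {ω | n * x ≤ (∑ i, Z i) ω} ∪ {ω | (∑ i, Z i) ω ≤ -(n * x)} := fun ω hω => by
    simp only [Set.mem_union, Set.mem_ofPred_eq, Finset.sum_apply, hZ] at hω ⊢
    rcases le_abs.1 hω with h | h
    · exact Or.inl h
    · exact Or.inr (by linarith)
  refine (measureReal_mono hsub).trans ((measureReal_union_le _ _).trans ?_)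
  have d1 := c1.trans (mul_le_mul_of_nonneg_left m1 (Real.exp_pos _).le)
  have d2 := c2.trans (mul_le_mul_of_nonneg_left m2 (Real.exp_pos _).le)
  rw [neg_neg, mul_neg, ← neg_mul θ, b1] at d2
  rw [b1] at d1
  linarith

end ChiSquare

/-! ### Laws of linear combinations of the observations. -/

section SampleVariance

variable {𝒳 : Type*} [MeasurableSpace 𝒳] {ν : Measure 𝒳} [IsProbabilityMeasure ν]
  {X : unitInterval → 𝒳 → ℝ} {K : unitInterval → unitInterval → ℝ}

theorem IsCenteredGaussian.linearCombination_law (hX : IsCenteredGaussian ν X K) {m : ℕ}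
    (t : Fin m → unitInterval) (a : Fin m → ℝ) :
    HasGaussianLaw (fun x => ∑ j, a j * X (t j) x) ν ∧
    ∫ x, ∑ j, a j * X (t j) x ∂ν = 0 ∧
    Var[fun x => ∑ j, a j * X (t j) x; ν] = ∑ j, ∑ j', a j * a j' * K (t j) (t j') := by
  have hl : HasGaussianLaw (fun x => ∑ j, a j * X (t j) x) ν := by
    have := ((hX.gaussian.comp_right t).smul a).hasGaussianLaw_fun_sum (I := Finset.univ)
    simpa using this
  have hL2 : ∀ u, MemLp (X u) 2 ν := fun u => (hX.gaussian.hasGaussianLaw_eval u).memLp_two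
  have h0 : ∫ x, ∑ j, a j * X (t j) x ∂ν = 0 := by
    rw [integral_finsetSum _ fun j _ => (hX.gaussian.hasGaussianLaw_eval _).integrable.const_mul _]
    simp_rw [integral_const_mul, hX.mean_zero, mul_zero, Finset.sum_const_zero]
  refine ⟨hl, h0, ?_⟩
  rw [variance_of_integral_eq_zero hl.aemeasurable h0]
  have e : ∀ x, (∑ j, a j * X (t j) x) ^ 2
      = ∑ j, ∑ j', a j * a j' * (X (t j) x * X (t j') x) := fun x => by
    rw [sq, Finset.sum_mul_sum]
    exact Finset.sum_congr rfl fun b _ => Finset.sum_congr rfl fun b' _ => by ring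
  have hi : ∀ j j', Integrable (fun x => a j * a j' * (X (t j) x * X (t j') x)) ν := fun j j' =>
    ((hL2 (t j)).integrable_mul (hL2 (t j'))).const_mul _
  simp_rw [e]
  rw [integral_finsetSum _ fun b _ => integrable_finsetSum _ fun b' _ => hi b b']
  refine Finset.sum_congr rfl fun b _ => ?_
  rw [integral_finsetSum _ fun b' _ => hi b b']
  simp_rw [integral_const_mul, hX.covariance]

theorem noise_linearCombination_law {m : ℕ} (a : Fin m → ℝ) :
    HasGaussianLaw (fun e : Fin m → ℝ => ∑ j, a j * e j) (Measure.pi fun _ => gaussianReal 0 1) ∧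
    ∫ e : Fin m → ℝ, ∑ j, a j * e j ∂(Measure.pi fun _ => gaussianReal 0 1) = 0 ∧
    Var[fun e : Fin m → ℝ => ∑ j, a j * e j; Measure.pi fun _ => gaussianReal 0 1]
      = ∑ j, a j ^ 2 := by
  set γ : Measure (Fin m → ℝ) := Measure.pi fun _ => gaussianReal 0 1 with hγ
  have hmp : ∀ j, MeasurePreserving (Function.eval j) γ (gaussianReal 0 1) := fun j =>
    measurePreserving_eval _ j
  have hg1 : ∀ j, HasGaussianLaw (fun e : Fin m → ℝ => e j) γ := fun j =>
    ⟨by rw [show (fun e : Fin m → ℝ => e j) = Function.eval j from rfl, (hmp j).map_eq]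
        infer_instance⟩
  have hg : ∀ j, HasGaussianLaw (fun e : Fin m → ℝ => a j * e j) γ := fun j =>
    (hg1 j).fun_smul (a j)
  have hind : iIndepFun (fun j (e : Fin m → ℝ) => a j * e j) γ :=
    iIndepFun_pi (X := fun j y => a j * y) fun j => (measurable_const_mul (a j)).aemeasurable
  refine ⟨hind.hasGaussianLaw_fun_sum hg, ?_, ?_⟩
  · rw [integral_finsetSum _ fun j _ => (hg j).integrable]
    refine Finset.sum_eq_zero fun j _ => ?_
    rw [integral_const_mul]
    have : ∫ e : Fin m → ℝ, e j ∂γ = ∫ y, y ∂gaussianReal 0 1 := by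
      rw [← (hmp j).map_eq, integral_map (f := fun y : ℝ => y) (hmp j).measurable.aemeasurable
        measurable_id.aestronglyMeasurable]
    rw [this, integral_id_gaussianReal, mul_zero]
  · have h1 := variance_sum_pi (μ := fun _ : Fin m => gaussianReal 0 1) (X := fun j y => a j * y)
      fun j => (memLp_id_gaussianReal' 2 (by norm_num)).const_mul (a j)
    have h2 : (∑ j, fun e : Fin m → ℝ => a j * e j) = fun e : Fin m → ℝ => ∑ j, a j * e j := by
      ext e; simp
    rw [h2] at h1
    rw [h1]
    refine Finset.sum_congr rfl fun j _ => ?_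
    rw [variance_const_mul, variance_fun_id_gaussianReal]
    simp

/-- The law of a linear combination of the observations of one curve. -/
theorem IsCenteredGaussian.map_obs_linearCombination (hX : IsCenteredGaussian ν X K) {m : ℕ} (σ : ℝ)
    (t : Fin m → unitInterval) (a : Fin m → ℝ) :
    0 ≤ a ⬝ᵥ trueCov σ K t *ᵥ a ∧
    (ν.prod (Measure.pi fun _ : Fin m => gaussianReal 0 1)).map
      (fun p => ∑ j, a j * (X (t j) p.1 + σ * p.2 j))
      = gaussianReal 0 (a ⬝ᵥ trueCov σ K t *ᵥ a).toNNReal := by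
  set γ : Measure (Fin m → ℝ) := Measure.pi fun _ => gaussianReal 0 1 with hγ
  obtain ⟨l1, m1, v1⟩ := hX.linearCombination_law t a
  obtain ⟨l2, m2, v2⟩ := noise_linearCombination_law fun j => a j * σ
  have mU : Measurable fun x => ∑ j, a j * X (t j) x :=
    Finset.measurable_sum _ fun j _ =>
      (hX.measurable.comp (measurable_const.prodMk measurable_id)).const_mul _
  have mV : Measurable fun e : Fin m → ℝ => ∑ j, a j * σ * e j :=
    Finset.measurable_sum _ fun j _ => (measurable_pi_apply j).const_mul _
  set U : 𝒳 × (Fin m → ℝ) → ℝ := fun p => ∑ j, a j * X (t j) p.1 with hU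
  set W : 𝒳 × (Fin m → ℝ) → ℝ := fun p => ∑ j, a j * σ * p.2 j with hW
  have mpf : MeasurePreserving (Prod.fst : 𝒳 × (Fin m → ℝ) → 𝒳) (ν.prod γ) ν :=
    measurePreserving_fst
  have mps : MeasurePreserving (Prod.snd : 𝒳 × (Fin m → ℝ) → _) (ν.prod γ) γ :=
    measurePreserving_snd
  have eU : (ν.prod γ).map U = ν.map fun x => ∑ j, a j * X (t j) x := by
    conv_rhs => rw [← mpf.map_eq]
    rw [Measure.map_map mU mpf.measurable]; rfl
  have eW : (ν.prod γ).map W = γ.map fun e : Fin m → ℝ => ∑ j, a j * σ * e j := by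
    conv_rhs => rw [← mps.map_eq]
    rw [Measure.map_map mV mps.measurable]; rfl
  have gU : HasGaussianLaw U (ν.prod γ) := ⟨by rw [eU]; exact l1.isGaussian_map⟩
  have gW : HasGaussianLaw W (ν.prod γ) := ⟨by rw [eW]; exact l2.isGaussian_map⟩
  have hind : IndepFun U W (ν.prod γ) :=
    indepFun_prod (X := fun x => ∑ j, a j * X (t j) x)
      (Y := fun e : Fin m → ℝ => ∑ j, a j * σ * e j) mU mV
  have hsum := (hind.hasGaussianLaw gU gW).add
  have iU : ∫ p, U p ∂(ν.prod γ) = 0 := by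
    have := integral_map (μ := ν.prod γ) (f := fun x => ∑ j, a j * X (t j) x) mpf.measurable.aemeasurable
      mU.aestronglyMeasurable
    rw [mpf.map_eq, m1] at this
    exact this.symm
  have iW : ∫ p, W p ∂(ν.prod γ) = 0 := by
    have := integral_map (μ := ν.prod γ) (f := fun e : Fin m → ℝ => ∑ j, a j * σ * e j)
      mps.measurable.aemeasurable mV.aestronglyMeasurable
    rw [mps.map_eq, m2] at this
    exact this.symm
  have vU : Var[U; ν.prod γ] = ∑ j, ∑ j', a j * a j' * K (t j) (t j') := by
    rw [← v1, ← variance_id_map mU.aemeasurable, ← eU,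
      variance_id_map (X := U) (mU.comp mpf.measurable).aemeasurable]
  have vW : Var[W; ν.prod γ] = ∑ j, (a j * σ) ^ 2 := by
    rw [← v2, ← variance_id_map mV.aemeasurable, ← eW,
      variance_id_map (X := W) (mV.comp mps.measurable).aemeasurable]
  have hvar : Var[U + W; ν.prod γ] = a ⬝ᵥ trueCov σ K t *ᵥ a := by
    rw [hind.variance_add gU.memLp_two gW.memLp_two, vU, vW, trueCov, add_mulVec, dotProduct_add,
      smul_mulVec, one_mulVec, dotProduct_smul]
    congr 1
    · simp only [dotProduct, mulVec, of_apply, Finset.mul_sum]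
      exact Finset.sum_congr rfl fun j _ => Finset.sum_congr rfl fun j' _ => by ring
    · simp only [dotProduct, smul_eq_mul, Finset.mul_sum]
      exact Finset.sum_congr rfl fun j _ => by ring
  have hmean : ∫ p, (U + W) p ∂(ν.prod γ) = 0 := by
    simp only [Pi.add_apply]
    rw [integral_add gU.integrable gW.integrable, iU, iW, add_zero]
  have hq : (fun p : 𝒳 × (Fin m → ℝ) => ∑ j, a j * (X (t j) p.1 + σ * p.2 j)) = U + W := by
    ext p
    simp only [hU, hW, Pi.add_apply, ← Finset.sum_add_distrib]
    exact Finset.sum_congr rfl fun j _ => by ring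
  refine ⟨hvar ▸ variance_nonneg _ _, ?_⟩
  rw [hq, hsum.map_eq_gaussianReal, hmean, hvar]

/-- Concentration of the sum of squares of linear combinations of the observations, for a fixed
design. -/
theorem IsCenteredGaussian.measure_sum_sq_le (hX : IsCenteredGaussian ν X K) {n m : ℕ} (σ : ℝ)
    (T : Fin n → Fin m → unitInterval) (a : Fin n → Fin m → ℝ) {V x : ℝ} (hV : 0 < V)
    (hv : ∀ i, a i ⬝ᵥ trueCov σ K (T i) *ᵥ a i ≤ V) (hx : 0 ≤ x) (hxV : x ≤ 2 * V) :
    ((Measure.pi fun _ : Fin n => ν).prod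
      (Measure.pi fun _ : Fin n => Measure.pi fun _ : Fin m => gaussianReal 0 1)).real
      {p | n * x ≤ |∑ i, ((∑ j, a i j * (X (T i j) (p.1 i) + σ * p.2 i j)) ^ 2
        - a i ⬝ᵥ trueCov σ K (T i) *ᵥ a i)|} ≤ 2 * Real.exp (-(n * x ^ 2 / (16 * V ^ 2))) := by
  set γ : Measure (Fin m → ℝ) := Measure.pi fun _ => gaussianReal 0 1 with hγ
  -- Curves and noise are regrouped into one independent pair per index, so that the linear forms
  -- are functions of distinct coordinates.
  have mp := measurePreserving_arrowProdEquivProdArrow 𝒳 (Fin m → ℝ) (Fin n) (fun _ => ν)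
    (fun _ => γ)
  set Q : Fin n → 𝒳 × (Fin m → ℝ) → ℝ := fun i p => ∑ j, a i j * (X (T i j) p.1 + σ * p.2 j)
    with hQ
  have hQm : ∀ i, Measurable (Q i) := fun i => by
    refine Finset.measurable_sum _ fun j _ => Measurable.const_mul (Measurable.add ?_ ?_) _
    · exact hX.measurable.comp (measurable_const.prodMk measurable_fst)
    · have h : Measurable fun p : 𝒳 × (Fin m → ℝ) => p.2 j :=
        (measurable_pi_apply j).comp measurable_snd
      exact h.const_mul σ
  have hind : iIndepFun (fun i (ω : Fin n → 𝒳 × (Fin m → ℝ)) => Q i (ω i))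
      (Measure.pi fun _ : Fin n => ν.prod γ) := iIndepFun_pi fun i => (hQm i).aemeasurable
  have hlaw : ∀ i, (Measure.pi fun _ : Fin n => ν.prod γ).map
      (fun ω : Fin n → 𝒳 × (Fin m → ℝ) => Q i (ω i))
      = gaussianReal 0 (a i ⬝ᵥ trueCov σ K (T i) *ᵥ a i).toNNReal := fun i => by
    rw [← (hX.map_obs_linearCombination σ (T i) (a i)).2]
    conv_rhs => rw [← (measurePreserving_eval (fun _ : Fin n => ν.prod γ) i).map_eq]
    rw [Measure.map_map (hQm i) (measurable_pi_apply i)]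
    rfl
  have h := measure_sum_sq_sub_var_le (fun i => (hQm i).comp (measurable_pi_apply i)) hlaw hind hV
    (fun i => by
      rw [Real.coe_toNNReal _ (hX.map_obs_linearCombination σ (T i) (a i)).1]
      exact hv i) hx hxV
  rw [← mp.map_eq, measureReal_def, MeasurableEquiv.map_apply, ← measureReal_def]
  simp only [Real.coe_toNNReal _ (hX.map_obs_linearCombination σ (T _) (a _)).1] at h
  exact h

end SampleVariance

/-! ### Matrices close to the identity and reduction of the likelihood to coefficient space. -/

section Design

theorem abs_form_le_opNorm {p : ℕ} (A : Matrix (Fin p) (Fin p) ℝ) (x : Fin p → ℝ) :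
    |x ⬝ᵥ A *ᵥ x| ≤ opNorm A * (x ⬝ᵥ x) := by
  set y : EuclideanSpace ℝ (Fin p) := WithLp.toLp 2 x with hy
  have h1 : x ⬝ᵥ A *ᵥ x = inner ℝ y (Matrix.toEuclideanCLM (n := Fin p) (𝕜 := ℝ) A y) := by
    rw [hy, Matrix.toEuclideanCLM_toLp, EuclideanSpace.inner_toLp_toLp, star_trivial,
      dotProduct_comm]
  have h2 : x ⬝ᵥ x = ‖y‖ ^ 2 := by
    rw [hy, ← real_inner_self_eq_norm_sq, EuclideanSpace.inner_toLp_toLp, star_trivial]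
  rw [h1, h2]
  calc |inner ℝ y (Matrix.toEuclideanCLM (n := Fin p) (𝕜 := ℝ) A y)|
      ≤ ‖y‖ * ‖Matrix.toEuclideanCLM (n := Fin p) (𝕜 := ℝ) A y‖ := abs_real_inner_le_norm _ _
    _ ≤ ‖y‖ * (‖Matrix.toEuclideanCLM (n := Fin p) (𝕜 := ℝ) A‖ * ‖y‖) := by
        gcongr
        exact ContinuousLinearMap.le_opNorm _ _
    _ = opNorm A * ‖y‖ ^ 2 := by rw [opNorm]; ring

theorem abs_form_le_frob {p : ℕ} (A : Matrix (Fin p) (Fin p) ℝ) (x : Fin p → ℝ) :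
    |x ⬝ᵥ A *ᵥ x| ≤ frob A * (x ⬝ᵥ x) := by
  have h1 : (x ⬝ᵥ A *ᵥ x) ^ 2 ≤ (frob A * (x ⬝ᵥ x)) ^ 2 := by
    have h2 : (x ⬝ᵥ A *ᵥ x) ^ 2 ≤ (x ⬝ᵥ x) * (A *ᵥ x ⬝ᵥ A *ᵥ x) := by
      have := Finset.sum_mul_sq_le_sq_mul_sq Finset.univ x (A *ᵥ x)
      simpa [dotProduct, sq] using this
    have h3 : A *ᵥ x ⬝ᵥ A *ᵥ x ≤ frob A ^ 2 * (x ⬝ᵥ x) := by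
      rw [frob_sq, Finset.sum_mul]
      refine Finset.sum_le_sum fun i _ => ?_
      have := Finset.sum_mul_sq_le_sq_mul_sq Finset.univ (A i) x
      simpa [dotProduct, mulVec, sq] using this
    calc (x ⬝ᵥ A *ᵥ x) ^ 2 ≤ (x ⬝ᵥ x) * (A *ᵥ x ⬝ᵥ A *ᵥ x) := h2
      _ ≤ (x ⬝ᵥ x) * (frob A ^ 2 * (x ⬝ᵥ x)) :=
          mul_le_mul_of_nonneg_left h3 (dotProduct_self_nonneg_real x)
      _ = _ := by ring
  exact abs_le_of_sq_le_sq h1 (mul_nonneg (frob_nonneg A) (dotProduct_self_nonneg_real x))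

theorem congruence_form {p q : Type*} [Fintype p] [Fintype q] (P : Matrix p q ℝ) (A : Matrix p p ℝ)
    (x y : q → ℝ) : x ⬝ᵥ (Pᵀ * A * P) *ᵥ y = (P *ᵥ x) ⬝ᵥ A *ᵥ (P *ᵥ y) := by
  rw [← mulVec_mulVec, ← mulVec_mulVec, dotProduct_mulVec, ← mulVec_transpose, transpose_transpose]

variable {ι : Type*} [Fintype ι] [DecidableEq ι]

theorem posDef_smul_one {c : ℝ} (hc : 0 < c) : (c • (1 : Matrix ι ι ℝ)).PosDef :=
  PosDef.one.smul hc

/-- A symmetric matrix close to the identity has an inverse close to the identity. -/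
theorem inv_sub_one_form_le {R : Matrix ι ι ℝ} (hR : Rᵀ = R) {ρ : ℝ} (hρ0 : 0 ≤ ρ) (hρ : ρ ≤ 1 / 2)
    (h : ∀ x, |x ⬝ᵥ (R - 1) *ᵥ x| ≤ ρ * (x ⬝ᵥ x)) :
    R.PosDef ∧ ∀ x, |x ⬝ᵥ (R⁻¹ - 1) *ᵥ x| ≤ 2 * ρ * (x ⬝ᵥ x) := by
  have e : ∀ (A : Matrix ι ι ℝ) x, x ⬝ᵥ (A - 1) *ᵥ x = x ⬝ᵥ A *ᵥ x - x ⬝ᵥ x := fun A x => by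
    rw [sub_mulVec, one_mulVec, dotProduct_sub]
  have ec : ∀ (c : ℝ) (x : ι → ℝ), x ⬝ᵥ (c • (1 : Matrix ι ι ℝ)) *ᵥ x = c * (x ⬝ᵥ x) := fun c x => by
    rw [smul_mulVec, one_mulVec, dotProduct_smul, smul_eq_mul]
  have hlo : ∀ x, (1 - ρ) * (x ⬝ᵥ x) ≤ x ⬝ᵥ R *ᵥ x := fun x => by
    have := (abs_le.1 (h x)).1
    rw [e] at this; linarith
  have hup : ∀ x, x ⬝ᵥ R *ᵥ x ≤ (1 + ρ) * (x ⬝ᵥ x) := fun x => by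
    have := (abs_le.1 (h x)).2
    rw [e] at this; linarith
  have hpd : R.PosDef := posDef_of_forall hR fun x hx => by
    have h1 : 0 < x ⬝ᵥ x := by
      have := dotProduct_self_eq_zero.not.2 hx
      exact lt_of_le_of_ne (dotProduct_self_nonneg_real x) (Ne.symm this)
    exact lt_of_lt_of_le (mul_pos (by linarith) h1) (hlo x)
  refine ⟨hpd, fun x => ?_⟩
  have hinv : ∀ c : ℝ, 0 < c → (c • (1 : Matrix ι ι ℝ))⁻¹ = c⁻¹ • 1 := fun c hc =>
    inv_eq_of_mul (by rw [smul_mul_smul_comm, mul_one, mul_inv_cancel₀ hc.ne', one_smul])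
  have h1 := PosDef.inv_form_antitone (posDef_smul_one (show 0 < 1 - ρ by linarith)) hpd
    (fun x => by rw [ec]; exact hlo x) x
  have h2 := PosDef.inv_form_antitone hpd (posDef_smul_one (show 0 < 1 + ρ by linarith))
    (fun x => by rw [ec]; exact hup x) x
  rw [hinv _ (by linarith), ec] at h1 h2
  have h3 : (1 - ρ)⁻¹ ≤ 1 + 2 * ρ := by
    rw [inv_le_iff_one_le_mul₀ (by linarith)]; nlinarith
  have h4 : 1 - 2 * ρ ≤ (1 + ρ)⁻¹ := by
    rw [inv_eq_one_div, le_div_iff₀ (by linarith)]; nlinarith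
  have h5 := mul_le_mul_of_nonneg_right h3 (dotProduct_self_nonneg_real x)
  have h6 := mul_le_mul_of_nonneg_right h4 (dotProduct_self_nonneg_real x)
  rw [e, abs_le]
  constructor <;> linarith

variable {M m r : ℕ} {σ : ℝ} {φ : Fin M → unitInterval → ℝ} {t : Fin m → unitInterval}
  {B : Matrix (Fin M) (Fin r) ℝ} {L : Fin r → ℝ}

theorem designGram_transpose : (designGram φ t)ᵀ = designGram φ t := by
  rw [designGram, transpose_smul, transpose_mul, transpose_transpose]

theorem designMatrix_mul_transpose (hm : 0 < m) :
    designMatrix φ t * (designMatrix φ t)ᵀ = (m : ℝ) • designGram φ t := by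
  rw [designGram, smul_smul, mul_one_div_cancel (by positivity), one_smul]

theorem transCov_eq (hm : 0 < m) : transCov σ φ t B L
    = (m : ℝ) • (designGram φ t * (B * diagonal L * Bᵀ) * designGram φ t)
      + σ ^ 2 • designGram φ t := by
  have hm' : (m : ℝ) ≠ 0 := by positivity
  have e : designMatrix φ t * modelCov σ φ t B L * (designMatrix φ t)ᵀ
      = (designMatrix φ t * (designMatrix φ t)ᵀ) * (B * diagonal L * Bᵀ)
        * (designMatrix φ t * (designMatrix φ t)ᵀ)
        + σ ^ 2 • (designMatrix φ t * (designMatrix φ t)ᵀ) := by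
    rw [modelCov, Matrix.mul_add, Matrix.add_mul, Matrix.mul_smul, Matrix.smul_mul, Matrix.mul_one]
    simp only [Matrix.mul_assoc]
  rw [transCov, e, designMatrix_mul_transpose hm, smul_add]
  simp only [Matrix.smul_mul, Matrix.mul_smul, smul_smul]
  congr 2
  · field_simp
  · field_simp

/-- The reduced covariance `B Λ Bᵀ + (σ²/m) R⁻¹` of one curve. -/
noncomputable def reducedCov (σ : ℝ) (φ : Fin M → unitInterval → ℝ) (t : Fin m → unitInterval)
    (B : Matrix (Fin M) (Fin r) ℝ) (L : Fin r → ℝ) : Matrix (Fin M) (Fin M) ℝ :=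
  B * diagonal L * Bᵀ + (σ ^ 2 / m) • (1 : Matrix (Fin M) (Fin M) ℝ)
    + (σ ^ 2 / m) • ((designGram φ t)⁻¹ - 1)

/-- The reduced data of one curve. -/
noncomputable def reducedData (φ : Fin M → unitInterval → ℝ) (t : Fin m → unitInterval) (y : Fin m → ℝ) :
    Fin M → ℝ :=
  (1 / (m : ℝ)) • (designGram φ t)⁻¹ *ᵥ (designMatrix φ t *ᵥ y)

theorem reducedCov_eq : reducedCov σ φ t B L
    = B * diagonal L * Bᵀ + (σ ^ 2 / m) • (designGram φ t)⁻¹ := by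
  rw [reducedCov, add_assoc, ← smul_add, add_sub_cancel]

theorem lowRank_form_nonneg (hL : ∀ k, 0 ≤ L k) (x : Fin M → ℝ) :
    0 ≤ x ⬝ᵥ (B * diagonal L * Bᵀ) *ᵥ x := by
  have := congruence_form Bᵀ (diagonal L) x x
  rw [transpose_transpose] at this
  rw [this, diagonal_form]
  exact Finset.sum_nonneg fun k _ => mul_nonneg (hL k) (sq_nonneg _)

theorem posDef_reducedCov (hm : 0 < m) (hσ : 0 < σ) (hL : ∀ k, 0 ≤ L k)
    (hR : (designGram φ t).PosDef) : (reducedCov σ φ t B L).PosDef := by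
  rw [reducedCov_eq]
  refine PosDef.posSemidef_add (posSemidef_of_forall (transpose_lowRank B L)
    (lowRank_form_nonneg hL)) (hR.inv.smul ?_)
  positivity

theorem transCov_eq_reducedCov (hm : 0 < m) (hR : (designGram φ t).PosDef) :
    transCov σ φ t B L
      = (m : ℝ) • (designGram φ t * reducedCov σ φ t B L * designGram φ t) := by
  have hm' : (m : ℝ) ≠ 0 := by positivity
  rw [transCov_eq hm, reducedCov_eq, Matrix.mul_add, Matrix.add_mul, smul_add, Matrix.mul_smul,
    PosDef.mul_inv hR, Matrix.smul_mul, Matrix.one_mul, smul_smul]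
  congr 2
  field_simp

theorem inv_transCov (hm : 0 < m) (hσ : 0 < σ) (hL : ∀ k, 0 ≤ L k) (hR : (designGram φ t).PosDef) :
    (transCov σ φ t B L)⁻¹ = (1 / (m : ℝ)) •
      ((designGram φ t)⁻¹ * (reducedCov σ φ t B L)⁻¹ * (designGram φ t)⁻¹) := by
  have hm' : (m : ℝ) ≠ 0 := by positivity
  refine inv_eq_of_mul ?_
  rw [transCov_eq_reducedCov hm hR, smul_mul_smul_comm, mul_one_div_cancel hm', one_smul]
  have h1 := PosDef.mul_inv hR
  have h2 := PosDef.mul_inv (posDef_reducedCov (B := B) hm hσ hL hR)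
  calc designGram φ t * reducedCov σ φ t B L * designGram φ t
        * ((designGram φ t)⁻¹ * (reducedCov σ φ t B L)⁻¹ * (designGram φ t)⁻¹)
      = designGram φ t * (reducedCov σ φ t B L * (designGram φ t * (designGram φ t)⁻¹)
        * (reducedCov σ φ t B L)⁻¹) * (designGram φ t)⁻¹ := by simp only [Matrix.mul_assoc]
    _ = 1 := by rw [h1, Matrix.mul_one, h2, Matrix.mul_one, h1]

theorem inv_reducedCov (hm : 0 < m) (hσ : 0 < σ) (hL : ∀ k, 0 ≤ L k)
    (hR : (designGram φ t).PosDef) :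
    (reducedCov σ φ t B L)⁻¹
      = (m : ℝ) • (designGram φ t * (transCov σ φ t B L)⁻¹ * designGram φ t) := by
  have hm' : (m : ℝ) ≠ 0 := by positivity
  rw [inv_transCov hm hσ hL hR, Matrix.mul_smul, Matrix.smul_mul, smul_smul,
    mul_one_div_cancel hm', one_smul]
  have h1 := PosDef.mul_inv hR
  have h2 := PosDef.inv_mul hR
  calc (reducedCov σ φ t B L)⁻¹
      = (designGram φ t * (designGram φ t)⁻¹) * (reducedCov σ φ t B L)⁻¹
        * ((designGram φ t)⁻¹ * designGram φ t) := by
        rw [h1, h2, Matrix.one_mul, Matrix.mul_one]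
    _ = _ := by simp only [Matrix.mul_assoc]

theorem posDef_transCov (hm : 0 < m) (hσ : 0 < σ) (hL : ∀ k, 0 ≤ L k)
    (hR : (designGram φ t).PosDef) : (transCov σ φ t B L).PosDef := by
  have h1 : (reducedCov σ φ t B L).PosDef := posDef_reducedCov hm hσ hL hR
  have h2 : (designGram φ t * reducedCov σ φ t B L * designGram φ t).PosDef := by
    have h3 := h1.conjTranspose_mul_mul_same (B := designGram φ t)
      (mulVec_injective_of_isUnit hR.isUnit)
    rwa [conjTranspose_eq_transpose_of_trivial, designGram_transpose] at h3
  rw [transCov_eq_reducedCov hm hR]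
  exact h2.smul (by positivity)

theorem log_det_transCov (hm : 0 < m) (hσ : 0 < σ) (hL : ∀ k, 0 ≤ L k)
    (hR : (designGram φ t).PosDef) : Real.log (transCov σ φ t B L).det
      = Real.log ((m : ℝ) ^ M * (designGram φ t).det ^ 2)
        + Real.log (reducedCov σ φ t B L).det := by
  have h1 := hR.det_pos
  have h2 := (posDef_reducedCov (B := B) hm hσ hL hR).det_pos
  rw [← Real.log_mul (by positivity) h2.ne', transCov_eq_reducedCov hm hR, det_smul, det_mul,
    det_mul, Fintype.card_fin]
  congr 1
  ring

theorem trace_inv_transCov (hm : 0 < m) (hσ : 0 < σ) (hL : ∀ k, 0 ≤ L k)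
    (hR : (designGram φ t).PosDef) (y : Fin m → ℝ) :
    trace ((transCov σ φ t B L)⁻¹ * ((1 / (m : ℝ)) •
      vecMulVec (designMatrix φ t *ᵥ y) (designMatrix φ t *ᵥ y)))
      = reducedData φ t y ⬝ᵥ (reducedCov σ φ t B L)⁻¹ *ᵥ reducedData φ t y := by
  have hs : ((designGram φ t)⁻¹)ᵀ = (designGram φ t)⁻¹ := PosDef.transpose_eq hR.inv
  rw [inv_transCov hm hσ hL hR, reducedData]
  set w := designMatrix φ t *ᵥ y with hw
  rw [Matrix.mul_smul, trace_smul, Matrix.mul_vecMulVec, trace_vecMulVec, smul_mulVec, smul_dotProduct,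
    mulVec_smul, dotProduct_smul, smul_dotProduct]
  congr 2
  rw [← mulVec_mulVec, ← mulVec_mulVec, dotProduct_comm, dotProduct_mulVec_symm hs,
    dotProduct_comm]

/-- The coefficients `b` such that `b ⬝ᵥ y` is the linear form `x ⬝ᵥ X⁻¹ z` in the reduced data `z`,
with `X` the reduced covariance. -/
noncomputable def dataCoeff (σ : ℝ) (φ : Fin M → unitInterval → ℝ) (t : Fin m → unitInterval)
    (B : Matrix (Fin M) (Fin r) ℝ) (L : Fin r → ℝ) (x : Fin M → ℝ) : Fin m → ℝ :=
  (designMatrix φ t)ᵀ *ᵥ ((transCov σ φ t B L)⁻¹ *ᵥ (designGram φ t *ᵥ x))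

theorem transCov_inv_transpose (hm : 0 < m) (hσ : 0 < σ) (hL : ∀ k, 0 ≤ L k)
    (hR : (designGram φ t).PosDef) : ((transCov σ φ t B L)⁻¹)ᵀ = (transCov σ φ t B L)⁻¹ :=
  PosDef.transpose_eq (posDef_transCov hm hσ hL hR).inv

theorem dataCoeff_dotProduct (hm : 0 < m) (hσ : 0 < σ) (hL : ∀ k, 0 ≤ L k)
    (hR : (designGram φ t).PosDef) (x : Fin M → ℝ) (y : Fin m → ℝ) :
    dataCoeff σ φ t B L x ⬝ᵥ y
      = x ⬝ᵥ (reducedCov σ φ t B L)⁻¹ *ᵥ reducedData φ t y := by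
  have hm' : (m : ℝ) ≠ 0 := by positivity
  have e : ∀ w, (designGram φ t * (transCov σ φ t B L)⁻¹ * designGram φ t) *ᵥ
      ((designGram φ t)⁻¹ *ᵥ w) = designGram φ t *ᵥ ((transCov σ φ t B L)⁻¹ *ᵥ w) := fun w => by
    rw [mulVec_mulVec, Matrix.mul_assoc, PosDef.mul_inv hR, Matrix.mul_one, ← mulVec_mulVec]
  rw [inv_reducedCov hm hσ hL hR, reducedData, dataCoeff, smul_mulVec, mulVec_smul,
    smul_smul, mul_one_div_cancel hm', one_smul, e, mulVec_transpose, ← dotProduct_mulVec,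
    dotProduct_mulVec_symm designGram_transpose x, dotProduct_comm,
    dotProduct_mulVec_symm (transCov_inv_transpose hm hσ hL hR), dotProduct_comm]

/-- Multiplying the model covariance by `Φ` on both sides gives `m Γ`, which cancels one of the two
inverses `Γ⁻¹` in the coefficients. Thus, under the model, the noise form is exactly centred. -/
theorem dataCoeff_modelCov (hm : 0 < m) (hσ : 0 < σ) (hL : ∀ k, 0 ≤ L k)
    (hR : (designGram φ t).PosDef) (x : Fin M → ℝ) :
    dataCoeff σ φ t B L x ⬝ᵥ modelCov σ φ t B L *ᵥ dataCoeff σ φ t B L x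
      = x ⬝ᵥ (reducedCov σ φ t B L)⁻¹ *ᵥ x := by
  have hm' : (m : ℝ) ≠ 0 := by positivity
  set v := (transCov σ φ t B L)⁻¹ *ᵥ (designGram φ t *ᵥ x) with hv
  have e : designMatrix φ t * modelCov σ φ t B L * (designMatrix φ t)ᵀ
      = (m : ℝ) • transCov σ φ t B L := by
    rw [transCov, smul_smul, mul_one_div_cancel hm', one_smul]
  have h1 : dataCoeff σ φ t B L x ⬝ᵥ modelCov σ φ t B L *ᵥ dataCoeff σ φ t B L x
      = v ⬝ᵥ (designMatrix φ t * modelCov σ φ t B L * (designMatrix φ t)ᵀ) *ᵥ v := by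
    rw [dataCoeff, ← hv, mulVec_transpose, ← dotProduct_mulVec, ← mulVec_transpose, mulVec_mulVec,
      mulVec_mulVec, Matrix.mul_assoc]
  have h2 : transCov σ φ t B L *ᵥ v = designGram φ t *ᵥ x := by
    rw [hv, mulVec_mulVec, PosDef.mul_inv (posDef_transCov hm hσ hL hR), one_mulVec]
  rw [h1, e, smul_mulVec, h2, inv_reducedCov hm hσ hL hR, smul_mulVec, dotProduct_smul,
    dotProduct_smul, ← mulVec_mulVec, ← mulVec_mulVec, dotProduct_mulVec_symm designGram_transpose x,
    dotProduct_comm v]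

/-- The model covariance is at least `σ²`. An error of the covariance of size `δ σ²`, as in C',
therefore becomes a relative error `δ` of the variance. -/
theorem dataCoeff_sq_le (hm : 0 < m) (hσ : 0 < σ) (hL : ∀ k, 0 ≤ L k)
    (hR : (designGram φ t).PosDef) (x : Fin M → ℝ) :
    σ ^ 2 * (dataCoeff σ φ t B L x ⬝ᵥ dataCoeff σ φ t B L x)
      ≤ x ⬝ᵥ (reducedCov σ φ t B L)⁻¹ *ᵥ x := by
  rw [← dataCoeff_modelCov hm hσ hL hR]
  set a := dataCoeff σ φ t B L x
  rw [modelCov, add_mulVec, dotProduct_add, smul_mulVec, one_mulVec, dotProduct_smul, smul_eq_mul]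
  have h1 : a ⬝ᵥ ((designMatrix φ t)ᵀ * B * diagonal L * Bᵀ * designMatrix φ t) *ᵥ a
      = (designMatrix φ t *ᵥ a) ⬝ᵥ (B * diagonal L * Bᵀ) *ᵥ (designMatrix φ t *ᵥ a) := by
    rw [← congruence_form]
    simp only [Matrix.mul_assoc]
  rw [h1]
  have := lowRank_form_nonneg (B := B) hL (designMatrix φ t *ᵥ a)
  linarith

/-- The variance of the linear form in the data under the true law is close to the one under the
model. -/
theorem abs_trueVar_sub_le (hm : 0 < m) (hσ : 0 < σ) (hL : ∀ k, 0 ≤ L k)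
    (hR : (designGram φ t).PosDef) {K : unitInterval → unitInterval → ℝ} {δ : ℝ}
    (hK : frob (trueCov σ K t - modelCov σ φ t B L) ≤ δ * σ ^ 2) (x : Fin M → ℝ) :
    |dataCoeff σ φ t B L x ⬝ᵥ trueCov σ K t *ᵥ dataCoeff σ φ t B L x
      - x ⬝ᵥ (reducedCov σ φ t B L)⁻¹ *ᵥ x| ≤ δ * (x ⬝ᵥ (reducedCov σ φ t B L)⁻¹ *ᵥ x) := by
  have hδ : 0 ≤ δ := by
    have := (frob_nonneg _).trans hK
    exact nonneg_of_mul_nonneg_left this (by positivity)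
  have h0 := dataCoeff_sq_le (B := B) hm hσ hL hR x
  rw [← dataCoeff_modelCov hm hσ hL hR] at h0 ⊢
  set a := dataCoeff σ φ t B L x
  rw [← dotProduct_sub, ← sub_mulVec]
  calc |a ⬝ᵥ (trueCov σ K t - modelCov σ φ t B L) *ᵥ a|
      ≤ frob (trueCov σ K t - modelCov σ φ t B L) * (a ⬝ᵥ a) := abs_form_le_frob _ _
    _ ≤ δ * σ ^ 2 * (a ⬝ᵥ a) := mul_le_mul_of_nonneg_right hK (dotProduct_self_nonneg_real a)
    _ = δ * (σ ^ 2 * (a ⬝ᵥ a)) := by ring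
    _ ≤ _ := mul_le_mul_of_nonneg_left h0 hδ

/-- The likelihood in terms of the reduced data. -/
theorem transNegLogLik_eq {n : ℕ} {T : Fin n → Fin m → unitInterval} {Y : Fin n → Fin m → ℝ}
    (hm : 0 < m) (hσ : 0 < σ) (hL : ∀ k, 0 ≤ L k) (hR : ∀ i, (designGram φ (T i)).PosDef) :
    transNegLogLik σ φ T Y (B, L) = 1 / (2 * (n : ℝ)) *
      (∑ i, Real.log ((m : ℝ) ^ M * (designGram φ (T i)).det ^ 2)
        + ∑ i, (Real.log (reducedCov σ φ (T i) B L).det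
          + reducedData φ (T i) (Y i) ⬝ᵥ (reducedCov σ φ (T i) B L)⁻¹ *ᵥ
            reducedData φ (T i) (Y i))) := by
  rw [transNegLogLik, ← mul_add, ← Finset.sum_add_distrib, ← Finset.sum_add_distrib]
  congr 1
  refine Finset.sum_congr rfl fun i _ => ?_
  rw [trace_inv_transCov hm hσ hL (hR i), log_det_transCov hm hσ hL (hR i)]
  ring

end Design

/-! ### Control of a quadratic form by its values on a finite grid. -/

section Grid

/-- The points of a regular grid of mesh `1/(4M)` in the cube `[-1,1]^M`. -/
noncomputable def gridPoint (M : ℕ) (k : Fin M → Fin (8 * M + 1)) : Fin M → ℝ := fun j =>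
  ((k j : ℕ) - 4 * (M : ℝ)) / (4 * M)

/-- Rounding down moves each of the `M` coordinates by at most `1 / (4M)`, so the squared distance
is at most `M / (4M)² ≤ 1/16`. -/
theorem exists_gridPoint_near {M : ℕ} (hM : 0 < M) {u : Fin M → ℝ} (hu : u ⬝ᵥ u = 1) :
    ∃ k, (u - gridPoint M k) ⬝ᵥ (u - gridPoint M k) ≤ 1 / 16 := by
  have hM' : (0 : ℝ) < M := by positivity
  have hu1 : ∀ j, |u j| ≤ 1 := fun j => by
    rw [← sq_le_one_iff_abs_le_one, ← hu, dotProduct, sq]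
    exact Finset.single_le_sum (f := fun i => u i * u i) (fun i _ => mul_self_nonneg _)
      (Finset.mem_univ j)
  have hk : ∀ j, ⌊4 * M * (u j + 1)⌋₊ < 8 * M + 1 := fun j => by
    rw [Nat.lt_succ_iff, ← Nat.cast_le (α := ℝ)]
    refine (Nat.floor_le ?_).trans ?_
    · have := (abs_le.1 (hu1 j)).1
      exact mul_nonneg (by positivity) (by linarith)
    · have := (abs_le.1 (hu1 j)).2
      push_cast
      nlinarith
  refine ⟨fun j => ⟨_, hk j⟩, ?_⟩
  have hd : ∀ j, |u j - gridPoint M (fun j => ⟨_, hk j⟩) j| ≤ 1 / (4 * M) := fun j => by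
    have h0 : 0 ≤ 4 * M * (u j + 1) := by
      have := (abs_le.1 (hu1 j)).1
      exact mul_nonneg (by positivity) (by linarith)
    have h1 := Nat.floor_le h0
    have h2 := (Nat.lt_floor_add_one (4 * M * (u j + 1))).le
    have e : u j - gridPoint M (fun j => ⟨_, hk j⟩) j
        = (4 * M * (u j + 1) - ⌊4 * M * (u j + 1)⌋₊) / (4 * M) := by
      simp only [gridPoint]
      field_simp
      ring
    rw [e, abs_of_nonneg (div_nonneg (by linarith) (by positivity))]
    gcongr
    linarith
  calc _ = ∑ j, (u j - gridPoint M (fun j => ⟨_, hk j⟩) j) ^ 2 := by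
        simp only [dotProduct, Pi.sub_apply, sq]
    _ ≤ ∑ _j : Fin M, (1 / (4 * (M : ℝ))) ^ 2 :=
        Finset.sum_le_sum fun j _ => sq_le_sq' (by linarith [(abs_le.1 (hd j)).1])
          (abs_le.1 (hd j)).2
    _ = 1 / (16 * M) := by
        rw [Finset.sum_const, Finset.card_univ, Fintype.card_fin, nsmul_eq_mul]
        field_simp
        norm_num
    _ ≤ 1 / 16 := by
        have : (1 : ℝ) ≤ M := by exact_mod_cast hM
        gcongr
        linarith

/-- A quadratic form is controlled by its values on the grid. -/
theorem form_le_of_gridPoint {M : ℕ} (hM : 0 < M) {Ξ : Matrix (Fin M) (Fin M) ℝ} (hΞ : Ξᵀ = Ξ)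
    {t : ℝ} (h : ∀ k, gridPoint M k ⬝ᵥ gridPoint M k ≤ 25 / 16 →
      |gridPoint M k ⬝ᵥ Ξ *ᵥ gridPoint M k| ≤ t) (ht : 0 ≤ t) (u : Fin M → ℝ) :
    |u ⬝ᵥ Ξ *ᵥ u| ≤ 3 * t * (u ⬝ᵥ u) := by
  -- Self-improvement of a bound `s`: with `|u - g| ≤ 1/4` the error is a bilinear value at vectors
  -- of length at most `1/4` and `9/4`. The optimal bound then satisfies `s ≤ t + 9 s / 16`, so `s ≤
  -- 16 t / 7 ≤ 3 t`.
  have step : ∀ s : ℝ, 0 ≤ s → (∀ x, |x ⬝ᵥ Ξ *ᵥ x| ≤ s * (x ⬝ᵥ x)) →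
      ∀ x, |x ⬝ᵥ Ξ *ᵥ x| ≤ (t + 9 / 16 * s) * (x ⬝ᵥ x) := by
    intro s hs hb
    have unit : ∀ u, u ⬝ᵥ u = 1 → |u ⬝ᵥ Ξ *ᵥ u| ≤ t + 9 / 16 * s := fun u hu => by
      obtain ⟨k, hk⟩ := exists_gridPoint_near hM hu
      set g := gridPoint M k with hg
      set d := u - g with hd
      have hud : -(u ⬝ᵥ d) ≤ 1 / 4 := by
        have := dotProduct_self_nonneg_real ((1 / 2 : ℝ) • u + (2 : ℝ) • d)
        simp only [dotProduct_add, add_dotProduct, smul_dotProduct, dotProduct_smul, smul_eq_mul,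
          dotProduct_comm d u, hu] at this
        linarith
      have hgu : g = u - d := by rw [hd]; abel
      have hgg : g ⬝ᵥ g ≤ 25 / 16 := by
        rw [hgu]
        simp only [dotProduct_sub, sub_dotProduct, dotProduct_comm d u, hu]
        linarith
      have h1 := h k hgg
      have e : u ⬝ᵥ Ξ *ᵥ u = g ⬝ᵥ Ξ *ᵥ g + d ⬝ᵥ Ξ *ᵥ ((2 : ℝ) • u - d) := by
        rw [hgu]
        simp only [mulVec_sub, dotProduct_sub, sub_dotProduct, mulVec_smul, dotProduct_smul,
          smul_eq_mul, dotProduct_mulVec_symm hΞ u d]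
        ring
      have hb1 : ∀ x, |x ⬝ᵥ Ξ *ᵥ x| ≤ s * ((1 : Matrix (Fin M) (Fin M) ℝ) *ᵥ x ⬝ᵥ
          (1 : Matrix (Fin M) (Fin M) ℝ) *ᵥ x) := by simpa using hb
      have hz : ((1 / 3 : ℝ) • ((2 : ℝ) • u - d)) ⬝ᵥ ((1 / 3 : ℝ) • ((2 : ℝ) • u - d)) ≤ 9 / 16 := by
        simp only [dotProduct_sub, sub_dotProduct, smul_dotProduct, dotProduct_smul, smul_eq_mul,
          dotProduct_comm d u, hu]
        linarith
      have hy : ∀ c : ℝ, c = 3 ∨ c = -3 → (c • d) ⬝ᵥ (c • d) ≤ 9 / 16 := fun c hc => by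
        simp only [smul_dotProduct, dotProduct_smul, smul_eq_mul]
        rcases hc with rfl | rfl <;> linarith
      -- The factors `3` and `1/3` balance the two lengths at `3/4`; the sign change gives the bound
      -- from the other side.
      have hp := abs_bilin_le hΞ hb1 ((3 : ℝ) • d) ((1 / 3 : ℝ) • ((2 : ℝ) • u - d))
      have hn := abs_bilin_le hΞ hb1 ((-3 : ℝ) • d) ((1 / 3 : ℝ) • ((2 : ℝ) • u - d))
      rw [one_mulVec, one_mulVec, mulVec_smul, dotProduct_smul, smul_dotProduct, smul_eq_mul,
        smul_eq_mul] at hp hn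
      have hz' := mul_le_mul_of_nonneg_left hz hs
      have hy1 := mul_le_mul_of_nonneg_left (hy 3 (Or.inl rfl)) hs
      have hy2 := mul_le_mul_of_nonneg_left (hy (-3) (Or.inr rfl)) hs
      have h2 : |d ⬝ᵥ Ξ *ᵥ ((2 : ℝ) • u - d)| ≤ 9 / 16 * s := by
        rw [abs_le]; constructor <;> linarith
      rw [e]
      exact (abs_add_le _ _).trans (add_le_add h1 h2)
    intro x
    rcases (dotProduct_self_nonneg_real x).eq_or_lt with hx | hx
    · rw [dotProduct_self_eq_zero.1 hx.symm]; simp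
    · set c := (√(x ⬝ᵥ x))⁻¹ with hc
      have hc2 : c * c = (x ⬝ᵥ x)⁻¹ := by
        rw [hc, ← mul_inv, Real.mul_self_sqrt hx.le]
      have := unit (c • x) (by
        rw [smul_dotProduct, dotProduct_smul, smul_eq_mul, smul_eq_mul, ← mul_assoc, hc2,
          inv_mul_cancel₀ hx.ne'])
      rw [smul_dotProduct, mulVec_smul, dotProduct_smul, smul_eq_mul, smul_eq_mul, ← mul_assoc, hc2,
        abs_mul, abs_of_pos (inv_pos.2 hx), inv_mul_le_iff₀ hx] at this
      linarith
  -- The infimum of the admissible bounds replaces the operator norm; the Frobenius norm shows that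
  -- there is one.
  set S : Set ℝ := {s | 0 ≤ s ∧ ∀ x, |x ⬝ᵥ Ξ *ᵥ x| ≤ s * (x ⬝ᵥ x)} with hS
  have hne : S.Nonempty := ⟨frob Ξ, frob_nonneg _, abs_form_le_frob Ξ⟩
  have hbdd : BddBelow S := ⟨0, fun s hs => hs.1⟩
  have h1 : ∀ s ∈ S, (sInf S - t) * (16 / 9) ≤ s := fun s hs => by
    have : t + 9 / 16 * s ∈ S :=
      ⟨by have := hs.1; positivity, step s hs.1 hs.2⟩
    linarith [csInf_le hbdd this]
  have h2 := le_csInf hne h1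
  rcases (dotProduct_self_nonneg_real u).eq_or_lt with hx | hx
  · rw [dotProduct_self_eq_zero.1 hx.symm]; simp
  · have h3 : |u ⬝ᵥ Ξ *ᵥ u| / (u ⬝ᵥ u) ≤ sInf S :=
      le_csInf hne fun s hs => by rw [div_le_iff₀ hx]; exact hs.2 u
    rw [div_le_iff₀ hx] at h3
    refine h3.trans (mul_le_mul_of_nonneg_right ?_ hx.le)
    linarith

end Grid

/-! ### Measurable dependence on the design. -/

section Measurability

variable {α : Type*} [MeasurableSpace α] {p q : Type*} [Fintype p] [Fintype q]

theorem measurable_mulVec_apply {A : α → Matrix p q ℝ} {v : α → q → ℝ}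
    (hA : ∀ i j, Measurable fun a => A a i j) (hv : ∀ j, Measurable fun a => v a j) (i : p) :
    Measurable fun a => (A a *ᵥ v a) i :=
  Finset.measurable_sum _ fun j _ => (hA i j).mul (hv j)

theorem measurable_dotProduct_apply {v w : α → q → ℝ} (hv : ∀ j, Measurable fun a => v a j)
    (hw : ∀ j, Measurable fun a => w a j) : Measurable fun a => v a ⬝ᵥ w a :=
  Finset.measurable_sum _ fun j _ => (hv j).mul (hw j)

variable {M m r : ℕ} {φ : Fin M → unitInterval → ℝ}

theorem continuous_designMatrix (hφ : ∀ k, Continuous (φ k)) :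
    Continuous fun t : Fin m → unitInterval => designMatrix φ t :=
  continuous_matrix fun k j => (hφ k).comp (continuous_apply j)

theorem continuous_designGram (hφ : ∀ k, Continuous (φ k)) :
    Continuous fun t : Fin m → unitInterval => designGram φ t := by
  unfold designGram
  exact ((continuous_designMatrix hφ).matrix_mul
    (continuous_designMatrix hφ).matrix_transpose).const_smul (1 / (m : ℝ))

theorem continuous_modelCov (hφ : ∀ k, Continuous (φ k)) (σ : ℝ) (B : Matrix (Fin M) (Fin r) ℝ)
    (L : Fin r → ℝ) : Continuous fun t : Fin m → unitInterval => modelCov σ φ t B L :=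
  (((((continuous_designMatrix hφ).matrix_transpose.matrix_mul continuous_const).matrix_mul
    continuous_const).matrix_mul continuous_const).matrix_mul (continuous_designMatrix hφ)).add
    continuous_const

theorem continuous_transCov (hφ : ∀ k, Continuous (φ k)) (σ : ℝ) (B : Matrix (Fin M) (Fin r) ℝ)
    (L : Fin r → ℝ) : Continuous fun t : Fin m → unitInterval => transCov σ φ t B L := by
  unfold transCov
  exact (((continuous_designMatrix hφ).matrix_mul (continuous_modelCov hφ σ B L)).matrix_mul
    (continuous_designMatrix hφ).matrix_transpose).const_smul (1 / (m : ℝ))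

theorem inv_apply_eq {ι : Type*} [Fintype ι] [DecidableEq ι] (A : Matrix ι ι ℝ) (i j : ι) :
    A⁻¹ i j = A.det⁻¹ * A.adjugate i j := by
  rw [Matrix.inv_def, Ring.inverse_eq_inv', Matrix.smul_apply, smul_eq_mul]

theorem measurable_dataCoeff (hφ : ∀ k, Continuous (φ k)) (σ : ℝ) (B : Matrix (Fin M) (Fin r) ℝ)
    (L : Fin r → ℝ) (x : Fin M → ℝ) (j : Fin m) :
    Measurable fun t : Fin m → unitInterval => dataCoeff σ φ t B L x j := by
  have hG := continuous_transCov (m := m) hφ σ B L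
  refine measurable_mulVec_apply (A := fun t : Fin m → unitInterval => (designMatrix φ t)ᵀ)
    (fun i j => ?_) (fun k => ?_) j
  · exact ((hφ j).comp (continuous_apply i)).measurable
  refine measurable_mulVec_apply
    (A := fun t : Fin m → unitInterval => (transCov σ φ t B L)⁻¹) (fun i j => ?_) (fun k => ?_) k
  · simp_rw [inv_apply_eq]
    exact hG.matrix_det.measurable.inv.mul
      (hG.matrix_adjugate.matrix_elem i j).measurable
  refine measurable_mulVec_apply (A := fun t : Fin m → unitInterval => designGram φ t)
    (v := fun _ => x)
    (fun i j => ?_) (fun k => measurable_const) k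
  exact ((continuous_designGram hφ).matrix_elem i j).measurable

end Measurability

/-! ### Uniform bound on the noise over all directions. -/

section NoiseEvent

variable {n M m r : ℕ} {σ : ℝ} {φ : Fin M → unitInterval → ℝ}
  {B : Matrix (Fin M) (Fin r) ℝ} {L : Fin r → ℝ}
  {𝒳 : Type*} [MeasurableSpace 𝒳] {ν : Measure 𝒳} [IsProbabilityMeasure ν]
  {X : unitInterval → 𝒳 → ℝ} {K : unitInterval → unitInterval → ℝ}

theorem lowRank_add_smul_form (s : ℝ) (x : Fin M → ℝ) :
    x ⬝ᵥ (B * diagonal L * Bᵀ + s • (1 : Matrix (Fin M) (Fin M) ℝ)) *ᵥ x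
      = x ⬝ᵥ (B * diagonal L * Bᵀ) *ᵥ x + s * (x ⬝ᵥ x) := by
  rw [add_mulVec, dotProduct_add, smul_mulVec, one_mulVec, dotProduct_smul, smul_eq_mul]

theorem posDef_lowRank_add_smul {s : ℝ} (hs : 0 < s) (hL : ∀ k, 0 ≤ L k) :
    (B * diagonal L * Bᵀ + s • (1 : Matrix (Fin M) (Fin M) ℝ)).PosDef :=
  PosDef.posSemidef_add (posSemidef_of_forall (transpose_lowRank B L) (lowRank_form_nonneg hL))
    (posDef_smul_one hs)

/-- The perturbation `s (R⁻¹ - 1)` is at least `-s/2`, so the reduced covariance is at least half of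
`B Λ Bᵀ + s I`, and inversion reverses the order. -/
theorem inv_reducedCov_form_le (hm : 0 < m) (hσ : 0 < σ) (hL : ∀ k, 0 ≤ L k)
    {t : Fin m → unitInterval} {ρ : ℝ} (hρ0 : 0 ≤ ρ) (hρ : ρ ≤ 1 / 4)
    (hR : ∀ x, |x ⬝ᵥ (designGram φ t - 1) *ᵥ x| ≤ ρ * (x ⬝ᵥ x)) (x : Fin M → ℝ) :
    x ⬝ᵥ (reducedCov σ φ t B L)⁻¹ *ᵥ x
      ≤ 2 * (x ⬝ᵥ (B * diagonal L * Bᵀ + (σ ^ 2 / m) • (1 : Matrix (Fin M) (Fin M) ℝ))⁻¹ *ᵥ x) := by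
  obtain ⟨hpd, hE⟩ := inv_sub_one_form_le designGram_transpose hρ0 (by linarith) hR
  have hs : 0 < σ ^ 2 / m := by positivity
  have hA := posDef_lowRank_add_smul (B := B) hs hL
  have h2 := PosDef.inv_form_antitone (hA.smul (show (0 : ℝ) < 1 / 2 by norm_num))
    (posDef_reducedCov (B := B) hm hσ hL hpd) (fun x => by
      have h3 : x ⬝ᵥ reducedCov σ φ t B L *ᵥ x
          = x ⬝ᵥ (B * diagonal L * Bᵀ + (σ ^ 2 / m) • (1 : Matrix (Fin M) (Fin M) ℝ)) *ᵥ x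
            + (σ ^ 2 / m) * (x ⬝ᵥ ((designGram φ t)⁻¹ - 1) *ᵥ x) := by
        rw [reducedCov, add_mulVec, dotProduct_add, smul_mulVec _ (_ - _), dotProduct_smul,
          smul_eq_mul]
      rw [h3, smul_mulVec, dotProduct_smul, smul_eq_mul, lowRank_add_smul_form]
      have h4 := (abs_le.1 (hE x)).1
      have h5 := lowRank_form_nonneg (B := B) hL x
      have h6 : -(1 / 2) * (x ⬝ᵥ x) ≤ x ⬝ᵥ ((designGram φ t)⁻¹ - 1) *ᵥ x := by
        nlinarith [dotProduct_self_nonneg_real x]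
      have h7 := mul_le_mul_of_nonneg_left h6 hs.le
      linarith) x
  have h3 : ((1 / 2 : ℝ) • (B * diagonal L * Bᵀ + (σ ^ 2 / m) • (1 : Matrix (Fin M) (Fin M) ℝ)))⁻¹
      = (2 : ℝ) • (B * diagonal L * Bᵀ + (σ ^ 2 / m) • (1 : Matrix (Fin M) (Fin M) ℝ))⁻¹ :=
    inv_eq_of_mul (by
      rw [smul_mul_smul_comm, PosDef.mul_inv hA]; norm_num)
  rwa [h3, smul_mulVec, dotProduct_smul, smul_eq_mul] at h2

/-- The event that the quadratic form of the noise is large for some direction has small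
probability. -/
theorem measure_noise_large_le (hM : 0 < M) (hm : 0 < m) (hσ : 0 < σ) (hL : ∀ k, 0 ≤ L k)
    (hX : IsCenteredGaussian ν X K) (hφ : ∀ k, Continuous (φ k))
    (τ : Measure (Fin n → Fin m → unitInterval)) [IsProbabilityMeasure τ]
    {G : Set (Fin n → Fin m → unitInterval)} (hG : MeasurableSet G) {ρ δ y : ℝ} (hρ0 : 0 ≤ ρ)
    (hρ : ρ ≤ 1 / 4) (hGR : ∀ T ∈ G, ∀ i x, |x ⬝ᵥ (designGram φ (T i) - 1) *ᵥ x| ≤ ρ * (x ⬝ᵥ x))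
    (hδ : δ ≤ 1) (hδ0 : 0 ≤ δ)
    (hGK : ∀ T ∈ G, ∀ i, frob (trueCov σ K (T i) - modelCov σ φ (T i) B L) ≤ δ * σ ^ 2)
    (hy : 0 ≤ y) (hy1 : y ≤ 1) :
    sampleLaw τ ν {ω | ω.1 ∈ G ∧ ¬ ∀ x,
      |∑ i, ((x ⬝ᵥ (reducedCov σ φ (ω.1 i) B L)⁻¹ *ᵥ reducedData φ (ω.1 i) (obs σ X ω i)) ^ 2
        - x ⬝ᵥ (reducedCov σ φ (ω.1 i) B L)⁻¹ *ᵥ x)|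
      ≤ n * (3 * (y + 4 * δ)) *
        (x ⬝ᵥ (B * diagonal L * Bᵀ + (σ ^ 2 / m) • (1 : Matrix (Fin M) (Fin M) ℝ))⁻¹ *ᵥ x)}
      ≤ ENNReal.ofReal ((8 * M + 1) ^ M * (2 * Real.exp (-(n * y ^ 2 / 625)))) := by
  have hs : 0 < σ ^ 2 / m := by positivity
  set A := B * diagonal L * Bᵀ + (σ ^ 2 / m) • (1 : Matrix (Fin M) (Fin M) ℝ) with hA
  -- Whitening: in the coordinates `W x` the form of `A⁻¹` is Euclidean, and the grid is placed
  -- there.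
  obtain ⟨W, W', hW, hW', hAW⟩ := exists_eq_transpose_mul_self
    (posDef_lowRank_add_smul (B := B) hs hL).inv
  rw [← hA] at hAW
  have hform : ∀ x, x ⬝ᵥ A⁻¹ *ᵥ x = (W *ᵥ x) ⬝ᵥ (W *ᵥ x) := fun x => by
    rw [hAW, ← mulVec_mulVec, dotProduct_mulVec, vecMul_transpose]
  set x : (Fin M → Fin (8 * M + 1)) → Fin M → ℝ := fun k => W' *ᵥ gridPoint M k with hx
  have hxform : ∀ k, x k ⬝ᵥ A⁻¹ *ᵥ x k = gridPoint M k ⬝ᵥ gridPoint M k := fun k => by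
    rw [hform, hx]; simp only [mulVec_mulVec, hW, one_mulVec]
  set a : (Fin M → Fin (8 * M + 1)) → (Fin m → unitInterval) → Fin m → ℝ := fun k t =>
    dataCoeff σ φ t B L (x k) with ha
  set S : (Fin M → Fin (8 * M + 1)) → Set (Sample n m 𝒳) := fun k => {ω | ω.1 ∈ G ∧
    n * (y + 4 * δ) < |∑ i, ((a k (ω.1 i) ⬝ᵥ obs σ X ω i) ^ 2
      - a k (ω.1 i) ⬝ᵥ modelCov σ φ (ω.1 i) B L *ᵥ a k (ω.1 i))|} with hS
  have hpd : ∀ T ∈ G, ∀ i, (designGram φ (T i)).PosDef := fun T hT i =>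
    (inv_sub_one_form_le designGram_transpose hρ0 (by linarith) (hGR T hT i)).1
  -- measurability
  have hSm : ∀ k, MeasurableSet (S k) := fun k => by
    have hT : ∀ i, Measurable fun ω : Sample n m 𝒳 => ω.1 i := fun i =>
      (measurable_pi_apply i).comp measurable_fst
    have hTj : ∀ i j, Measurable fun ω : Sample n m 𝒳 => ω.1 i j := fun i j =>
      (measurable_pi_apply j).comp (hT i)
    have hxi : ∀ i, Measurable fun ω : Sample n m 𝒳 => ω.2.1 i := fun i =>
      (measurable_pi_apply i).comp (measurable_fst.comp measurable_snd)
    have hei : ∀ i j, Measurable fun ω : Sample n m 𝒳 => ω.2.2 i j := fun i j =>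
      (measurable_pi_apply j).comp ((measurable_pi_apply i).comp
        (measurable_snd.comp measurable_snd))
    have hobs : ∀ i j, Measurable fun ω : Sample n m 𝒳 => obs σ X ω i j := fun i j =>
      (hX.measurable.comp ((hTj i j).prodMk (hxi i))).add ((hei i j).const_mul σ)
    have ham : ∀ i j, Measurable fun ω : Sample n m 𝒳 => a k (ω.1 i) j := fun i j =>
      (measurable_dataCoeff hφ σ B L (x k) j).comp (hT i)
    have hcov : ∀ i j j', Measurable fun ω : Sample n m 𝒳 => modelCov σ φ (ω.1 i) B L j j' :=
      fun i j j' => ((continuous_modelCov hφ σ B L).matrix_elem j j').measurable.comp (hT i)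
    have hf : Measurable fun ω : Sample n m 𝒳 => ∑ i, ((a k (ω.1 i) ⬝ᵥ obs σ X ω i) ^ 2
        - a k (ω.1 i) ⬝ᵥ modelCov σ φ (ω.1 i) B L *ᵥ a k (ω.1 i)) :=
      Finset.measurable_sum _ fun i _ =>
        ((measurable_dotProduct_apply (ham i) (hobs i)).pow_const 2).sub
          (measurable_dotProduct_apply (ham i) (measurable_mulVec_apply (hcov i) (ham i)))
    exact (measurable_fst hG).inter (measurableSet_lt measurable_const hf.abs)
  -- the event is contained in the union over the grid
  have hsub : {ω : Sample n m 𝒳 | ω.1 ∈ G ∧ ¬ ∀ x,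
      |∑ i, ((x ⬝ᵥ (reducedCov σ φ (ω.1 i) B L)⁻¹ *ᵥ reducedData φ (ω.1 i) (obs σ X ω i)) ^ 2
        - x ⬝ᵥ (reducedCov σ φ (ω.1 i) B L)⁻¹ *ᵥ x)|
      ≤ n * (3 * (y + 4 * δ)) * (x ⬝ᵥ A⁻¹ *ᵥ x)}
      ⊆ ⋃ k ∈ Finset.univ.filter fun k => gridPoint M k ⬝ᵥ gridPoint M k ≤ 25 / 16, S k := by
    rintro ω ⟨hωG, hω⟩
    by_contra hcon
    refine hω fun z => ?_
    have hk : ∀ k, gridPoint M k ⬝ᵥ gridPoint M k ≤ 25 / 16 →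
        |∑ i, ((a k (ω.1 i) ⬝ᵥ obs σ X ω i) ^ 2
          - a k (ω.1 i) ⬝ᵥ modelCov σ φ (ω.1 i) B L *ᵥ a k (ω.1 i))| ≤ n * (y + 4 * δ) := by
      intro k hk
      by_contra hlt
      refine hcon (Set.mem_biUnion (x := k) (by simpa using hk) ⟨hωG, not_le.1 hlt⟩)
    set N : Fin n → Matrix (Fin M) (Fin M) ℝ := fun i => (reducedCov σ φ (ω.1 i) B L)⁻¹ with hN
    set w : Fin n → Fin M → ℝ := fun i => N i *ᵥ reducedData φ (ω.1 i) (obs σ X ω i) with hw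
    have hNs : ∀ i, (N i)ᵀ = N i := fun i =>
      PosDef.transpose_eq (posDef_reducedCov hm hσ hL (hpd _ hωG i)).inv
    set Ξ : Matrix (Fin M) (Fin M) ℝ := W'ᵀ * (∑ i, (vecMulVec (w i) (w i) - N i)) * W' with hΞ
    have hΞs : Ξᵀ = Ξ := by
      rw [hΞ, transpose_mul, transpose_mul, transpose_transpose, transpose_sum, Matrix.mul_assoc]
      congr 3
      ext1 i
      rw [transpose_sub, transpose_vecMulVec, hNs]
    have hΞf : ∀ u, u ⬝ᵥ Ξ *ᵥ u = ∑ i, (((W' *ᵥ u) ⬝ᵥ w i) ^ 2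
        - (W' *ᵥ u) ⬝ᵥ N i *ᵥ (W' *ᵥ u)) := fun u => by
      rw [hΞ, congruence_form, sum_mulVec, dotProduct_sum]
      refine Finset.sum_congr rfl fun i _ => ?_
      rw [sub_mulVec, dotProduct_sub, vecMulVec_mulVec, dotProduct_smul, dotProduct_comm (w i)]
      simp [sq]
    have h1 := form_le_of_gridPoint hM hΞs (t := n * (y + 4 * δ)) (fun k hkk => by
      rw [hΞf]
      have := hk k hkk
      simp only [ha, dataCoeff_modelCov hm hσ hL (hpd _ hωG _)] at this
      simp only [dataCoeff_dotProduct hm hσ hL (hpd _ hωG _)] at this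
      exact this) (by positivity) (W *ᵥ z)
    rw [hΞf, mulVec_mulVec, hW', one_mulVec, ← hform] at h1
    refine h1.trans (le_of_eq ?_)
    ring
  -- the probability of each of the events
  set μ := (Measure.pi fun _ : Fin n => ν).prod
    (Measure.pi fun _ : Fin n => Measure.pi fun _ : Fin m => gaussianReal 0 1) with hμ
  have hP : ∀ k, gridPoint M k ⬝ᵥ gridPoint M k ≤ 25 / 16 →
      sampleLaw τ ν (S k) ≤ ENNReal.ofReal (2 * Real.exp (-(n * y ^ 2 / 625))) := fun k hk => by
    -- Conditionally on the design the bound does not depend on it, and sections over designs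
    -- outside `G` are empty; integrating over `τ` concludes.
    have hsec : ∀ T, μ (Prod.mk T ⁻¹' S k)
        ≤ ENNReal.ofReal (2 * Real.exp (-(n * y ^ 2 / 625))) := fun T => by
      by_cases hT : T ∈ G
      swap
      · have : Prod.mk T ⁻¹' S k = ∅ := by
          ext p; simp [hS, hT]
        rw [this, measure_empty]
        exact zero_le
      have hv : ∀ i, a k (T i) ⬝ᵥ modelCov σ φ (T i) B L *ᵥ a k (T i) ≤ 25 / 8 := fun i => by
        rw [ha]
        simp only
        rw [dataCoeff_modelCov hm hσ hL (hpd T hT i)]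
        have := inv_reducedCov_form_le (B := B) hm hσ hL hρ0 hρ (hGR T hT i) (x k)
        rw [← hA, hxform] at this
        linarith
      have hv0 : ∀ i, 0 ≤ a k (T i) ⬝ᵥ modelCov σ φ (T i) B L *ᵥ a k (T i) := fun i => by
        rw [ha]
        simp only
        rw [dataCoeff_modelCov hm hσ hL (hpd T hT i)]
        exact PosSemidef.form_nonneg (posDef_reducedCov hm hσ hL (hpd T hT i)).inv.posSemidef _
      have hvv : ∀ i, |a k (T i) ⬝ᵥ trueCov σ K (T i) *ᵥ a k (T i)
          - a k (T i) ⬝ᵥ modelCov σ φ (T i) B L *ᵥ a k (T i)| ≤ δ * (25 / 8) := fun i => by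
        refine le_trans ?_ (mul_le_mul_of_nonneg_left (hv i) hδ0)
        have := abs_trueVar_sub_le hm hσ hL (hpd T hT i) (hGK T hT i) (x k)
        rwa [← dataCoeff_modelCov hm hσ hL (hpd T hT i)] at this
      -- The model variance is at most `2 · 25/16 = 25/8` and the true one at most `1 + δ ≤ 2` times
      -- that; hence `V = 25/4` and `16 V² = 625`. The bias `25 δ / 8` is absorbed by `4 δ`.
      have hb := hX.measure_sum_sq_le σ T (fun i => a k (T i)) (V := 25 / 4) (x := y) (by norm_num)
        (fun i => by
          have := (abs_le.1 (hvv i)).2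
          linarith [hv i]) hy (by linarith)
      have hset : Prod.mk T ⁻¹' S k ⊆ {p | n * y ≤ |∑ i, ((∑ j, a k (T i) j *
          (X (T i j) (p.1 i) + σ * p.2 i j)) ^ 2
            - a k (T i) ⬝ᵥ trueCov σ K (T i) *ᵥ a k (T i))|} := by
        rintro p ⟨-, hp⟩
        have h1 : ∑ i, ((a k (T i) ⬝ᵥ obs σ X (T, p) i) ^ 2
            - a k (T i) ⬝ᵥ modelCov σ φ (T i) B L *ᵥ a k (T i))
            = ∑ i, ((∑ j, a k (T i) j * (X (T i j) (p.1 i) + σ * p.2 i j)) ^ 2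
              - a k (T i) ⬝ᵥ trueCov σ K (T i) *ᵥ a k (T i))
            + ∑ i, (a k (T i) ⬝ᵥ trueCov σ K (T i) *ᵥ a k (T i)
              - a k (T i) ⬝ᵥ modelCov σ φ (T i) B L *ᵥ a k (T i)) := by
          rw [← Finset.sum_add_distrib]
          refine Finset.sum_congr rfl fun i _ => ?_
          simp only [dotProduct, obs]
          ring
        have h2 : |∑ i, (a k (T i) ⬝ᵥ trueCov σ K (T i) *ᵥ a k (T i)
              - a k (T i) ⬝ᵥ modelCov σ φ (T i) B L *ᵥ a k (T i))| ≤ n * (δ * (25 / 8)) := by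
          refine (Finset.abs_sum_le_sum_abs _ _).trans ((Finset.sum_le_sum fun i _ => hvv i).trans ?_)
          rw [Finset.sum_const, Finset.card_univ, Fintype.card_fin, nsmul_eq_mul]
        have h3 : n * (y + 4 * δ) < |∑ i, ((a k (T i) ⬝ᵥ obs σ X (T, p) i) ^ 2
            - a k (T i) ⬝ᵥ modelCov σ φ (T i) B L *ᵥ a k (T i))| := hp
        rw [h1] at h3
        have h4 := h3.trans_le (abs_add_le _ _)
        have h5 : (n : ℝ) * (δ * (25 / 8)) ≤ n * (4 * δ) :=
          mul_le_mul_of_nonneg_left (by linarith) (Nat.cast_nonneg n)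
        show (n : ℝ) * y ≤ _
        linarith
      refine (measure_mono hset).trans ?_
      rw [← ofReal_measureReal (measure_ne_top _ _)]
      refine ENNReal.ofReal_le_ofReal (hb.trans (le_of_eq ?_))
      congr 3
      ring
    rw [sampleLaw, Measure.prod_apply (hSm k)]
    refine (lintegral_mono hsec).trans ?_
    rw [lintegral_const, measure_univ, mul_one]
  refine (measure_mono hsub).trans ((measure_biUnion_finset_le _ _).trans ?_)
  refine (Finset.sum_le_sum fun k hk => hP k (by simpa using hk)).trans ?_
  rw [Finset.sum_const, nsmul_eq_mul,
    ENNReal.ofReal_mul (p := (8 * M + 1) ^ M) (by positivity)]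
  refine mul_le_mul_left ?_ _
  rw [← ENNReal.ofReal_natCast]
  refine ENNReal.ofReal_le_ofReal ?_
  have := Finset.card_filter_le (Finset.univ : Finset (Fin M → Fin (8 * M + 1)))
    fun k => gridPoint M k ⬝ᵥ gridPoint M k ≤ 25 / 16
  rw [Finset.card_univ, Fintype.card_fun, Fintype.card_fin, Fintype.card_fin] at this
  exact_mod_cast this

end NoiseEvent

/-! ### Invariance under order and signs of the columns; rank of differences. -/

section Invariance

variable {n M m r : ℕ}

theorem colTransform_transpose_mul {B : Matrix (Fin M) (Fin r) ℝ} (hB : Bᵀ * B = 1)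
    (p : Equiv.Perm (Fin r)) {e : Fin r → ℝ} (he : ∀ k, e k = 1 ∨ e k = -1) :
    (colTransform B p e)ᵀ * colTransform B p e = 1 := by
  ext j k
  have h : ∑ i, B i (p j) * B i (p k) = if p j = p k then 1 else 0 :=
    dotProduct_transpose_of_orthonormal hB (p j) (p k)
  have h1 : ((colTransform B p e)ᵀ * colTransform B p e) j k
      = e j * e k * ∑ i, B i (p j) * B i (p k) := by
    rw [mul_apply, Finset.mul_sum]
    refine Finset.sum_congr rfl fun i _ => ?_
    simp only [colTransform, transpose_apply, of_apply]
    ring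
  rw [h1, h, Matrix.one_apply]
  by_cases hjk : j = k
  · subst hjk
    rcases he j with h | h <;> simp [h]
  · simp [hjk]

theorem lowRank_colTransform (B : Matrix (Fin M) (Fin r) ℝ) (L : Fin r → ℝ)
    (p : Equiv.Perm (Fin r)) {e : Fin r → ℝ} (he : ∀ k, e k = 1 ∨ e k = -1) :
    colTransform B p e * diagonal (fun k => L (p k)) * (colTransform B p e)ᵀ
      = B * diagonal L * Bᵀ := by
  ext i j
  rw [mul_apply, mul_apply]
  simp only [mul_diagonal, transpose_apply, colTransform, of_apply]
  rw [← Equiv.sum_comp p (fun k => B i k * L k * B j k)]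
  refine Finset.sum_congr rfl fun k _ => ?_
  rcases he k with h | h <;> rw [h] <;> ring

theorem modelCov_congr {σ : ℝ} {φ : Fin M → unitInterval → ℝ} {t : Fin m → unitInterval}
    {B B' : Matrix (Fin M) (Fin r) ℝ} {L L' : Fin r → ℝ}
    (h : B * diagonal L * Bᵀ = B' * diagonal L' * B'ᵀ) :
    modelCov σ φ t B L = modelCov σ φ t B' L' := by
  have e : ∀ (B : Matrix (Fin M) (Fin r) ℝ) L, modelCov σ φ t B L
      = (designMatrix φ t)ᵀ * (B * diagonal L * Bᵀ) * designMatrix φ t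
        + σ ^ 2 • (1 : Matrix (Fin m) (Fin m) ℝ) := fun B L => by
    rw [modelCov]; simp only [Matrix.mul_assoc]
  rw [e, e, h]

theorem transNegLogLik_congr {σ : ℝ} {φ : Fin M → unitInterval → ℝ}
    {T : Fin n → Fin m → unitInterval} {Y : Fin n → Fin m → ℝ}
    {B B' : Matrix (Fin M) (Fin r) ℝ} {L L' : Fin r → ℝ}
    (h : B * diagonal L * Bᵀ = B' * diagonal L' * B'ᵀ) :
    transNegLogLik σ φ T Y (B, L) = transNegLogLik σ φ T Y (B', L') := by
  have e : ∀ i, transCov σ φ (T i) B L = transCov σ φ (T i) B' L' := fun i => by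
    rw [transCov, transCov, modelCov_congr h]
  simp only [transNegLogLik, e]

/-- The difference factors through a matrix with `2 r` columns. -/
theorem rank_lowRank_sub_le (B B' : Matrix (Fin M) (Fin r) ℝ) (L L' : Fin r → ℝ) :
    (B * diagonal L * Bᵀ - B' * diagonal L' * B'ᵀ).rank ≤ 2 * r := by
  have e : B * diagonal L * Bᵀ - B' * diagonal L' * B'ᵀ
      = fromCols B B' * fromRows (diagonal L * Bᵀ) (-(diagonal L' * B'ᵀ)) := by
    rw [fromCols_mul_fromRows, Matrix.mul_neg, sub_eq_add_neg, Matrix.mul_assoc, Matrix.mul_assoc]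
  rw [e]
  refine (rank_mul_le_left _ _).trans ((rank_le_card_width _).trans (le_of_eq ?_))
  rw [Fintype.card_sum, Fintype.card_fin, two_mul]

end Invariance

/-! ### Localization and existence of a minimizer. -/

section Minimizer

variable {n M m r : ℕ} {σ : ℝ} {φ : Fin M → unitInterval → ℝ}
  {T : Fin n → Fin m → unitInterval} {Y : Fin n → Fin m → ℝ}

theorem continuousOn_transNegLogLik (hm : 0 < m) (hσ : 0 < σ)
    (hR : ∀ i, (designGram φ (T i)).PosDef) :
    ContinuousOn (transNegLogLik (r := r) σ φ T Y) (paramSpace M r) := by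
  have hG : ∀ i, Continuous fun θ : Matrix (Fin M) (Fin r) ℝ × (Fin r → ℝ) =>
      transCov σ φ (T i) θ.1 θ.2 := fun i => by
    unfold transCov modelCov
    fun_prop
  have hpd : ∀ i, ∀ θ ∈ paramSpace M r, (transCov σ φ (T i) θ.1 θ.2).PosDef := fun i θ hθ =>
    posDef_transCov hm hσ (fun k => (hθ.2 k).le) (hR i)
  have hinv : ∀ i, ContinuousOn (fun θ : Matrix (Fin M) (Fin r) ℝ × (Fin r → ℝ) =>
      (transCov σ φ (T i) θ.1 θ.2)⁻¹) (paramSpace M r) := fun i => by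
    simp_rw [Matrix.inv_def, Ring.inverse_eq_inv']
    exact ((hG i).matrix_det.continuousOn.inv₀ fun θ hθ => (hpd i θ hθ).det_pos.ne').smul
      (hG i).matrix_adjugate.continuousOn
  unfold transNegLogLik
  refine ContinuousOn.add (continuousOn_const.mul (continuousOn_finsetSum _ fun i _ => ?_))
    (continuousOn_const.mul (continuousOn_finsetSum _ fun i _ => ?_))
  · have hc : Continuous fun A : Matrix (Fin M) (Fin M) ℝ => trace (A * ((1 / (m : ℝ)) •
        vecMulVec (designMatrix φ (T i) *ᵥ Y i) (designMatrix φ (T i) *ᵥ Y i))) :=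
      (continuous_id.matrix_mul continuous_const).matrix_trace
    exact hc.comp_continuousOn (hinv i)
  · exact (hG i).matrix_det.continuousOn.log fun θ hθ => (hpd i θ hθ).det_pos.ne'

/-- A parameter at least as good as the optimal one is close to it in the sense of quadratic
forms. -/
theorem lowRank_form_sub_le_of_transNegLogLik_le (hn : 0 < n) (hm : 0 < m) (hσ : 0 < σ)
    {B Bs : Matrix (Fin M) (Fin r) ℝ} {L Ls : Fin r → ℝ} (hL : ∀ k, 0 ≤ L k) (hLs : ∀ k, 0 ≤ Ls k)
    {ρ ε : ℝ} (hρ0 : 0 ≤ ρ) (hρ : ρ ≤ 1 / 448)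
    (hR : ∀ i x, |x ⬝ᵥ (designGram φ (T i) - 1) *ᵥ x| ≤ ρ * (x ⬝ᵥ x))
    (hε0 : 0 ≤ ε) (hε1 : ε ≤ 1) (hε : ε * (2 * r) ≤ 1 / 128)
    (hnoise : ∀ x,
      |∑ i, ((x ⬝ᵥ (reducedCov σ φ (T i) Bs Ls)⁻¹ *ᵥ reducedData φ (T i) (Y i)) ^ 2
        - x ⬝ᵥ (reducedCov σ φ (T i) Bs Ls)⁻¹ *ᵥ x)|
      ≤ n * ε *
        (x ⬝ᵥ (Bs * diagonal Ls * Bsᵀ + (σ ^ 2 / m) • (1 : Matrix (Fin M) (Fin M) ℝ))⁻¹ *ᵥ x))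
    (hle : transNegLogLik σ φ T Y (B, L) ≤ transNegLogLik σ φ T Y (Bs, Ls)) (x : Fin M → ℝ) :
    |x ⬝ᵥ (B * diagonal L * Bᵀ - Bs * diagonal Ls * Bsᵀ) *ᵥ x| ≤ 64 * (2 * r * ε) *
      (x ⬝ᵥ (Bs * diagonal Ls * Bsᵀ + (σ ^ 2 / m) • (1 : Matrix (Fin M) (Fin M) ℝ)) *ᵥ x) := by
  have hs : 0 < σ ^ 2 / m := by positivity
  have hpd := fun i => (inv_sub_one_form_le designGram_transpose hρ0 (by linarith) (hR i)).1
  have hE := fun i => (inv_sub_one_form_le designGram_transpose hρ0 (by linarith) (hR i)).2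
  rw [transNegLogLik_eq hm hσ hL hpd, transNegLogLik_eq hm hσ hLs hpd,
    mul_le_mul_iff_right₀ (by positivity), add_le_add_iff_left, ← sub_nonpos,
    ← Finset.sum_sub_distrib] at hle
  have : Nonempty (Fin n) := ⟨⟨0, hn⟩⟩
  have key := abs_form_sub_le_of_loss_le (κ := Fin n) (posDef_lowRank_add_smul (B := Bs) hs hLs)
    (posDef_lowRank_add_smul (B := B) hs hL) hs
    (fun x => by rw [lowRank_add_smul_form]; linarith [lowRank_form_nonneg (B := Bs) hLs x])
    (fun x => by rw [lowRank_add_smul_form]; linarith [lowRank_form_nonneg (B := B) hL x])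
    (fun i => (designGram φ (T i))⁻¹ - 1)
    (fun i => by rw [transpose_sub, transpose_one, PosDef.transpose_eq (hpd i).inv])
    -- Inverting `R` doubles its distance from the identity, so `ρ ≤ 1/448` becomes `δ = 2 ρ ≤
    -- 1/224`.
    (show 0 ≤ 2 * ρ by linarith) (by linarith) hE (fun i => reducedData φ (T i) (Y i)) hε0 hε1
    (fun x => by rw [Fintype.card_fin]; exact hnoise x)
    (by
      refine le_trans (le_of_eq (Finset.sum_congr rfl fun i _ => ?_)) hle
      simp only [reducedCov]
      ring)
    (k := 2 * r) (by rw [add_sub_add_right_eq_sub]; exact rank_lowRank_sub_le _ _ _ _)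
    (by push_cast; exact hε) x
  rw [add_sub_add_right_eq_sub] at key
  push_cast at key
  exact key

/-- Existence of a global minimizer near the optimal parameter. -/
theorem exists_isREMLEstimate_near (hm : 0 < m) (hσ : 0 < σ)
    (hR : ∀ i, (designGram φ (T i)).PosDef)
    {Bs : Matrix (Fin M) (Fin r) ℝ} {Ls : Fin r → ℝ} (hBs : Bsᵀ * Bs = 1) {a b : ℝ} (ha : 0 ≤ a)
    (hb : 0 ≤ b) (hbL : ∀ k, b < Ls k)
    (hnear : ∀ B L, (B, L) ∈ paramSpace M r →
      transNegLogLik σ φ T Y (B, L) ≤ transNegLogLik σ φ T Y (Bs, Ls) →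
      ∃ (p : Equiv.Perm (Fin r)) (e : Fin r → ℝ), (∀ k, e k = 1 ∨ e k = -1) ∧
        frob ((1 - Bs * Bsᵀ) * (colTransform B p e - Bs)) ≤ a ∧
        frob (Bsᵀ * (colTransform B p e - Bs)) ≤ b ∧ ∀ k, |L (p k) - Ls k| ≤ b) :
    ∃ B L, IsREMLEstimate σ φ T Y B L ∧ frob ((1 - Bs * Bsᵀ) * (B - Bs)) ≤ a ∧
      frob (Bsᵀ * (B - Bs)) ≤ b ∧ ∀ k, |L k - Ls k| ≤ b := by
  -- A compact set containing the optimum; `b < Ls k` keeps its eigenvalues positive, hence inside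
  -- the open constraint of the parameter space.
  set N : Set (Matrix (Fin M) (Fin r) ℝ × (Fin r → ℝ)) := {θ | θ.1ᵀ * θ.1 = 1 ∧
    frob ((1 - Bs * Bsᵀ) * (θ.1 - Bs)) ≤ a ∧ frob (Bsᵀ * (θ.1 - Bs)) ≤ b ∧
    ∀ k, |θ.2 k - Ls k| ≤ b} with hN
  have hfrob : ∀ {p q : ℕ}, Continuous fun A : Matrix (Fin p) (Fin q) ℝ => frob A := by
    intro p q
    unfold frob
    exact Real.continuous_sqrt.comp (continuous_finsetSum _ fun i _ =>
      continuous_finsetSum _ fun j _ => (continuous_id.matrix_elem i j).pow 2)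
  have hNc : IsCompact N := by
    have hclosed : IsClosed N := by
      have h1 : Continuous fun θ : Matrix (Fin M) (Fin r) ℝ × (Fin r → ℝ) => θ.1ᵀ * θ.1 := by
        fun_prop
      have h2 : Continuous fun θ : Matrix (Fin M) (Fin r) ℝ × (Fin r → ℝ) =>
          frob ((1 - Bs * Bsᵀ) * (θ.1 - Bs)) := hfrob.comp (by fun_prop)
      have h3 : Continuous fun θ : Matrix (Fin M) (Fin r) ℝ × (Fin r → ℝ) =>
          frob (Bsᵀ * (θ.1 - Bs)) := hfrob.comp (by fun_prop)
      have h4 : IsClosed {θ : Matrix (Fin M) (Fin r) ℝ × (Fin r → ℝ) | ∀ k, |θ.2 k - Ls k| ≤ b} := by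
        simp only [Set.ofPred_forall]
        exact isClosed_iInter fun k => isClosed_le (by fun_prop) continuous_const
      exact (isClosed_eq h1 continuous_const).inter ((isClosed_le h2 continuous_const).inter
        ((isClosed_le h3 continuous_const).inter h4))
    set Kb : Set (Matrix (Fin M) (Fin r) ℝ) :=
      Set.univ.pi fun _ => Set.univ.pi fun _ => Set.Icc (-1) 1 with hKb
    set Kl : Set (Fin r → ℝ) := Set.univ.pi fun k => Set.Icc (Ls k - b) (Ls k + b) with hKl
    have hcomp : IsCompact (Kb ×ˢ Kl) :=
      (isCompact_univ_pi fun _ => isCompact_univ_pi fun _ => isCompact_Icc).prod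
        (isCompact_univ_pi fun _ => isCompact_Icc)
    refine hcomp.of_isClosed_subset hclosed fun θ hθ => ⟨fun i _ j _ => ?_, fun k _ => ?_⟩
    · have h1 : θ.1 i j ^ 2 ≤ 1 := by
        have h2 := dotProduct_transpose_of_orthonormal hθ.1 j j
        rw [if_pos rfl] at h2
        rw [← h2, sq]
        exact Finset.single_le_sum (f := fun i => θ.1 i j * θ.1 i j)
          (fun i _ => mul_self_nonneg _) (Finset.mem_univ i)
      exact abs_le.1 ((sq_le_one_iff_abs_le_one _).1 h1)
    · have := abs_le.1 (hθ.2.2.2 k)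
      exact ⟨by linarith, by linarith⟩
  have hNsub : N ⊆ paramSpace M r := fun θ hθ => ⟨hθ.1, fun k => by
    have := (abs_le.1 (hθ.2.2.2 k)).1
    linarith [hbL k]⟩
  have hsN : (Bs, Ls) ∈ N := by
    refine ⟨hBs, ?_, ?_, fun k => ?_⟩
    · simpa [frob] using ha
    · simpa [frob] using hb
    · simpa using hb
  obtain ⟨θ, hθN, hθ⟩ := hNc.exists_isMinOn ⟨_, hsN⟩
    ((continuousOn_transNegLogLik (Y := Y) hm hσ hR).mono hNsub)
  refine ⟨θ.1, θ.2, ⟨hNsub hθN, fun θ' hθ' => ?_⟩, hθN.2⟩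
  obtain ⟨B, L⟩ := θ'
  show transNegLogLik σ φ T Y θ ≤ transNegLogLik σ φ T Y (B, L)
  -- A competitor not worse than the optimum has, after reordering and sign changes, the same
  -- likelihood as a point of `N`; a worse one loses to the optimum, which lies in `N`.
  by_cases hle : transNegLogLik σ φ T Y (B, L) ≤ transNegLogLik σ φ T Y (Bs, Ls)
  · obtain ⟨p, e, he, h1, h2, h3⟩ := hnear B L hθ' hle
    rw [← transNegLogLik_congr (lowRank_colTransform B L p he)]
    exact hθ ⟨colTransform_transpose_mul hθ'.1 p he, h1, h2, h3⟩
  · exact (hθ hsN).trans (not_le.1 hle).le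

end Minimizer

/-! ### Auxiliary estimates for the conclusion. -/

section Assembly

variable {n M m r : ℕ} {σ : ℝ} {φ : Fin M → unitInterval → ℝ}
  {T : Fin n → Fin m → unitInterval} {Y : Fin n → Fin m → ℝ}

theorem pos_of_transpose_mul_eq_one (hr : 1 ≤ r) {B : Matrix (Fin M) (Fin r) ℝ} (hB : Bᵀ * B = 1) :
    0 < M := by
  rcases Nat.eq_zero_or_pos M with rfl | h
  · have := congrFun (congrFun hB ⟨0, hr⟩) ⟨0, hr⟩
    simp [mul_apply] at this
  · exact h

theorem hsDist_comm (K K' : unitInterval → unitInterval → ℝ) : hsDist K K' = hsDist K' K := by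
  rw [hsDist, hsDist, ← eLpNorm_neg]
  congr 1
  ext p
  simp

theorem hsDist_triangle {K₁ K₂ K₃ : unitInterval → unitInterval → ℝ}
    (h₁ : AEStronglyMeasurable (fun p : unitInterval × unitInterval => K₁ p.1 p.2)
      (volume.prod volume))
    (h₂ : AEStronglyMeasurable (fun p : unitInterval × unitInterval => K₂ p.1 p.2)
      (volume.prod volume))
    (h₃ : AEStronglyMeasurable (fun p : unitInterval × unitInterval => K₃ p.1 p.2)
      (volume.prod volume)) :
    hsDist K₁ K₃ ≤ hsDist K₁ K₂ + hsDist K₂ K₃ := by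
  have := eLpNorm_add_le (h₁.sub h₂) (h₂.sub h₃) (p := 2) (by norm_num)
  refine le_trans (le_of_eq ?_) this
  rw [hsDist]
  congr 1
  ext p
  simp

theorem aestronglyMeasurable_modelKernel (hφ : IsOrthonormalBasis φ) (B : Matrix (Fin M) (Fin r) ℝ)
    (L : Fin r → ℝ) : AEStronglyMeasurable
      (fun p : unitInterval × unitInterval => modelKernel φ B L p.1 p.2) (volume.prod volume) := by
  refine Continuous.aestronglyMeasurable ?_
  simp_rw [modelKernel_eq_coeffKernel]
  exact continuous_coeffKernel hφ _

theorem frob_diagonal_sub_le {L Ls : Fin r → ℝ} {a : ℝ} (ha : 0 ≤ a) (h : ∀ k, |L k - Ls k| ≤ a) :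
    frob (diagonal L - diagonal Ls) ≤ r * a := by
  rw [diagonal_sub]
  exact frob_diagonal_le ha h

/-- The probability bound of the union over the grid. -/
theorem grid_union_bound {η D : ℝ} (hη : 0 ≤ η) (hD : 25 * (2 + η) ≤ D) (hn : 9 ≤ n) (hM : 0 < M)
    (hMn : M ≤ n) {y : ℝ} (hy : n * y ^ 2 = D ^ 2 * (M * Real.log n)) :
    (8 * (M : ℝ) + 1) ^ M * (2 * Real.exp (-(n * y ^ 2 / 625))) ≤ 2 * (n : ℝ) ^ (-η) := by
  have hM1 : (1 : ℝ) ≤ M := by exact_mod_cast hM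
  have hn9 : (9 : ℝ) ≤ n := by exact_mod_cast hn
  have hn0 : (0 : ℝ) < n := by linarith
  have hMn' : (M : ℝ) ≤ n := by exact_mod_cast hMn
  have hlog : 0 ≤ Real.log n := Real.log_nonneg (by linarith)
  -- The number of grid points costs `exp (2 M log n)`, because `8 M + 1 ≤ 8 n + 1 ≤ n²` for `n ≥
  -- 9`.
  have h1 : (8 * (M : ℝ) + 1) ^ M ≤ Real.exp (2 * (M * Real.log n)) := by
    calc (8 * (M : ℝ) + 1) ^ M ≤ ((n : ℝ) ^ 2) ^ M := by
          refine pow_le_pow_left₀ (by positivity) ?_ _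
          nlinarith
      _ = Real.exp (2 * (M * Real.log n)) := by
          rw [← pow_mul, ← Real.exp_log (pow_pos hn0 _), Real.log_pow]
          congr 1
          push_cast
          ring
  have h2 : (2 + η) * (M * Real.log n) ≤ n * y ^ 2 / 625 := by
    rw [hy, le_div_iff₀ (by norm_num)]
    have h3 : (2 + η) * 625 ≤ D ^ 2 := by nlinarith
    have h4 : 0 ≤ M * Real.log n := by positivity
    nlinarith
  have h3 : η * Real.log n ≤ η * (M * Real.log n) :=
    mul_le_mul_of_nonneg_left (le_mul_of_one_le_left hlog hM1) hη
  calc (8 * (M : ℝ) + 1) ^ M * (2 * Real.exp (-(n * y ^ 2 / 625)))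
      ≤ Real.exp (2 * (M * Real.log n)) * (2 * Real.exp (-(n * y ^ 2 / 625))) :=
        mul_le_mul_of_nonneg_right h1 (by positivity)
    _ = 2 * Real.exp (2 * (M * Real.log n) - n * y ^ 2 / 625) := by
        rw [sub_eq_add_neg, Real.exp_add]; ring
    _ ≤ 2 * Real.exp (-(η * Real.log n)) := by
        refine mul_le_mul_of_nonneg_left (Real.exp_le_exp.2 ?_) zero_le_two
        linarith
    _ = 2 * (n : ℝ) ^ (-η) := by
        rw [Real.rpow_def_of_pos hn0]
        congr 2
        ring

end Assembly

end REML

/-! ### The theorem. -/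

theorem theorem2
    -- the rank, the number of basis functions, the number of measurements per curve, the noise level
    (r : ℕ) (hr : 1 ≤ r) (M m : ℕ → ℕ) (σ : ℕ → ℝ)
    (hσ : ∀ n, 0 < σ n) (hσm : ∀ n, σ n ^ 2 ≤ m n)
    (hM : Tendsto (fun n : ℕ => (M n : ℝ) * Real.log n / n) atTop (𝓝 0))
    (hB1 : REML.CondB1' m)
    -- the Gaussian process and its covariance kernel
    {𝒳 : ℕ → Type*} [∀ n, MeasurableSpace (𝒳 n)] (ν : ∀ n, Measure (𝒳 n))
    [∀ n, IsProbabilityMeasure (ν n)] (X : ∀ n, unitInterval → 𝒳 n → ℝ)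
    (K : ∀ _ : ℕ, unitInterval → unitInterval → ℝ)
    (hX : ∀ n, REML.IsCenteredGaussian (ν n) (X n) (K n))
    (lam : ℕ → ℕ → ℝ) (psi : ℕ → ℕ → ℝ → ℝ)
    (hK : ∀ n, REML.IsSpectralDecomposition (K n) (lam n) (psi n))
    (c₁ c₂ C₀ : ℝ) (hA1 : ∀ n, REML.CondA1 r c₁ c₂ (lam n)) (hA2 : ∀ n, REML.CondA2 r C₀ (psi n))
    -- the basis and the optimal parameter
    (φ : ∀ n, Fin (M n) → unitInterval → ℝ) (hφ : ∀ n, REML.IsOrthonormalBasis (φ n))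
    (Bs : ∀ n, Matrix (Fin (M n)) (Fin r) ℝ) (lams : ℕ → Fin r → ℝ)
    (hθs : ∀ n, (Bs n, lams n) ∈ REML.paramSpace (M n) r) (hlams : ∀ n, StrictAnti (lams n))
    (happrox : ∃ C : ℝ, ∀ᶠ n in atTop,
      REML.hsDist (K n) (REML.modelKernel (φ n) (Bs n) (lams n))
        ≤ ENNReal.ofReal (C * REML.rate M n))
    -- the design
    (τ : ∀ n, Measure (Fin n → Fin (m n) → unitInterval)) [∀ n, IsProbabilityMeasure (τ n)]
    (hC : REML.CondC' σ K φ Bs lams τ) (hD : REML.CondD σ φ Bs τ)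
    (η : ℝ) (hη : 0 < η) :
    ∃ c₀ : ℝ, 0 < c₀ ∧ ∃ c : ℝ, 0 < c ∧
      REML.HighProb (fun n => REML.sampleLaw (τ n) (ν n)) η fun n =>
        {ω | let α : ℝ := c₀ * σ n * Real.sqrt (M n * Real.log n / (n * m n))
          ∃ (B : Matrix (Fin (M n)) (Fin r) ℝ) (L : Fin r → ℝ),
            REML.IsREMLEstimate (σ n) (φ n) ω.1 (REML.obs (σ n) (X n) ω) B L ∧
            REML.frob ((1 - Bs n * (Bs n).transpose) * (B - Bs n)) ≤ α ∧
            REML.frob ((Bs n).transpose * (B - Bs n)) ≤ Real.sqrt (m n / σ n ^ 2) * α ∧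
            REML.frob (Matrix.diagonal L - Matrix.diagonal (lams n))
              ≤ Real.sqrt (m n / σ n ^ 2) * α ∧
            REML.hsDist (REML.modelKernel (φ n) B L) (K n) ≤ ENNReal.ofReal (c * REML.rate M n)} :=
  by
  open REML Matrix in
  have hc₂ : 0 < c₂ := by
    obtain ⟨h1, h2⟩ := (hA1 0).2 0 hr
    exact (inv_pos.2 (sub_pos.2 h1)).trans_le h2
  have hc₁ : 0 ≤ c₁ := ((hK 0).nonneg 0).trans (hA1 0).1
  have hr1 : (1 : ℝ) ≤ r := by exact_mod_cast hr
  have hc : 0 < 1 / (2 * c₂) := by positivity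
  obtain ⟨κ₀, hκ₀, C₁, hC₁, hclose⟩ := exists_colTransform_close r hc
    (show 0 < c₁ + 1 by linarith) hc
  obtain ⟨Ca, hCa⟩ := happrox
  obtain ⟨cC, hcC, PC, hPC⟩ := hC η hη
  obtain ⟨cD, cD', hcD, -, PD, hPD⟩ := hD η hη
  -- `D₁` times the rate is the deviation allowed on the grid, large enough to beat the grid size
  -- and leave `n^(-η)`. `D₂` adds the bias from C' and the factor `3` of the grid argument.
  set D₁ : ℝ := 25 * (2 + η) with hD₁
  set D₂ : ℝ := 3 * (D₁ + 4 * cC) with hD₂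
  have hD₁0 : 0 < D₁ := by positivity
  have hD₂0 : 0 < D₂ := by positivity
  -- the bound of the relative error of the quadratic form, divided by the rate
  set q : ℝ := 64 * (2 * r * D₂) with hq
  have hq0 : 0 < q := by positivity
  set A : ℝ := 4 * (r + 1) ^ 3 * (c₁ + 1 + 1) with hA
  have hA0 : 0 < A := by positivity
  -- The factor `r` pays for bounding the Frobenius norm of a diagonal matrix by its largest entry.
  -- The probability constant collects C', D and the noise event.
  refine ⟨r * (C₁ * q), by positivity, A * (C₁ * q) + |Ca|, by positivity, |PC| + |PD| + 2, ?_⟩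
  have hrate : Tendsto (fun n => rate M n) atTop (𝓝 0) := by
    have := (Real.continuous_sqrt.tendsto 0).comp hM
    rw [Real.sqrt_zero] at this
    exact this
  have small : ∀ a b : ℝ, 0 < b → ∀ᶠ n in atTop, a * rate M n < b := fun a b hb => by
    have := hrate.const_mul a
    rw [mul_zero] at this
    exact this.eventually_lt_const hb
  have hlogn : Tendsto (fun n : ℕ => Real.log n) atTop atTop :=
    Real.tendsto_log_atTop.comp tendsto_natCast_atTop_atTop
  filter_upwards [hPC, hPD, hCa, eventually_ge_atTop 9, hM.eventually_le_const zero_lt_one,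
    hlogn.eventually_ge_atTop 1, hlogn.eventually_ge_atTop ((448 * cD) ^ 2),
    small |Ca| (1 / (16 * (r + 1) * c₂)) (by positivity), small |Ca| (1 / (2 * (r + 1))) (by positivity),
    small D₁ 1 one_pos, small cC 1 one_pos, small D₂ 1 one_pos,
    small (D₂ * (2 * r)) (1 / 128) (by norm_num), small q κ₀ hκ₀, small (C₁ * q) (1 / (2 * c₂)) hc,
    small (C₁ * q) 1 one_pos]
    with n hPCn hPDn hCan hn9 hMn hlog1 hlogD e1 e2 e3 e4 e5 e6 e7 e8 e9
  set R := rate M n with hR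
  have hR0 : 0 ≤ R := Real.sqrt_nonneg _
  obtain ⟨hBs, hls⟩ := hθs n
  have hMpos : 0 < M n := pos_of_transpose_mul_eq_one hr hBs
  have hσn := hσ n
  have hmpos : 0 < m n := by
    have : (0 : ℝ) < m n := (pow_pos hσn 2).trans_le (hσm n)
    exact_mod_cast this
  have hm' : (0 : ℝ) < m n := by exact_mod_cast hmpos
  have hn' : (0 : ℝ) < n := by
    have : (9 : ℝ) ≤ n := by exact_mod_cast hn9
    linarith
  have hMlen : M n ≤ n := by
    rw [div_le_one hn'] at hMn
    have : (M n : ℝ) ≤ n := (le_mul_of_one_le_right (Nat.cast_nonneg _) hlog1).trans hMn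
    exact_mod_cast this
  have hs : 0 < σ n ^ 2 / m n := by positivity
  have hs1 : σ n ^ 2 / m n ≤ 1 := by rw [div_le_one hm']; exact hσm n
  have hRsq : n * R ^ 2 = M n * Real.log n := by
    rw [hR, rate, Real.sq_sqrt (by positivity)]
    field_simp
  -- separation of the eigenvalues of the optimal parameter
  obtain ⟨-, hlow, hupp, hgap⟩ := eigenvalue_separation hr (hA1 n) (hK n) (hφ n) hBs hls
    (show 0 ≤ |Ca| * R by positivity) e1.le e2.le
    (hCan.trans (ENNReal.ofReal_le_ofReal (mul_le_mul_of_nonneg_right (le_abs_self _) hR0)))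
  -- the good designs
  set EC : Set (Fin n → Fin (m n) → unitInterval) := {T | ∀ i, 1 / (m n : ℝ) *
        frob (trueCov (σ n) (K n) (T i) - modelCov (σ n) (φ n) (T i) (Bs n) (lams n))
      ≤ cC * (σ n ^ 2 / m n) * rate M n} with hEC
  set ED : Set (Fin n → Fin (m n) → unitInterval) := {T | ∀ i,
        opNorm (designGram (φ n) (T i) - 1) ≤ cD * Real.sqrt (σ n ^ 2 / (m n * Real.log n)) ∧
        opNorm ((Bs n).transpose * designGram (φ n) (T i) * Bs n - 1)
          ≤ cD' * (σ n ^ 2 / (m n * Real.log n))} with hED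
  -- The good designs need not form a measurable set, so the bad ones are replaced by a measurable
  -- hull of the same measure.
  set G : Set (Fin n → Fin (m n) → unitInterval) := (toMeasurable (τ n) (EC ∩ ED)ᶜ)ᶜ with hG
  have hGm : MeasurableSet G := (measurableSet_toMeasurable _ _).compl
  have hGsub : G ⊆ EC ∩ ED := by
    rw [hG, Set.compl_subset_comm]; exact subset_toMeasurable _ _
  have hGp : τ n Gᶜ ≤ ENNReal.ofReal ((|PC| + |PD|) * (n : ℝ) ^ (-η)) := by
    rw [hG, compl_compl, measure_toMeasurable, Set.compl_inter]
    refine (measure_union_le _ _).trans ((add_le_add hPCn hPDn).trans ?_)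
    have hp : 0 ≤ (n : ℝ) ^ (-η) := by positivity
    rw [add_mul, ENNReal.ofReal_add (by positivity) (by positivity)]
    exact add_le_add
      (ENNReal.ofReal_le_ofReal (mul_le_mul_of_nonneg_right (le_abs_self _) hp))
      (ENNReal.ofReal_le_ofReal (mul_le_mul_of_nonneg_right (le_abs_self _) hp))
  have hGR : ∀ T ∈ G, ∀ i x, |x ⬝ᵥ (designGram (φ n) (T i) - 1) *ᵥ x| ≤ 1 / 448 * (x ⬝ᵥ x) := by
    intro T hT i x
    refine (abs_form_le_opNorm _ _).trans
      (mul_le_mul_of_nonneg_right (((hGsub hT).2 i).1.trans ?_) (dotProduct_self_nonneg_real x))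
    have h1 : Real.sqrt (σ n ^ 2 / (m n * Real.log n)) ≤ 1 / (448 * cD) := by
      rw [Real.sqrt_le_left (by positivity)]
      calc σ n ^ 2 / (m n * Real.log n) = σ n ^ 2 / m n / Real.log n := by rw [div_div]
        _ ≤ 1 / (448 * cD) ^ 2 := div_le_div₀ zero_le_one hs1 (by positivity) hlogD
        _ = _ := by rw [_root_.one_div_pow]
    calc cD * Real.sqrt (σ n ^ 2 / (m n * Real.log n)) ≤ cD * (1 / (448 * cD)) :=
          mul_le_mul_of_nonneg_left h1 hcD.le
      _ = 1 / 448 := by field_simp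
  have hGK : ∀ T ∈ G, ∀ i, frob (trueCov (σ n) (K n) (T i)
      - modelCov (σ n) (φ n) (T i) (Bs n) (lams n)) ≤ cC * R * σ n ^ 2 := by
    intro T hT i
    have h1 := (hGsub hT).1 i
    rw [one_div, inv_mul_le_iff₀ hm'] at h1
    refine h1.trans (le_of_eq ?_)
    rw [hR]
    field_simp
  have hnoise := measure_noise_large_le hMpos hmpos hσn (fun k => (hls k).le) (hX n)
    (fun k => (hφ n).continuous k) (τ n) hGm (show (0 : ℝ) ≤ 1 / 448 by norm_num) (by norm_num) hGR
    e4.le (by positivity) hGK (show 0 ≤ D₁ * R by positivity) e3.le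
  have hyR : n * (D₁ * R) ^ 2 = D₁ ^ 2 * (M n * Real.log n) := by rw [← hRsq]; ring
  have hnoise' := hnoise.trans (ENNReal.ofReal_le_ofReal
    (grid_union_bound hη.le le_rfl hn9 hMpos hMlen hyR))
  -- on the good event the conclusion holds
  set NE := {ω : Sample n (m n) (𝒳 n) | ω.1 ∈ G ∧ ¬ ∀ x,
      |∑ i, ((x ⬝ᵥ (reducedCov (σ n) (φ n) (ω.1 i) (Bs n) (lams n))⁻¹ *ᵥ
          reducedData (φ n) (ω.1 i) (obs (σ n) (X n) ω i)) ^ 2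
        - x ⬝ᵥ (reducedCov (σ n) (φ n) (ω.1 i) (Bs n) (lams n))⁻¹ *ᵥ x)|
      ≤ n * (3 * (D₁ * R + 4 * (cC * R))) * (x ⬝ᵥ (Bs n * diagonal (lams n) * (Bs n)ᵀ
          + (σ n ^ 2 / m n) • (1 : Matrix (Fin (M n)) (Fin (M n)) ℝ))⁻¹ *ᵥ x)} with hNE
  have hDR : 3 * (D₁ * R + 4 * (cC * R)) = D₂ * R := by rw [hD₂]; ring
  have hqR : 64 * (2 * r * (D₂ * R)) = q * R := by rw [hq]; ring
  -- Since `σ √(M log n / (n m)) = √s · R`, the radius `α` carries exactly the factor `√s` of the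
  -- orthogonal part, and `√(m / σ²)` removes it.
  have hα : r * (C₁ * q) * σ n * Real.sqrt (M n * Real.log n / (n * m n))
      = r * (C₁ * √(σ n ^ 2 / m n) * (q * R)) := by
    have h1 : (M n : ℝ) * Real.log n / (n * m n) = M n * Real.log n / n / m n := by rw [div_div]
    rw [h1, Real.sqrt_div' _ hm'.le, Real.sqrt_div' _ hm'.le, Real.sqrt_sq hσn.le, hR, rate]
    ring
  have hβ : Real.sqrt (m n / σ n ^ 2)
      * (r * (C₁ * q) * σ n * Real.sqrt (M n * Real.log n / (n * m n))) = r * (C₁ * (q * R)) := by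
    rw [hα]
    have h1 : Real.sqrt (m n / σ n ^ 2) * √(σ n ^ 2 / m n) = 1 := by
      rw [← Real.sqrt_mul (by positivity), div_mul_div_cancel₀ (by positivity),
        div_self hm'.ne', Real.sqrt_one]
    calc _ = r * (C₁ * (q * R)) * (Real.sqrt (m n / σ n ^ 2) * √(σ n ^ 2 / m n)) := by ring
      _ = _ := by rw [h1, mul_one]
  have hbR : 0 ≤ C₁ * (q * R) := by positivity
  have hgood : ∀ ω : Sample n (m n) (𝒳 n), ω.1 ∈ G → ω ∉ NE →
      ∃ (B : Matrix (Fin (M n)) (Fin r) ℝ) (L : Fin r → ℝ),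
        IsREMLEstimate (σ n) (φ n) ω.1 (obs (σ n) (X n) ω) B L ∧
        frob ((1 - Bs n * (Bs n)ᵀ) * (B - Bs n)) ≤ C₁ * √(σ n ^ 2 / m n) * (q * R) ∧
        frob ((Bs n)ᵀ * (B - Bs n)) ≤ C₁ * (q * R) ∧ ∀ k, |L k - lams n k| ≤ C₁ * (q * R) := by
    intro ω hωG hω
    rw [hNE, Set.mem_ofPred_eq, not_and, not_not] at hω
    have hω' := hω hωG
    rw [hDR] at hω'
    refine exists_isREMLEstimate_near hmpos hσn (fun i =>
      (inv_sub_one_form_le designGram_transpose (by norm_num) (by norm_num) (hGR _ hωG i)).1) hBs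
      (by positivity) hbR (fun k => ?_) fun B L hθ hle => ?_
    · refine lt_of_lt_of_le ?_ (hlow k)
      rw [← mul_assoc]; exact e8
    · refine hclose (M n) B (Bs n) L (lams n) (σ n ^ 2 / m n) (q * R) hθ.1 hBs hθ.2 hlow hupp hgap
        hs hs1 (by positivity) e7.le fun x => ?_
      rw [← hqR]
      exact lowRank_form_sub_le_of_transNegLogLik_le (by omega) hmpos hσn (fun k => (hθ.2 k).le)
        (fun k => (hls k).le) (by norm_num) le_rfl (hGR _ hωG) (by positivity) e5.le
        (by rw [mul_right_comm]; exact e6.le) hω' hle x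
  -- The failure event is contained in the union of the bad designs and the event of large noise
  -- over a good design.
  refine (measure_mono (t := {ω : Sample n (m n) (𝒳 n) | ω.1 ∈ Gᶜ} ∪ NE) fun ω hω => ?_).trans ?_
  · by_contra hcon
    rw [Set.mem_union, not_or] at hcon
    have hωG : ω.1 ∈ G := by
      have := hcon.1
      simpa using this
    obtain ⟨B, L, hE, h1, h2, h3⟩ := hgood ω hωG hcon.2
    have hB : Bᵀ * B = 1 := hE.1.1
    have hle1 : ∀ z : ℝ, 0 ≤ z → z ≤ r * z := fun z hz => le_mul_of_one_le_left hz hr1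
    refine hω ⟨B, L, hE, ?_, ?_, ?_, ?_⟩
    · rw [hα]; exact h1.trans (hle1 _ (by positivity))
    · rw [hβ]; exact h2.trans (hle1 _ hbR)
    · rw [hβ]; exact frob_diagonal_sub_le hbR h3
    · have hb1 : C₁ * (q * R) ≤ 1 := by rw [← mul_assoc]; exact e9.le
      have hsq : √(σ n ^ 2 / m n) ≤ 1 := Real.sqrt_le_one.2 hs1
      have h4 := frob_lowRank_sub_le (C := c₁ + 1) hB hBs hbR hb1 (by linarith)
        (fun k => by rw [abs_of_pos (hls k)]; exact hupp k)
        (h1.trans (by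
          calc C₁ * √(σ n ^ 2 / m n) * (q * R) = C₁ * (q * R) * √(σ n ^ 2 / m n) := by ring
            _ ≤ C₁ * (q * R) := mul_le_of_le_one_right hbR hsq)) h2 h3
      refine (hsDist_triangle (K₂ := modelKernel (φ n) (Bs n) (lams n))
        (aestronglyMeasurable_modelKernel (hφ n) B L)
        (aestronglyMeasurable_modelKernel (hφ n) (Bs n) (lams n))
        (hK n).aestronglyMeasurable).trans ?_
      rw [hsDist_modelKernel (hφ n), hsDist_comm _ (K n), add_mul,
        ENNReal.ofReal_add (by positivity) (by positivity)]
      refine add_le_add (ENNReal.ofReal_le_ofReal (h4.trans (le_of_eq ?_)))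
        (hCan.trans (ENNReal.ofReal_le_ofReal (mul_le_mul_of_nonneg_right (le_abs_self _) hR0)))
      rw [hA]; ring
  · refine (measure_union_le _ _).trans ?_
    have h1 : sampleLaw (τ n) (ν n) {ω : Sample n (m n) (𝒳 n) | ω.1 ∈ Gᶜ} = τ n Gᶜ := by
      have : {ω : Sample n (m n) (𝒳 n) | ω.1 ∈ Gᶜ} = Gᶜ ×ˢ Set.univ := by ext ω; simp
      rw [this, sampleLaw, Measure.prod_prod, measure_univ, mul_one]
    rw [h1]
    refine (add_le_add hGp hnoise').trans ?_
    rw [← ENNReal.ofReal_add (by positivity) (by positivity), ← add_mul]
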